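/- Let $H$ be a real Hilbert space with closed unit ball $\mathbb B$, let $T>0$, and write $d_S$ for the distance function of $S\subset H$. For $x\in S$ let $T(S;x)$ be the Clarke tangent cone (all $v$ such that for all $S\ni u_n\to x$ and $\tau_n\downarrow 0$, $\tau_n>0$, there are $w_n\to v$ with $u_n+\tau_nw_n\in S$), let $N(S;x)=\{\zeta:\langle \zeta,v\rangle\le 0\ \forall v\in T(S;x)\}$ be the Clarke normal cone ($N(S;x)=\emptyset$ if $x\notin S$), and let $N^P(S;x)$ be the proximal normal cone (all $\zeta$ for which there are $\sigma\ge0$, $r>0$ with $\langle\zeta,y-x\rangle\le\sigma\|y-x\|^2$ for all $y\in S$ with $\|y-x\|<r$). For $\rho\in\,]0,+\infty]$ a closed set $S$ is $\rho$-uniformly prox-regular if $\langle\zeta,y-x\rangle\le\frac{\|\zeta\|}{2\rho}\|y-x\|^2$ for all $x,y\in S$, $\zeta\in N^P(S;x)$ (with $1/\rho=0$ if $\rho=+\infty$). **Assumptions.** Let $C:[0,T]\rightrightarrows H$ have nonempty closed $\rho$-uniformly prox-regular values ($\rho\in\,]0,+\infty]$ fixed) with Hausdorff distance $\operatorname{Haus}(C(t),C(s))\le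 L_C|t-s|$ for all $s,t\in[0,T]$, where $L_C\ge0$, and let $x_0\in C(0)$. Let $F:[0,T]\times H\rightrightarrows H$ have nonempty closed convex values and satisfy: * (H1) for all $t\in[0,T]$, $F(t,\cdot)$ is upper semicontinuous from $H$ to $H$ with the weak topology, i.e. $\{x:F(t,x)\cap D\neq\emptyset\}$ is closed for every weakly closed $D$; * (H2) there is a Lipschitz function $h:H\to[0,\infty[$, with constant $L_h$, such that for every $x\in H$, $d_{F(t,x)}(0)\le h(x)$ for a.e. $t\in[0,T]$; * (H3) $\gamma>0$ and $f:[0,T]\times H\to H$ are such that $f(\cdot,x)$ is (strongly, Lebesgue) measurable for all $x$, and $f(t,x)\in F(t,x)$, $\|f(t,x)\|^2<d_{F(t,x)}(0)^2+\gamma$ for all $(t,x)$; * for every $r>0$ there is a nonnegative integrable $k_r$ on $[0,T]$ with $\langle v_1-v_2,x_1-x_2\rangle\le k_r(t)\|x_1-x_2\|^2$ for all $t\in[0,T]$, $x_1,x_2\in r\mathbb B$, $v_i\in F(t,x_i)$. A *solution* is an absolutely continuous $x:[0,T]\to H$ with $x(0)=x_0$ that for a.e. $t\in[0,T]$ is differentiable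 at $t$ with $$\dot x(t)\in -N(C(t);x(t))+F(t,x(t)).$$ **Algorithm.** For $n\ge1$ let $\mu_n=T/n$, $t^n_k=k\mu_n$, and let $\varepsilon_n,\eta_n>0$ with $\varepsilon_n/\mu_n^2\to0$, $\eta_n/\mu_n\to0$. Let $\operatorname{proj}_S^{\varepsilon,\eta}(x)$ be the set of $z$ with $\|x-z\|^2<d_S(x)^2+\varepsilon$ that lie in some closed set $S_\eta$ with $S\subset S_\eta\subset S+\eta\mathbb B$. Let $x^n_0=x_0$ and, for $0\le k<n$, $$x^n_{k+1}\in\operatorname{proj}^{\varepsilon_n,\eta_n}_{C(t^n_{k+1})}\Bigl(x^n_k+\int_{t^n_k}^{t^n_{k+1}}f(s,x^n_k)\,ds\Bigr),$$ and let $x_n(0)=x_0$ and, for $t\in\,]t^n_k,t^n_{k+1}]$, $$x_n(t)=x^n_k+\frac{t-t^n_k}{\mu_n}\Bigl(x^n_{k+1}-x^n_k-\int_{t^n_k}^{t^n_{k+1}}f(s,x^n_k)\,ds\Bigr)+\int_{t^n_k}^tf(s,x^n_k)\,ds .$$ **Theorem.** (a) Every sequence $(x_n)$ generated by this algorithm converges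 uniformly on $[0,T]$ to a Lipschitz continuous solution $x$ (no compactness being assumed). (b) Rate. Let $c\ge\sup_{n\ge1}(\sqrt{\varepsilon_n}+\eta_n)/\mu_n$ and set $K_1=T(L_C+2h(x_0)+2\sqrt\gamma+c)e^{2L_hT}$, $\alpha=h(x_0)+L_hK_1+\sqrt\gamma$, $K_2=K_1+\|x_0\|+T(L_C+2\alpha+c)$, $K_3=L_C+h(x_0)+L_h(K_2+\|x_0\|)+\sqrt\gamma$, $K_4=L_C+2\alpha$, $K_5=K_4+L_C+2\alpha$, $K_7=c+L_C+2\alpha$, $\sigma_n=2\varepsilon_n+2K_3\eta_n\mu_n+4\eta_n^2$, $\kappa=\int_0^Tk_{K_2}(s)\,ds$; let $\Gamma\ge\frac1{\mu_n}\bigl(4\sqrt{\sigma_n}+(L_C+h(x^n_j)+\sqrt\gamma)\mu_n+\eta_n\bigr)$ for all $n\ge1$, $0\le j<n$; and let $$\begin{aligned}A_n={}&4\alpha T\bigl(2\sqrt{\sigma_n}+\sqrt{\varepsilon_n}+2\eta_n+K_4\mu_n\bigr)+4TK_7\bigl(K_5\mu_n+2(\sqrt{\varepsilon_n}+\sqrt{\sigma_n})+3\eta_n\bigr)+4T\Gamma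 L_C\mu_n\\&+2T\,\tfrac{3\sqrt{\sigma_n}+\eta_n}{\mu_n}\bigl(2\sqrt{\sigma_n}+\eta_n+2K_2\bigr)+\tfrac{16T\Gamma}{\rho}\bigl(2(\sqrt{\varepsilon_n}+\sqrt{\sigma_n})+3\eta_n+K_5\mu_n\bigr)^2\\&+4\kappa\bigl(3\sqrt{\varepsilon_n}+3\eta_n+(K_4+K_5)\mu_n\bigr)^2.\end{aligned}$$ Then for all $n>2L_CT/\rho$ and $t\in[0,T]$, $$\|x_n(t)-x(t)\|^2\le A_n\exp\Bigl(\tfrac{16\Gamma}{\rho}T+4\kappa\Bigr),$$ and there is $D>0$ such that for all $n\ge1$ $$A_n\le D\Bigl(\sqrt{\varepsilon_n}+\eta_n+\mu_n+\frac{\sqrt{\varepsilon_n}}{\mu_n}+\frac{\eta_n}{\mu_n}+\sqrt{\frac{\eta_n}{\mu_n}}\Bigr).$$ (c) If there is a nonnegative $c\in L^1([0,T])$ such that for a.e. $t\in[0,T]$, $\|y\|\le c(t)(\|x\|+1)$ for all $x\in H$ and $y\in F(t,x)$, then any two solutions coincide on $[0,T]$. -/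

import Mathlib

open Set Filter Topology MeasureTheory
open scoped NNReal ENNReal Pointwise

namespace SweepingProcess

section Cones

variable {H : Type*} [NormedAddCommGroup H] [InnerProductSpace ℝ H]

/-- The Clarke tangent cone `T(S; x)`, in its sequential form. -/
def clarkeTangentCone (S : Set H) (x : H) : Set H :=
  {h | ∀ (u : ℕ → H) (τ : ℕ → ℝ), (∀ n, u n ∈ S) → Tendsto u atTop (𝓝 x) →
      (∀ n, 0 < τ n) → Tendsto τ atTop (𝓝 0) →
      ∃ w : ℕ → H, Tendsto w atTop (𝓝 h) ∧ ∀ n, u n + τ n • w n ∈ S}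

/-- The Clarke normal cone `N(S; x)`: the negative polar of the Clarke tangent cone if `x ∈ S`,
and the empty set if `x ∉ S`. -/
def clarkeNormalCone (S : Set H) (x : H) : Set H :=
  {v | x ∈ S ∧ ∀ h ∈ clarkeTangentCone S x, inner ℝ v h ≤ 0}

/-- The proximal normal cone `N^P(S; x)`, that is, the proximal subdifferential at `x ∈ S` of the
indicator function of `S` (equal to `0` on `S` and to `+∞` off `S`). -/
def proximalNormalCone (S : Set H) (x : H) : Set H :=
  {ζ | x ∈ S ∧ ∃ σ : ℝ, 0 ≤ σ ∧ ∃ r : ℝ, 0 < r ∧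
      ∀ y ∈ S, y ∈ Metric.ball x r → inner ℝ ζ (y - x) ≤ σ * ‖y - x‖ ^ 2}

/-- `S` is `ρ`-uniformly prox-regular, for `ρ ∈ (0, +∞]`.
The number `1 / ρ` is `ρ⁻¹.toReal`, which is `0` for `ρ = +∞`. -/
def IsUniformlyProxRegular (ρ : ℝ≥0∞) (S : Set H) : Prop :=
  IsClosed S ∧ ∀ x ∈ S, ∀ ζ ∈ proximalNormalCone S x, ∀ y ∈ S,
    inner ℝ ζ (y - x) ≤ ‖ζ‖ / 2 * ρ⁻¹.toReal * ‖y - x‖ ^ 2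

/-- A set-valued map `G` is upper semicontinuous from `H` (with the norm topology) into `H` with
the weak topology: the inverse image `{x | G x ∩ D ≠ ∅}` of each weakly closed set `D` is
closed. -/
def IsWeaklyUpperSemicontinuous (G : H → Set H) : Prop :=
  ∀ D : Set H, IsClosed (toWeakSpace ℝ H '' D) → IsClosed {x | (G x ∩ D).Nonempty}

/-- The set `proj_S^ε(x)` of `ε`-approximate projections. -/
def approxProj (ε : ℝ) (S : Set H) (x : H) : Set H :=
  {z | z ∈ S ∧ ‖x - z‖ ^ 2 < Metric.infDist x S ^ 2 + ε}

/-- The `ε`-`η` approximate projections of `x` on `S`. The closed set `S'` with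
`S ⊆ S' ⊆ S + η 𝔹` may be any such set. -/
def inexactProj (ε η : ℝ) (S : Set H) (x : H) : Set H :=
  {z | ∃ S' : Set H, IsClosed S' ∧ S ⊆ S' ∧ S' ⊆ S + Metric.closedBall (0 : H) η ∧
      z ∈ S' ∧ ‖x - z‖ ^ 2 < Metric.infDist x S ^ 2 + ε}

/-- `x` is a solution on `[0, T]` of the perturbed sweeping process
`x' ∈ -N(C(t); x) + F(t, x)` a.e., `x(0) = x₀`. -/
structure IsSolution (T : ℝ) (C : ℝ → Set H) (F : ℝ → H → Set H) (x₀ : H) (x : ℝ → H) :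
    Prop where
  absolutelyContinuous : AbsolutelyContinuousOnInterval x 0 T
  initial : x 0 = x₀
  inclusion : ∀ᵐ t ∂(volume.restrict (Icc 0 T)),
    DifferentiableAt ℝ x t ∧ deriv x t ∈ -clarkeNormalCone (C t) (x t) + F t (x t)

/-- `(X n)` is a sequence generated by the inexact catching-up algorithm with the selection `f`,
the tolerances `ε n` and `η n`, and the nodes `p n k`, on the uniform partition
`t_k = k * (T / n)` of `[0, T]`, for `n ≥ 1`. -/
structure IsInexactCatchingUp (T : ℝ) (C : ℝ → Set H) (f : ℝ → H → H) (x₀ : H)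
    (ε η : ℕ → ℝ) (p : ℕ → ℕ → H) (X : ℕ → ℝ → H) : Prop where
  eps_pos : ∀ n, 1 ≤ n → 0 < ε n
  eta_pos : ∀ n, 1 ≤ n → 0 < η n
  eps_lim : Tendsto (fun n : ℕ => ε n / (T / n) ^ 2) atTop (𝓝 0)
  eta_lim : Tendsto (fun n : ℕ => η n / (T / n)) atTop (𝓝 0)
  node_zero : ∀ n : ℕ, 1 ≤ n → p n 0 = x₀
  node_succ : ∀ n : ℕ, 1 ≤ n → ∀ k : ℕ, k < n →
    p n (k + 1) ∈ inexactProj (ε n) (η n) (C ((k + 1) * (T / n)))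
      (p n k + ∫ s in (k * (T / n))..((k + 1) * (T / n)), f s (p n k))
  interp_zero : ∀ n : ℕ, 1 ≤ n → X n 0 = x₀
  interp : ∀ n : ℕ, 1 ≤ n → ∀ k : ℕ, k < n → ∀ t ∈ Ioc (k * (T / n)) ((k + 1) * (T / n)),
    X n t = p n k
      + ((t - k * (T / n)) / (T / n)) • (p n (k + 1) - p n k
          - ∫ s in (k * (T / n))..((k + 1) * (T / n)), f s (p n k))
      + ∫ s in (k * (T / n))..t, f s (p n k)

end Cones

/-- The numbers that enter the constants of the error estimate: the final time `T`, the Lipschitz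
constants of `C` and of `h`, the value `h0 = h(x₀)`, the number `γ`, the norm of `x₀`, and an
upper bound `c` of `(√ε_n + η_n) / μ_n`. -/
structure Params where
  T : ℝ
  LC : ℝ
  Lh : ℝ
  h0 : ℝ
  γ : ℝ
  normx0 : ℝ
  c : ℝ

namespace Params

noncomputable section

def K₁ (P : Params) : ℝ := P.T * (P.LC + 2 * P.h0 + 2 * √P.γ + P.c) * Real.exp (2 * P.Lh * P.T)

def α (P : Params) : ℝ := P.h0 + P.Lh * P.K₁ + √P.γ

def K₂ (P : Params) : ℝ := P.K₁ + P.normx0 + P.T * (P.LC + 2 * P.α + P.c)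

def K₃ (P : Params) : ℝ := P.LC + P.h0 + P.Lh * (P.K₂ + P.normx0) + √P.γ

def K₄ (P : Params) : ℝ := P.LC + 2 * P.α

def K₅ (P : Params) : ℝ := P.K₄ + P.LC + 2 * P.α

def K₇ (P : Params) : ℝ := P.c + P.LC + 2 * P.α

def σ (P : Params) (ε η μ : ℝ) : ℝ := 2 * ε + 2 * P.K₃ * η * μ + 4 * η ^ 2

/-- The error quantity `A_n`, in terms of `ε = ε_n`, `η = η_n`, `μ = μ_n`; here `ρinv` is `1 / ρ`,
and `κ` is the integral of the monotonicity modulus. -/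
def errA (P : Params) (ρinv Γ κ ε η μ : ℝ) : ℝ :=
  4 * P.α * P.T * (2 * √(P.σ ε η μ) + √ε + 2 * η + P.K₄ * μ)
  + 4 * P.T * P.K₇ * (P.K₅ * μ + 2 * (√ε + √(P.σ ε η μ)) + 3 * η)
  + 4 * P.T * Γ * P.LC * μ
  + 2 * P.T * ((3 * √(P.σ ε η μ) + η) / μ) * (2 * √(P.σ ε η μ) + η + 2 * P.K₂)
  + 16 * P.T * Γ * ρinv * (2 * (√ε + √(P.σ ε η μ)) + 3 * η + P.K₅ * μ) ^ 2
  + 4 * κ * (3 * √ε + 3 * η + (P.K₄ + P.K₅) * μ) ^ 2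

end

end Params

end SweepingProcess

/-!
The sweeping process converges without compactness because the interpolants of the catching-up
algorithm form a Cauchy sequence, with a rate, and their limit is a solution.

A point of an inexact projection onto `S` need not lie on `S`, and nearest points need not exist.
However, points that have a nearest point in a closed set are dense, in a quantitative form
(`exists_nearest_point_near`): it follows that every inexact projection step is, up to an error of
order `√σ + η`, a step whose displacement is a proximal normal to `S` at a nearby point of `S`
(`exists_proximalNormal_near`). Together with a priori bounds on the nodes this turns each
interpolant into an approximate solution (`IsApproxSolution`): its velocity is a value of the
selection `f` at a nearby point minus a vector close to a proximal normal to the moving set at a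
nearby point and a nearby time.

For two approximate solutions, uniform prox-regularity makes the normal parts hypomonotone, and the
one-sided Lipschitz condition controls the perturbations. The Gronwall inequality for the squared
distance then bounds the distance by the errors of the two (`IsApproxSolution.norm_sub_sq_le`). As
the errors of the second one tend to zero, the bound tends to the claimed one (`pairError_le`); this
gives at the same time the convergence and the rate. The comparison of the error with
`√ε + η + μ + √ε / μ + η / μ + √(η / μ)` is elementary (`exists_errA_le`).

The velocities converge weakly only. A Mazur argument in `L²` yields convex combinations of tails
of the sequences of perturbations and of normal vectors that converge almost everywhere. Since the
values of `F` are closed and convex, and `F` is upper semicontinuous into the weak topology, the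
limit of the perturbations is in `F (t, x t)`. The inequality that characterises proximal normals to
a prox-regular set is linear in the normal and stable under limits, so that the limit of the normals
is a proximal normal, hence a Clarke normal (`exists_isSolution_of_tendsto`).

For uniqueness, the Clarke normals to a uniformly prox-regular set are proximal normals
(`IsUniformlyProxRegular.clarkeNormalCone_eq`), and linear growth of `F` makes the normal parts of
two solutions integrable; their hypomonotonicity and the Gronwall inequality give the result
(`IsSolution.eqOn`).
-/

namespace SweepingProcess

/-! ### Nearest points and proximal normals -/

section Geometry

theorem exists_mem_norm_sub_sq_le {H : Type*} [NormedAddCommGroup H] {S : Set H}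
    (hS : S.Nonempty) (x : H) {θ : ℝ} (hθ : 0 < θ) :
    ∃ u ∈ S, ‖x - u‖ ^ 2 ≤ Metric.infDist x S ^ 2 + θ := by
  have h0 : 0 ≤ Metric.infDist x S := Metric.infDist_nonneg
  have h1 : Metric.infDist x S < √(Metric.infDist x S ^ 2 + θ) := by
    apply Real.lt_sqrt_of_sq_lt; linarith
  obtain ⟨u, hu, hxu⟩ := (Metric.infDist_lt_iff hS).1 h1
  refine ⟨u, hu, ?_⟩
  rw [dist_eq_norm] at hxu
  calc ‖x - u‖ ^ 2 ≤ √(Metric.infDist x S ^ 2 + θ) ^ 2 := by gcongr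
    _ = _ := Real.sq_sqrt (by positivity)

variable {H : Type*} [NormedAddCommGroup H] [InnerProductSpace ℝ H]

/-- If `x` is moved the fraction `τ` of the way towards an almost nearest point `u` of `S`, then
the almost nearest points of the new point cluster around `u`. -/
theorem norm_sub_sq_le_of_almost_nearest {S : Set H} {x u u' : H} {τ θ θ' : ℝ}
    (hτ : 0 ≤ τ) (hτ1 : τ ≤ 1) (hu : u ∈ S) (hu' : u' ∈ S)
    (h : ‖x - u‖ ^ 2 ≤ Metric.infDist x S ^ 2 + θ) (hθ : 0 ≤ θ)
    (h' : ‖x + τ • (u - x) - u'‖ ^ 2 ≤ Metric.infDist (x + τ • (u - x)) S ^ 2 + θ') :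
    τ * ‖u' - u‖ ^ 2 ≤ θ + θ' := by
  have e1 : ‖x + τ • (u - x) - u'‖ ^ 2
      = (1 - τ) * ‖x - u'‖ ^ 2 + τ * ‖u' - u‖ ^ 2 - τ * (1 - τ) * ‖x - u‖ ^ 2 := by
    have a1 : x + τ • (u - x) - u' = (x - u') - τ • (x - u) := by module
    have a2 : u' - u = (x - u) - (x - u') := by abel
    have a3 : ∀ a b : H, ‖a - τ • b‖ ^ 2
        = (1 - τ) * ‖a‖ ^ 2 + τ * ‖b - a‖ ^ 2 - τ * (1 - τ) * ‖b‖ ^ 2 := fun a b => by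
      rw [norm_sub_sq_real, norm_sub_sq_real, norm_smul, inner_smul_right, mul_pow,
        Real.norm_eq_abs, sq_abs, real_inner_comm a b]
      ring
    rw [a1, a2, a3]
  have e2 : Metric.infDist (x + τ • (u - x)) S ^ 2 ≤ (1 - τ) ^ 2 * ‖x - u‖ ^ 2 := by
    have b1 : Metric.infDist (x + τ • (u - x)) S ≤ dist (x + τ • (u - x)) u :=
      Metric.infDist_le_dist_of_mem hu
    have b2 : x + τ • (u - x) - u = (1 - τ) • (x - u) := by module
    rw [dist_eq_norm, b2, norm_smul, Real.norm_eq_abs, abs_of_nonneg (by linarith)] at b1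
    rw [← mul_pow]
    exact pow_le_pow_left₀ Metric.infDist_nonneg b1 2
  have e3 : Metric.infDist x S ^ 2 ≤ ‖x - u'‖ ^ 2 := by
    have := Metric.infDist_le_dist_of_mem (x := x) hu'
    rw [dist_eq_norm] at this
    exact pow_le_pow_left₀ Metric.infDist_nonneg this 2
  nlinarith [mul_le_mul_of_nonneg_left h (sub_nonneg.2 hτ1),
    mul_le_mul_of_nonneg_left e3 (sub_nonneg.2 hτ1)]

/-- The points that have a nearest point in a nonempty closed subset of a Hilbert space are
dense: move `x` repeatedly by a small fraction of the way towards an almost nearest point; if the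
accuracy of these almost nearest points decreases fast enough, they form a Cauchy sequence. -/
theorem exists_nearest_point_near [CompleteSpace H] {S : Set H} (hS : IsClosed S)
    (hne : S.Nonempty) (x : H) {δ : ℝ} (hδ : 0 < δ) :
    ∃ y v, ‖y - x‖ ≤ δ ∧ v ∈ S ∧ ∀ w ∈ S, ‖y - v‖ ≤ ‖y - w‖ := by
  wlog hδ1 : δ ≤ 1 generalizing δ
  · obtain ⟨y, v, h1, h2⟩ := this one_pos le_rfl
    exact ⟨y, v, h1.trans (by linarith), h2⟩
  set D := Metric.infDist x S + 2 with hD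
  have hD2 : 2 ≤ D := by rw [hD]; linarith [Metric.infDist_nonneg (x := x) (s := S)]
  -- `D` bounds the distance of the moving point to its almost nearest points, so that the moves add
  -- up to at most `δ`; the tolerance `θ i` is small in comparison with the fraction `τ i`
  let τ : ℕ → ℝ := fun i => δ / (2 * D) * (1 / 2) ^ i
  let θ : ℕ → ℝ := fun i => τ i * (1 / 4) ^ i
  have hτ0 : ∀ i, 0 < τ i := fun i => by positivity
  have hθ0 : ∀ i, 0 < θ i := fun i => mul_pos (hτ0 i) (by positivity)
  have hτ1 : ∀ i, τ i ≤ 1 := fun i => by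
    have a : δ / (2 * D) ≤ 1 := by rw [div_le_one (by positivity)]; linarith
    have b : ((1 : ℝ) / 2) ^ i ≤ 1 := pow_le_one₀ (by norm_num) (by norm_num)
    exact mul_le_one₀ a (by positivity) b
  have hθτ : ∀ i, θ i ≤ τ i := fun i => by
    have b : ((1 : ℝ) / 4) ^ i ≤ 1 := pow_le_one₀ (by norm_num) (by norm_num)
    exact mul_le_of_le_one_right (hτ0 i).le b
  choose sel hselS hsel using fun (i : ℕ) (z : H) => exists_mem_norm_sub_sq_le hne z (hθ0 i)
  let X : ℕ → H := fun i => Nat.rec x (fun i z => z + τ i • (sel i z - z)) i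
  have hX0 : X 0 = x := rfl
  have hXs : ∀ i, X (i + 1) = X i + τ i • (sel i (X i) - X i) := fun i => rfl
  have hdist : ∀ i, ‖X i - x‖ ≤ 1 → ‖X (i + 1) - X i‖ ≤ δ / 2 / 2 ^ i := by
    intro i hi
    have a1 : ‖X i - sel i (X i)‖ ≤ D := by
      have c1 : Metric.infDist (X i) S ≤ Metric.infDist x S + 1 := by
        have := Metric.infDist_le_infDist_add_dist (s := S) (x := X i) (y := x)
        rw [dist_eq_norm] at this; linarith
      have c2 := hsel i (X i)
      have c3 : 0 ≤ Metric.infDist (X i) S := Metric.infDist_nonneg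
      have c4 := (hθτ i).trans (hτ1 i)
      refine (sq_le_sq₀ (norm_nonneg _) (by linarith)).1 ?_
      nlinarith
    rw [hXs, add_sub_cancel_left, norm_smul, norm_sub_rev, Real.norm_eq_abs,
      abs_of_pos (hτ0 i)]
    calc τ i * ‖X i - sel i (X i)‖ ≤ τ i * D := by
          exact mul_le_mul_of_nonneg_left a1 (hτ0 i).le
      _ = δ / 2 / 2 ^ i := by simp only [τ]; field_simp; rw [← mul_pow]; norm_num
  have hnear : ∀ i, ‖X i - x‖ ≤ δ - δ * (1 / 2) ^ i := by
    intro i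
    induction i with
    | zero => simp [hX0]
    | succ i ih =>
      have h1 : (0 : ℝ) ≤ δ * (1 / 2) ^ i := by positivity
      have h2 := hdist i (ih.trans (by linarith))
      have h3 : δ / 2 / 2 ^ i = δ * (1 / 2) ^ i - δ * (1 / 2) ^ (i + 1) := by
        rw [pow_succ, one_div, inv_pow]; field_simp; ring
      have h4 : X (i + 1) - x = (X (i + 1) - X i) + (X i - x) := by abel
      rw [h4]
      exact (norm_add_le _ _).trans (by linarith)
  have hnear1 : ∀ i, ‖X i - x‖ ≤ δ := fun i =>
    (hnear i).trans (by have : (0 : ℝ) ≤ δ * (1 / 2) ^ i := by positivity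
                        linarith)
  obtain ⟨y, hy⟩ := cauchySeq_tendsto_of_complete
    (cauchySeq_of_le_geometric_two (f := X) (C := δ) fun i => by
      rw [dist_comm, dist_eq_norm]; exact hdist i ((hnear1 i).trans hδ1))
  have hu : ∀ i, ‖sel (i + 1) (X (i + 1)) - sel i (X i)‖ ≤ 4 / 2 / 2 ^ i := by
    intro i
    have a := norm_sub_sq_le_of_almost_nearest (hτ0 i).le (hτ1 i) (hselS i (X i))
      (hselS (i + 1) (X (i + 1))) (hsel i (X i)) (hθ0 i).le (hsel (i + 1) (X (i + 1)))
    have b : θ (i + 1) ≤ θ i := by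
      have : θ (i + 1) = θ i * (1 / 8) := by simp only [θ, τ, pow_succ]; ring
      rw [this]; linarith [hθ0 i]
    have c : τ i * ‖sel (i + 1) (X (i + 1)) - sel i (X i)‖ ^ 2 ≤ τ i * (2 * (1 / 4) ^ i) := by
      refine a.trans ?_
      have : θ i = τ i * (1 / 4) ^ i := rfl
      linarith
    have d := le_of_mul_le_mul_left c (hτ0 i)
    refine (sq_le_sq₀ (norm_nonneg _) (by positivity)).1 (d.trans ?_)
    have : ((4 : ℝ) / 2 / 2 ^ i) ^ 2 = 4 * (1 / 4) ^ i := by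
      rw [div_pow, ← pow_mul, mul_comm i 2, pow_mul, one_div, inv_pow]; norm_num; ring
    rw [this]
    have : (0 : ℝ) ≤ (1 / 4) ^ i := by positivity
    linarith
  obtain ⟨v, hv⟩ := cauchySeq_tendsto_of_complete
    (cauchySeq_of_le_geometric_two (f := fun i => sel i (X i)) (C := 4) fun i => by
      rw [dist_comm, dist_eq_norm]; exact hu i)
  refine ⟨y, v, ?_, hS.mem_of_tendsto hv (Eventually.of_forall fun i => hselS i _), ?_⟩
  · exact le_of_tendsto ((hy.sub_const x).norm) (Eventually.of_forall hnear1)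
  · intro w hw
    have hθ : Tendsto θ atTop (𝓝 0) := by
      have h1 : Tendsto (fun i : ℕ => δ / (2 * D) * (1 / 2 : ℝ) ^ i * (1 / 4) ^ i) atTop
          (𝓝 (δ / (2 * D) * 0 * 0)) :=
        ((tendsto_pow_atTop_nhds_zero_of_lt_one (by norm_num) (by norm_num)).const_mul _).mul
          (tendsto_pow_atTop_nhds_zero_of_lt_one (by norm_num) (by norm_num))
      rwa [mul_zero] at h1
    have h1 : Tendsto (fun i => ‖X i - sel i (X i)‖ ^ 2) atTop (𝓝 (‖y - v‖ ^ 2)) :=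
      ((hy.sub hv).norm).pow 2
    have h2 : Tendsto (fun i => ‖X i - w‖ ^ 2 + θ i) atTop (𝓝 (‖y - w‖ ^ 2 + 0)) :=
      (((hy.sub_const w).norm).pow 2).add hθ
    have h3 := le_of_tendsto_of_tendsto' h1 h2 fun i => by
      refine (hsel i (X i)).trans ?_
      gcongr
      · exact Metric.infDist_nonneg
      · rw [← dist_eq_norm]; exact Metric.infDist_le_dist_of_mem hw
    rw [add_zero] at h3
    exact (sq_le_sq₀ (norm_nonneg _) (norm_nonneg _)).1 h3

theorem sub_mem_proximalNormalCone {S : Set H} {y v : H} (hv : v ∈ S)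
    (h : ∀ w ∈ S, ‖y - v‖ ≤ ‖y - w‖) : y - v ∈ proximalNormalCone S v := by
  refine ⟨hv, 1 / 2, by norm_num, 1, one_pos, fun w hw _ => ?_⟩
  have h1 := pow_le_pow_left₀ (norm_nonneg _) (h w hw) 2
  have h2 : y - w = (y - v) - (w - v) := by abel
  rw [h2, norm_sub_sq_real (y - v)] at h1
  linarith

theorem smul_mem_proximalNormalCone {S : Set H} {ζ v : H} {a : ℝ} (ha : 0 ≤ a)
    (h : ζ ∈ proximalNormalCone S v) : a • ζ ∈ proximalNormalCone S v := by
  obtain ⟨hv, σ, hσ, r, hr, hy⟩ := h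
  refine ⟨hv, a * σ, by positivity, r, hr, fun y hyS hyr => ?_⟩
  rw [real_inner_smul_left, mul_assoc]
  exact mul_le_mul_of_nonneg_left (hy y hyS hyr) ha

theorem add_mem_proximalNormalCone {S : Set H} {ζ ξ v : H}
    (h : ζ ∈ proximalNormalCone S v) (h' : ξ ∈ proximalNormalCone S v) :
    ζ + ξ ∈ proximalNormalCone S v := by
  obtain ⟨hv, σ, hσ, r, hr, hy⟩ := h
  obtain ⟨-, σ', hσ', r', hr', hy'⟩ := h'
  refine ⟨hv, σ + σ', by positivity, min r r', lt_min hr hr', fun y hyS hyr => ?_⟩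
  rw [inner_add_left, add_mul]
  exact add_le_add (hy y hyS (Metric.ball_subset_ball (min_le_left _ _) hyr))
    (hy' y hyS (Metric.ball_subset_ball (min_le_right _ _) hyr))

/-- For an approximate projection `z` of `x` on a closed set `S`, the vector `x - z` is close to a
proximal normal at a point of `S` close to `z`. The proximal normal is obtained from a point near
the midpoint of `x` and `z` that has a nearest point in `S`. -/
theorem exists_proximalNormal_near [CompleteSpace H] {S : Set H} (hS : IsClosed S) {x z : H}
    {σ : ℝ} (hσ : 0 < σ) (hz : z ∈ S) (hxz : ‖x - z‖ ^ 2 ≤ Metric.infDist x S ^ 2 + σ) :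
    ∃ v ∈ S, ∃ ζ ∈ proximalNormalCone S v, ‖v - z‖ ≤ 2 * √σ ∧ ‖ζ - (x - z)‖ ≤ 3 * √σ ∧
      ‖ζ‖ ≤ Metric.infDist x S + 4 * √σ := by
  set d := Metric.infDist x S with hd
  have hd0 : 0 ≤ d := Metric.infDist_nonneg
  have hs : 0 < √σ := Real.sqrt_pos.2 hσ
  have hss : √σ ^ 2 = σ := Real.sq_sqrt hσ.le
  set m : H := (1 / 2 : ℝ) • (x + z) with hm
  set M : ℝ := ‖m - z‖ with hM
  have hM0 : 0 ≤ M := norm_nonneg _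
  obtain ⟨δ, hδ, hδ1, hδ2⟩ : ∃ δ : ℝ, 0 < δ ∧ δ ≤ √σ / 8 ∧ δ * (16 * M + 16 * √σ) ≤ σ := by
    refine ⟨min (√σ / 8) (σ / (16 * M + 16 * √σ)), by positivity, min_le_left _ _, ?_⟩
    have : 0 < 16 * M + 16 * √σ := by positivity
    calc _ ≤ σ / (16 * M + 16 * √σ) * (16 * M + 16 * √σ) := by gcongr; exact min_le_right _ _
      _ = σ := by field_simp
  obtain ⟨y, v, hy, hv, hmin⟩ := exists_nearest_point_near hS ⟨z, hz⟩ m hδ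
  -- `v` is an almost nearest point to the midpoint `m`, hence close to `z`
  have h1 : ‖m - v‖ ≤ M + 2 * δ := by
    have a1 : m - v = (y - v) - (y - m) := by abel
    have a2 : y - z = (m - z) + (y - m) := by abel
    have a3 := hmin z hz
    have a4 := norm_sub_le (y - v) (y - m)
    have a5 := norm_add_le (m - z) (y - m)
    rw [← a1] at a4
    rw [← a2] at a5
    linarith
  have key : ‖x - v‖ ^ 2 + ‖v - z‖ ^ 2 ≤ d ^ 2 + 3 / 2 * σ := by
    have b1 : ‖x - v‖ ^ 2 + ‖v - z‖ ^ 2 = 2 * ‖m - v‖ ^ 2 + ‖x - z‖ ^ 2 / 2 := by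
      have e1 : x - v = (m - v) + (1 / 2 : ℝ) • (x - z) := by rw [hm]; module
      have e2 : v - z = (1 / 2 : ℝ) • (x - z) - (m - v) := by rw [hm]; module
      have e3 : ∀ a b : H, ‖a + (1 / 2 : ℝ) • b‖ ^ 2 + ‖(1 / 2 : ℝ) • b - a‖ ^ 2
          = 2 * ‖a‖ ^ 2 + ‖b‖ ^ 2 / 2 := fun a b => by
        rw [norm_add_sq_real, norm_sub_sq_real, norm_smul, mul_pow,
          real_inner_comm a ((1 / 2 : ℝ) • b)]
        norm_num; ring
      nth_rewrite 1 [e1]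
      rw [e2, e3]
    have b2 : 2 * M ^ 2 = ‖x - z‖ ^ 2 / 2 := by
      have e1 : m - z = (1 / 2 : ℝ) • (x - z) := by rw [hm]; module
      rw [hM, e1, norm_smul, mul_pow]; norm_num; ring
    have b3 := pow_le_pow_left₀ (norm_nonneg _) h1 2
    rw [b1]
    nlinarith
  have hvz : ‖v - z‖ ^ 2 ≤ 3 / 2 * σ := by
    have c1 : d ^ 2 ≤ ‖x - v‖ ^ 2 := by
      have := Metric.infDist_le_dist_of_mem (x := x) hv
      rw [dist_eq_norm] at this
      exact pow_le_pow_left₀ hd0 this 2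
    linarith
  have hvz1 : ‖v - z‖ ≤ 11 / 8 * √σ :=
    (sq_le_sq₀ (norm_nonneg _) (by positivity)).1 (by rw [mul_pow, hss]; linarith)
  have hxv : ‖x - v‖ ≤ d + 3 / 2 * √σ :=
    (sq_le_sq₀ (norm_nonneg _) (by positivity)).1
      (by nlinarith [sq_nonneg ‖v - z‖, mul_nonneg hd0 hs.le])
  have hy2 : ‖(2 : ℝ) • (y - m)‖ ≤ √σ / 4 := by
    rw [norm_smul]; norm_num; linarith
  refine ⟨v, hv, (2 : ℝ) • (y - v),
    smul_mem_proximalNormalCone zero_le_two (sub_mem_proximalNormalCone hv hmin),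
    by linarith, ?_, ?_⟩
  · have e : (2 : ℝ) • (y - v) - (x - z) = (2 : ℝ) • (y - m) - (2 : ℝ) • (v - z) := by
      rw [hm]; module
    rw [e]
    refine (norm_sub_le _ _).trans ?_
    have : ‖(2 : ℝ) • (v - z)‖ = 2 * ‖v - z‖ := by rw [norm_smul]; norm_num
    linarith
  · have e : (2 : ℝ) • (y - v) = (2 : ℝ) • (y - m) + ((x - v) - (v - z)) := by
      rw [hm]; module
    rw [e]
    have := norm_add_le ((2 : ℝ) • (y - m)) ((x - v) - (v - z))
    have := norm_sub_le (x - v) (v - z)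
    linarith

end Geometry

/-! ### Convergence of convex combinations of tails -/

section TailCombinations

/-- The weights of the convex combinations of the terms with index at least `n` of a sequence. -/
def tailWeights (n : ℕ) : Set (ℕ →₀ ℝ) :=
  {w | (∀ i, 0 ≤ w i) ∧ (∀ i < n, w i = 0) ∧ Finsupp.linearCombination ℝ (fun _ => (1 : ℝ)) w = 1}

theorem convex_tailWeights (n : ℕ) : Convex ℝ (tailWeights n) := by
  intro w hw w' hw' a b ha hb hab
  refine ⟨fun i => ?_, fun i hi => ?_, ?_⟩
  · exact add_nonneg (mul_nonneg ha (hw.1 i)) (mul_nonneg hb (hw'.1 i))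
  · simp [hw.2.1 i hi, hw'.2.1 i hi]
  · rw [map_add, map_smul, map_smul, hw.2.2, hw'.2.2]; simpa using hab

theorem tailWeights_antitone : Antitone tailWeights := fun _ _ h _ hw =>
  ⟨hw.1, fun i hi => hw.2.1 i (hi.trans_le h), hw.2.2⟩

theorem single_mem_tailWeights (n : ℕ) : Finsupp.single n (1 : ℝ) ∈ tailWeights n := by
  refine ⟨fun i => ?_, fun i hi => Finsupp.single_eq_of_ne hi.ne, by simp⟩
  rw [Finsupp.single_apply]; split_ifs <;> norm_num

theorem linearCombination_mem_of_mem_tailWeights {E : Type*} [AddCommGroup E] [Module ℝ E]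
    {s : Set E} (hs : Convex ℝ s) {a : ℕ → E} {n : ℕ} {w : ℕ →₀ ℝ} (hw : w ∈ tailWeights n)
    (ha : ∀ i, n ≤ i → a i ∈ s) : Finsupp.linearCombination ℝ a w ∈ s := by
  rw [Finsupp.linearCombination_apply, Finsupp.sum]
  refine hs.sum_mem (fun i _ => hw.1 i) ?_ fun i hi => ha i ?_
  · simpa [Finsupp.linearCombination_apply, Finsupp.sum] using hw.2.2
  · by_contra hlt
    exact (Finsupp.mem_support_iff.1 hi) (hw.2.1 i (not_le.1 hlt))

variable {E : Type*} [NormedAddCommGroup E]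

theorem tendsto_linearCombination_tailWeights [NormedSpace ℝ E] {a : ℕ → E} {x : E}
    (ha : Tendsto a atTop (𝓝 x)) {w : ℕ → ℕ →₀ ℝ} (hw : ∀ n, w n ∈ tailWeights n) :
    Tendsto (fun n => Finsupp.linearCombination ℝ a (w n)) atTop (𝓝 x) := by
  rw [Metric.tendsto_atTop] at ha ⊢
  intro ε hε
  obtain ⟨N, hN⟩ := ha ε hε
  exact ⟨N, fun n hn => linearCombination_mem_of_mem_tailWeights (convex_ball x ε) (hw n)
    fun i hi => hN i (hn.trans hi)⟩

variable [InnerProductSpace ℝ E]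

/-- Limits of convex combinations of the tails satisfy the inequalities that are satisfied
asymptotically by the sequence. -/
theorem inner_le_of_tendsto_linearCombination {a : ℕ → E} {x p : E} {b : ℕ → ℝ} {r : ℝ}
    {w : ℕ → ℕ →₀ ℝ} (hw : ∀ n, w n ∈ tailWeights n)
    (hx : Tendsto (fun n => Finsupp.linearCombination ℝ a (w n)) atTop (𝓝 x))
    (hb : Tendsto b atTop (𝓝 r)) (h : ∀ᶠ i in atTop, inner ℝ p (a i) ≤ b i) :
    inner ℝ p x ≤ r := by
  refine le_of_forall_gt_imp_ge_of_dense fun r' hr' => ?_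
  obtain ⟨N, hN⟩ := eventually_atTop.1 (h.and (hb.eventually (eventually_lt_nhds hr')))
  refine le_of_tendsto (tendsto_const_nhds.inner hx) ((eventually_ge_atTop N).mono fun n hn => ?_)
  have hconv : Convex ℝ {z : E | inner ℝ p z ≤ r'} :=
    convex_halfSpace_le (innerₛₗ ℝ p).isLinear r'
  exact linearCombination_mem_of_mem_tailWeights hconv (hw n) fun i hi =>
    ((hN i (hn.trans hi)).1.trans (hN i (hn.trans hi)).2.le)

/-- A bounded sequence of a Hilbert space has strongly convergent convex combinations of its
tails: the elements of almost minimal norm in the convex hulls of the tails form a Cauchy sequence,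
by the parallelogram identity. -/
theorem exists_tendsto_linearCombination_tailWeights [CompleteSpace E] {a : ℕ → E} {R : ℝ}
    (hR : ∀ i, ‖a i‖ ≤ R) :
    ∃ (w : ℕ → ℕ →₀ ℝ) (x : E), (∀ n, w n ∈ tailWeights n) ∧
      Tendsto (fun n => Finsupp.linearCombination ℝ a (w n)) atTop (𝓝 x) := by
  let K : ℕ → Set E := fun n => Finsupp.linearCombination ℝ a '' tailWeights n
  have hK : ∀ n, Convex ℝ (K n) := fun n => (convex_tailWeights n).linear_image _
  have hKne : ∀ n, (K n).Nonempty := fun n => ⟨_, _, single_mem_tailWeights n, rfl⟩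
  have hKanti : Antitone K := fun m n h => image_mono (tailWeights_antitone h)
  set d : ℕ → ℝ := fun n => Metric.infDist 0 (K n) with hd
  have hd0 : ∀ n, 0 ≤ d n := fun n => Metric.infDist_nonneg
  have hdmono : Monotone d := fun m n h =>
    Metric.infDist_le_infDist_of_subset (hKanti h) (hKne n)
  have hdle : ∀ n, ∀ p ∈ K n, d n ≤ ‖p‖ := fun n p hp => by
    have := Metric.infDist_le_dist_of_mem (x := (0 : E)) hp
    rwa [dist_zero_left] at this
  have hdR : ∀ n, d n ≤ R := fun n =>
    (hdle n (a n) ⟨_, single_mem_tailWeights n, by simp⟩).trans (hR n)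
  choose p hpK hp using fun n : ℕ =>
    exists_mem_norm_sub_sq_le (hKne n) (0 : E) (Nat.one_div_pos_of_nat (α := ℝ) (n := n))
  have hlim : Tendsto d atTop (𝓝 (⨆ n, d n)) :=
    tendsto_atTop_ciSup hdmono ⟨R, by rintro _ ⟨n, rfl⟩; exact hdR n⟩
  set D := ⨆ n, d n
  have hdD : ∀ n, d n ≤ D := fun n => hdmono.ge_of_tendsto hlim n
  have hcauchy : CauchySeq p := by
    refine cauchySeq_of_le_tendsto_0' (fun n => √(2 * (D ^ 2 - d n ^ 2) + 4 * (1 / ((n : ℝ) + 1))))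
      (fun n m hnm => ?_) ?_
    · rw [dist_eq_norm]
      refine Real.le_sqrt_of_sq_le ?_
      have h1 : (2 * d n) ^ 2 ≤ ‖p n + p m‖ ^ 2 := by
        have hmid : (1 / 2 : ℝ) • p n + (1 / 2 : ℝ) • p m ∈ K n :=
          hK n (hpK n) (hKanti hnm (hpK m)) (by norm_num) (by norm_num) (by norm_num)
        have := hdle n _ hmid
        rw [← smul_add, norm_smul] at this
        norm_num at this
        exact pow_le_pow_left₀ (by linarith [hd0 n]) (by linarith) 2
      have h2 := parallelogram_law_with_norm ℝ (p n) (p m)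
      have h3 := hp n
      have h4 := hp m
      rw [zero_sub, norm_neg] at h3 h4
      have h5 : d m ^ 2 ≤ D ^ 2 := pow_le_pow_left₀ (hd0 m) (hdD m) 2
      have h6 : 1 / ((m : ℝ) + 1) ≤ 1 / ((n : ℝ) + 1) := Nat.one_div_le_one_div hnm
      simp only [hd] at h1 h5 ⊢
      nlinarith
    · have h1 : Tendsto (fun n : ℕ => 2 * (D ^ 2 - d n ^ 2) + 4 * (1 / ((n : ℝ) + 1))) atTop
          (𝓝 (2 * (D ^ 2 - D ^ 2) + 4 * 0)) :=
        (((hlim.pow 2).const_sub _).const_mul _).add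
          (tendsto_one_div_add_atTop_nhds_zero_nat.const_mul _)
      simpa using h1.sqrt
  obtain ⟨x, hx⟩ := cauchySeq_tendsto_of_complete hcauchy
  choose w hw hwp using hpK
  exact ⟨w, x, hw, by simpa only [hwp] using hx⟩

end TailCombinations

/-! ### Normal cones of uniformly prox-regular sets -/

section ProxRegular

variable {H : Type*} [NormedAddCommGroup H] [InnerProductSpace ℝ H]

theorem proximalNormalCone_subset_clarkeNormalCone (S : Set H) (x : H) :
    proximalNormalCone S x ⊆ clarkeNormalCone S x := by
  rintro ζ ⟨hx, σ, hσ, r, hr, hζ⟩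
  refine ⟨hx, fun v hv => ?_⟩
  let τ : ℕ → ℝ := fun n => 1 / ((n : ℝ) + 1)
  -- test the tangent vector `v` with the constant sequence `x`
  have hτ0 : ∀ n, 0 < τ n := fun n => Nat.one_div_pos_of_nat
  have hτ : Tendsto τ atTop (𝓝 0) := tendsto_one_div_add_atTop_nhds_zero_nat
  obtain ⟨w, hw, hwS⟩ := hv (fun _ => x) τ (fun _ => hx) tendsto_const_nhds hτ0 hτ
  have h1 : Tendsto (fun n => x + τ n • w n) atTop (𝓝 x) := by
    simpa using (hτ.smul hw).const_add x
  have h2 : ∀ᶠ n in atTop, inner ℝ ζ (w n) ≤ σ * τ n * ‖w n‖ ^ 2 := by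
    filter_upwards [h1.eventually (Metric.ball_mem_nhds x hr)] with n hn
    have := hζ _ (hwS n) hn
    rw [add_sub_cancel_left, inner_smul_right, norm_smul, Real.norm_eq_abs,
      abs_of_pos (hτ0 n)] at this
    refine le_of_mul_le_mul_left ?_ (hτ0 n)
    linarith
  have h3 : Tendsto (fun n => σ * τ n * ‖w n‖ ^ 2) atTop (𝓝 (σ * 0 * ‖v‖ ^ 2)) :=
    (hτ.const_mul σ).mul (hw.norm.pow 2)
  simpa using le_of_tendsto_of_tendsto (tendsto_const_nhds.inner hw) h3 h2

variable {ρ : ℝ≥0∞} {S : Set H}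

theorem IsUniformlyProxRegular.mem_proximalNormalCone_iff (hS : IsUniformlyProxRegular ρ S)
    {x : H} (hx : x ∈ S) {ζ : H} : ζ ∈ proximalNormalCone S x ↔
      ∀ y ∈ S, inner ℝ ζ (y - x) ≤ ‖ζ‖ / 2 * ρ⁻¹.toReal * ‖y - x‖ ^ 2 :=
  ⟨hS.2 x hx ζ, fun h => ⟨hx, ‖ζ‖ / 2 * ρ⁻¹.toReal, by positivity, 1, one_pos,
    fun y hy _ => h y hy⟩⟩

/-- A vector that makes an obtuse angle with all proximal normals at a point of a prox-regular set
is a Clarke tangent vector: otherwise, the unit normals at the nearest points of `u + τ h` have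
a weak limit that is a proximal normal at `x` and makes an acute angle with `h`. -/
theorem IsUniformlyProxRegular.mem_clarkeTangentCone [CompleteSpace H]
    (hS : IsUniformlyProxRegular ρ S) {x h : H} (hx : x ∈ S)
    (hh : ∀ ξ ∈ proximalNormalCone S x, inner ℝ ξ h ≤ 0) : h ∈ clarkeTangentCone S x := by
  intro u τ huS hu hτ0 hτ
  have hne : S.Nonempty := ⟨x, hx⟩
  set c := ρ⁻¹.toReal with hc
  have hc0 : 0 ≤ c := ENNReal.toReal_nonneg
  -- it suffices that `u n + τ n • h` is at a distance `o(τ n)` of `S`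
  have key : Tendsto (fun n => Metric.infDist (u n + τ n • h) S / τ n) atTop (𝓝 0) := by
    by_contra hnot
    obtain ⟨ε, hε, hfreq⟩ : ∃ ε > 0, ∃ᶠ n in atTop,
        ε * τ n ≤ Metric.infDist (u n + τ n • h) S := by
      rw [Metric.tendsto_nhds] at hnot
      push Not at hnot
      obtain ⟨ε, hε, hf⟩ := hnot
      refine ⟨ε, hε, hf.mono fun n hn => ?_⟩
      have h0 : 0 ≤ Metric.infDist (u n + τ n • h) S / τ n :=
        div_nonneg Metric.infDist_nonneg (hτ0 n).le
      rw [Real.dist_eq, sub_zero, abs_of_nonneg h0, le_div_iff₀ (hτ0 n)] at hn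
      exact hn
    obtain ⟨φ, hφ, hφε⟩ := extraction_of_frequently_atTop hfreq
    choose y v hy hv hmin using fun n => exists_nearest_point_near hS.1 hne
      (u (φ n) + τ (φ n) • h) (mul_pos (div_pos hε (by norm_num : (0 : ℝ) < 4)) (hτ0 (φ n)))
    set t : ℕ → ℝ := fun n => τ (φ n) with ht
    have ht0 : ∀ n, 0 < t n := fun n => hτ0 _
    have htlim : Tendsto t atTop (𝓝 0) := hτ.comp hφ.tendsto_atTop
    have hulim : Tendsto (fun n => u (φ n)) atTop (𝓝 x) := hu.comp hφ.tendsto_atTop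
    have hr : ∀ n, 3 / 4 * ε * t n ≤ ‖y n - v n‖ := fun n => by
      have h1 := Metric.infDist_le_dist_of_mem (x := u (φ n) + τ (φ n) • h) (hv n)
      have h2 := dist_triangle_left (u (φ n) + τ (φ n) • h) (v n) (y n)
      rw [dist_eq_norm (y n), dist_eq_norm (y n)] at h2
      have h3 := hφε n
      have h4 := hy n
      simp only [ht]
      linarith
    have hr0 : ∀ n, 0 < ‖y n - v n‖ := fun n => lt_of_lt_of_le (by have := ht0 n; positivity) (hr n)
    have huv : ∀ n, ‖u (φ n) - v n‖ ≤ 2 * (ε / 4 + ‖h‖) * t n := fun n => by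
      have h1 := hmin n _ (huS (φ n))
      have h2 : ‖y n - u (φ n)‖ ≤ (ε / 4 + ‖h‖) * t n := by
        have e : y n - u (φ n) = (y n - (u (φ n) + τ (φ n) • h)) + τ (φ n) • h := by abel
        rw [e, add_mul]
        refine (norm_add_le _ _).trans (add_le_add (hy n) ?_)
        rw [norm_smul, Real.norm_eq_abs, abs_of_pos (hτ0 _), mul_comm]
      have e : u (φ n) - v n = (y n - v n) - (y n - u (φ n)) := by abel
      rw [e]
      refine (norm_sub_le _ _).trans ?_
      linarith
    have hvlim : Tendsto v atTop (𝓝 x) := by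
      have h1 : Tendsto (fun n => u (φ n) - v n) atTop (𝓝 0) := by
        refine squeeze_zero_norm huv ?_
        simpa using htlim.const_mul (2 * (ε / 4 + ‖h‖))
      simpa using hulim.sub h1
    -- the unit proximal normals at points `v n` near `u (φ n) + t n • h`
    set ξ : ℕ → H := fun n => ‖y n - v n‖⁻¹ • (y n - v n) with hξ
    have hξN : ∀ n, ξ n ∈ proximalNormalCone S (v n) := fun n =>
      smul_mem_proximalNormalCone (by positivity) (sub_mem_proximalNormalCone (hv n) (hmin n))
    have hξ1 : ∀ n, ‖ξ n‖ = 1 := fun n => by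
      simp only [hξ]
      rw [norm_smul, norm_inv, norm_norm, inv_mul_cancel₀ (hr0 n).ne']
    have hξS : ∀ n, ∀ z ∈ S, inner ℝ (ξ n) (z - v n) ≤ c / 2 * ‖z - v n‖ ^ 2 := fun n z hz => by
      have := hS.2 _ (hv n) _ (hξN n) z hz
      rw [hξ1] at this
      linarith
    have hξh : ∀ n, inner ℝ (-h) (ξ n) ≤ -(ε / 2) + 2 * c * (ε / 4 + ‖h‖) ^ 2 * t n := fun n => by
      have e1 : inner ℝ (ξ n) (y n - v n) = ‖y n - v n‖ := by
        simp only [hξ]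
        rw [real_inner_smul_left, real_inner_self_eq_norm_sq]
        field_simp
      have e2 : y n - v n = (y n - (u (φ n) + τ (φ n) • h)) + t n • h + (u (φ n) - v n) := by
        simp only [ht]; abel
      have h1 : inner ℝ (ξ n) (y n - (u (φ n) + τ (φ n) • h)) ≤ ε / 4 * t n := by
        refine (real_inner_le_norm _ _).trans ?_
        rw [hξ1, one_mul]; exact hy n
      have h2 := hξS n _ (huS (φ n))
      have h3 := pow_le_pow_left₀ (norm_nonneg _) (huv n) 2
      have e3 : inner ℝ (ξ n) (y n - v n) = inner ℝ (ξ n) (y n - (u (φ n) + τ (φ n) • h))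
          + t n * inner ℝ (ξ n) h + inner ℝ (ξ n) (u (φ n) - v n) := by
        rw [e2, inner_add_right, inner_add_right, inner_smul_right]
      rw [inner_neg_left, real_inner_comm]
      refine le_of_mul_le_mul_left ?_ (ht0 n)
      have h4 := mul_le_mul_of_nonneg_left h3 (by positivity : 0 ≤ c / 2)
      linarith [hr n]
    obtain ⟨w, z, hw, hz⟩ :=
      exists_tendsto_linearCombination_tailWeights (a := ξ) (R := 1) fun n => (hξ1 n).le
    -- the limit of convex combinations of the `ξ n` inherits the linear inequalities satisfied by `ξ n`
    have hzN : z ∈ proximalNormalCone S x := by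
      refine ⟨hx, c / 2, by positivity, 1, one_pos, fun s hs _ => ?_⟩
      rw [real_inner_comm]
      refine inner_le_of_tendsto_linearCombination hw hz
        (b := fun n => c / 2 * ‖s - v n‖ ^ 2 + ‖v n - x‖) ?_ (Eventually.of_forall fun n => ?_)
      · have := (((hvlim.const_sub s).norm.pow 2).const_mul (c / 2)).add
          (hvlim.sub_const x).norm
        simpa using this
      · have e : s - x = (s - v n) + (v n - x) := by abel
        rw [real_inner_comm, e, inner_add_right]
        refine add_le_add (hξS n s hs) ((real_inner_le_norm _ _).trans ?_)
        rw [hξ1, one_mul]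
    have h1 : inner ℝ (-h) z ≤ -(ε / 2) := by
      refine inner_le_of_tendsto_linearCombination hw hz ?_ (Eventually.of_forall hξh)
      simpa using (htlim.const_mul (2 * c * (ε / 4 + ‖h‖) ^ 2)).const_add (-(ε / 2))
    have h2 := hh z hzN
    rw [inner_neg_left, real_inner_comm] at h1
    linarith
  choose z hzS hz using fun n => (Metric.infDist_lt_iff (x := u n + τ n • h) hne).1
    (lt_add_of_pos_right (Metric.infDist (u n + τ n • h) S) (mul_pos (hτ0 n) (hτ0 n)))
  refine ⟨fun n => (τ n)⁻¹ • (z n - u n), ?_, fun n => ?_⟩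
  · rw [tendsto_iff_norm_sub_tendsto_zero]
    refine squeeze_zero (fun _ => norm_nonneg _) (fun n => ?_)
      (by simpa using key.add hτ : Tendsto
        (fun n => Metric.infDist (u n + τ n • h) S / τ n + τ n) atTop (𝓝 0))
    have e : (τ n)⁻¹ • (z n - u n) - h = (τ n)⁻¹ • (z n - (u n + τ n • h)) := by
      rw [← sub_sub, smul_sub _ (z n - u n), smul_smul, inv_mul_cancel₀ (hτ0 n).ne', one_smul]
    have h1 := (hz n).le
    rw [dist_eq_norm, norm_sub_rev] at h1
    rw [e, norm_smul, norm_inv, Real.norm_eq_abs, abs_of_pos (hτ0 n), inv_mul_eq_div,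
      div_add' _ _ _ (hτ0 n).ne']
    exact div_le_div_of_nonneg_right h1 (hτ0 n).le
  · simp only [smul_smul, mul_inv_cancel₀ (hτ0 n).ne', one_smul]
    simpa using hzS n

/-- On a uniformly prox-regular set the Clarke and the proximal normal cones agree. -/
theorem IsUniformlyProxRegular.clarkeNormalCone_eq [CompleteSpace H]
    (hS : IsUniformlyProxRegular ρ S) (x : H) :
    clarkeNormalCone S x = proximalNormalCone S x := by
  refine Subset.antisymm (fun ζ hζ => ?_) (proximalNormalCone_subset_clarkeNormalCone S x)
  have hx := hζ.1
  by_contra hnot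
  -- by prox-regularity the proximal normal cone is closed and convex, hence equal to its bipolar
  let K : ProperCone ℝ H :=
    { carrier := proximalNormalCone S x
      add_mem' := add_mem_proximalNormalCone
      zero_mem' := ⟨hx, 0, le_rfl, 1, one_pos, fun y _ _ => by simp⟩
      smul_mem' := fun a ζ h => smul_mem_proximalNormalCone a.2 h
      isClosed' := by
        have : proximalNormalCone S x = ⋂ y ∈ S,
            {ζ : H | inner ℝ ζ (y - x) ≤ ‖ζ‖ / 2 * ρ⁻¹.toReal * ‖y - x‖ ^ 2} := by
          ext ζ
          simp only [mem_iInter, mem_ofPred_eq]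
          exact hS.mem_proximalNormalCone_iff hx
        change IsClosed (proximalNormalCone S x)
        rw [this]
        exact isClosed_biInter fun y _ => isClosed_le (by fun_prop) (by fun_prop) }
  obtain ⟨y, hy, hζy⟩ := K.hyperplane_separation' (x₀ := ζ) hnot
  have h1 : -y ∈ clarkeTangentCone S x := hS.mem_clarkeTangentCone hx fun ξ hξ => by
    rw [inner_neg_right]; linarith [hy ξ hξ]
  have h2 := hζ.2 _ h1
  rw [inner_neg_right] at h2
  linarith

end ProxRegular

/-! ### Absolutely continuous functions and Gronwall's inequality -/

section AbsolutelyContinuous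

theorem absolutelyContinuousOnInterval_comp_of_dist_le {X Y : Type*} [PseudoMetricSpace X]
    [PseudoMetricSpace Y] {f : ℝ → X} {g : ℝ → Y} {a b K : ℝ} (hK : 0 ≤ K)
    (hf : AbsolutelyContinuousOnInterval f a b)
    (h : ∀ s ∈ uIcc a b, ∀ t ∈ uIcc a b, dist (g s) (g t) ≤ K * dist (f s) (f t)) :
    AbsolutelyContinuousOnInterval g a b := by
  rw [absolutelyContinuousOnInterval_iff] at hf ⊢
  intro ε hε
  obtain ⟨δ, hδ, hfδ⟩ := hf (ε / (K + 1)) (by positivity)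
  refine ⟨δ, hδ, fun I hI hIδ => ?_⟩
  have h1 := hfδ I hI hIδ
  calc ∑ i ∈ Finset.range I.1, dist (g (I.2 i).1) (g (I.2 i).2)
      ≤ ∑ i ∈ Finset.range I.1, (K + 1) * dist (f (I.2 i).1) (f (I.2 i).2) :=
        Finset.sum_le_sum fun i hi =>
          (h _ (hI.1 i hi).1 _ (hI.1 i hi).2).trans (by gcongr; linarith)
    _ = (K + 1) * ∑ i ∈ Finset.range I.1, dist (f (I.2 i).1) (f (I.2 i).2) :=
        (Finset.mul_sum _ _ _).symm
    _ < (K + 1) * (ε / (K + 1)) := by gcongr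
    _ = ε := by field_simp

theorem absolutelyContinuousOnInterval_norm_sq {E : Type*} [NormedAddCommGroup E] {f : ℝ → E}
    {a b : ℝ} (hf : AbsolutelyContinuousOnInterval f a b) :
    AbsolutelyContinuousOnInterval (fun t => ‖f t‖ ^ 2) a b := by
  have h1 : AbsolutelyContinuousOnInterval (fun t => ‖f t‖) a b :=
    absolutelyContinuousOnInterval_comp_of_dist_le zero_le_one hf fun s _ t _ => by
      rw [one_mul, dist_eq_norm (f s), Real.dist_eq]
      exact abs_norm_sub_norm_le _ _
  simpa only [sq] using h1.fun_mul h1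

theorem absolutelyContinuousOnInterval_exp_neg {f : ℝ → ℝ} {a b : ℝ}
    (hf : AbsolutelyContinuousOnInterval f a b) :
    AbsolutelyContinuousOnInterval (fun t => Real.exp (-f t)) a b := by
  obtain ⟨M, hM⟩ := hf.exists_bound
  refine absolutelyContinuousOnInterval_comp_of_dist_le (Real.exp_nonneg M) hf
    fun s hs t ht => ?_
  have hconv : Convex ℝ (Iic M) := convex_Iic M
  have h1 := hconv.norm_image_sub_le_of_norm_hasDerivWithin_le (f := Real.exp) (f' := Real.exp)
    (C := Real.exp M) (x := -f t) (y := -f s)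
    (fun x _ => (Real.hasDerivAt_exp x).hasDerivWithinAt)
    (fun x hx => by rw [Real.norm_eq_abs, Real.abs_exp]; exact Real.exp_le_exp.2 hx)
    (by have := hM t ht; rw [Real.norm_eq_abs] at this; exact (neg_le_abs _).trans this)
    (by have := hM s hs; rw [Real.norm_eq_abs] at this; exact (neg_le_abs _).trans this)
  rw [dist_eq_norm, dist_comm, dist_eq_norm]
  have e : f t - f s = -f s - -f t := by ring
  rw [e]
  exact h1

/-- Gronwall's inequality for absolutely continuous functions, with an integrable coefficient. -/
theorem le_integral_mul_exp_of_deriv_le {φ a b : ℝ → ℝ} {T : ℝ}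
    (hφ : AbsolutelyContinuousOnInterval φ 0 T) (hφ0 : φ 0 = 0)
    (ha : IntervalIntegrable a volume 0 T) (hb : IntervalIntegrable b volume 0 T)
    (ha0 : ∀ᵐ t ∂volume.restrict (Icc 0 T), 0 ≤ a t)
    (hb0 : ∀ᵐ t ∂volume.restrict (Icc 0 T), 0 ≤ b t)
    (h : ∀ᵐ t ∂volume.restrict (Icc 0 T), deriv φ t ≤ a t * φ t + b t) {t : ℝ}
    (ht : t ∈ Icc 0 T) : φ t ≤ (∫ s in (0 : ℝ)..T, b s) * Real.exp (∫ s in (0 : ℝ)..T, a s) := by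
  have hT : 0 ≤ T := ht.1.trans ht.2
  have hsub : uIcc 0 t ⊆ uIcc 0 T := by
    rw [uIcc_of_le ht.1, uIcc_of_le hT]; exact Icc_subset_Icc_right ht.2
  have hat : IntervalIntegrable a volume 0 t := ha.mono_set hsub
  have hbt : IntervalIntegrable b volume 0 t := hb.mono_set hsub
  set A : ℝ → ℝ := fun s => ∫ r in (0 : ℝ)..s, a r with hA
  have hAac : AbsolutelyContinuousOnInterval A 0 t :=
    hat.absolutelyContinuousOnInterval_intervalIntegral left_mem_uIcc
  have hφt := hφ.mono hsub
  have hψ := hφt.fun_mul (absolutelyContinuousOnInterval_exp_neg hAac)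
  have hae : ∀ᵐ s ∂volume, s ∈ Icc 0 T → (0 ≤ a s ∧ 0 ≤ b s ∧ deriv φ s ≤ a s * φ s + b s) :=
    (ae_restrict_iff' measurableSet_Icc).1 (by
      filter_upwards [ha0, hb0, h] with s h1 h2 h3 using ⟨h1, h2, h3⟩)
  have hA0 : ∀ s ∈ Icc 0 T, 0 ≤ A s := fun s hs => by
    refine intervalIntegral.integral_nonneg_of_ae_restrict hs.1 ?_
    exact ae_mono (Measure.restrict_mono (Icc_subset_Icc_right hs.2) le_rfl) ha0
  have hAT : A t ≤ A T := by
    have h1 : A t + ∫ r in t..T, a r = A T :=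
      intervalIntegral.integral_add_adjacent_intervals hat
        (ha.mono_set (by rw [uIcc_of_le ht.2, uIcc_of_le hT]; exact Icc_subset_Icc_left ht.1))
    have h2 : 0 ≤ ∫ r in t..T, a r :=
      intervalIntegral.integral_nonneg_of_ae_restrict ht.2
        (ae_mono (Measure.restrict_mono (Icc_subset_Icc_left ht.1) le_rfl) ha0)
    linarith
  have hbT : ∫ r in (0 : ℝ)..t, b r ≤ ∫ r in (0 : ℝ)..T, b r := by
    have h1 : (∫ r in (0 : ℝ)..t, b r) + ∫ r in t..T, b r = ∫ r in (0 : ℝ)..T, b r :=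
      intervalIntegral.integral_add_adjacent_intervals hbt
        (hb.mono_set (by rw [uIcc_of_le ht.2, uIcc_of_le hT]; exact Icc_subset_Icc_left ht.1))
    have h2 : 0 ≤ ∫ r in t..T, b r :=
      intervalIntegral.integral_nonneg_of_ae_restrict ht.2
        (ae_mono (Measure.restrict_mono (Icc_subset_Icc_left ht.1) le_rfl) hb0)
    linarith
  have hbt0 : 0 ≤ ∫ r in (0 : ℝ)..t, b r :=
      intervalIntegral.integral_nonneg_of_ae_restrict ht.1
        (ae_mono (Measure.restrict_mono (Icc_subset_Icc_right ht.2) le_rfl) hb0)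
  have hle : ∫ s in (0 : ℝ)..t, deriv (fun s => φ s * Real.exp (-A s)) s
      ≤ ∫ s in (0 : ℝ)..t, b s := by
    refine intervalIntegral.integral_mono_ae_restrict ht.1 hψ.intervalIntegrable_deriv hbt ?_
    refine (ae_restrict_iff' measurableSet_Icc).2 ?_
    filter_upwards [hae, hφt.ae_differentiableAt, hat.ae_hasDerivAt_integral] with s h1 h2 h3 hs
    have hs' : s ∈ Icc 0 T := ⟨hs.1, hs.2.trans ht.2⟩
    rw [uIcc_of_le ht.1] at h2 h3
    obtain ⟨has, hbs, hds⟩ := h1 hs'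
    have h4 : HasDerivAt (fun r => Real.exp (-A r)) (Real.exp (-A s) * -a s) s :=
      (h3 hs 0 (left_mem_Icc.2 ht.1)).fun_neg.exp
    have h5 := ((h2 hs).hasDerivAt.fun_mul h4).deriv
    rw [h5]
    have h6 : Real.exp (-A s) ≤ 1 := Real.exp_le_one_iff.2 (by linarith [hA0 s hs'])
    have h7 := Real.exp_nonneg (-A s)
    calc deriv φ s * Real.exp (-A s) + φ s * (Real.exp (-A s) * -a s)
        = (deriv φ s - a s * φ s) * Real.exp (-A s) := by ring
      _ ≤ b s * Real.exp (-A s) := by gcongr; linarith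
      _ ≤ b s := mul_le_of_le_one_right hbs h6
  rw [hψ.integral_deriv_eq_sub] at hle
  simp only [hφ0, zero_mul, sub_zero] at hle
  calc φ t = φ t * Real.exp (-A t) * Real.exp (A t) := by
        rw [mul_assoc, ← Real.exp_add, neg_add_cancel, Real.exp_zero, mul_one]
    _ ≤ (∫ r in (0 : ℝ)..t, b r) * Real.exp (A t) := by gcongr
    _ ≤ (∫ s in (0 : ℝ)..T, b s) * Real.exp (A T) :=
        mul_le_mul hbT (Real.exp_le_exp.2 hAT) (Real.exp_nonneg _) (hbt0.trans hbT)

end AbsolutelyContinuous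

/-! ### Estimates for the nodes of the scheme -/

section Scheme

variable {H : Type*} [NormedAddCommGroup H] [InnerProductSpace ℝ H]

/-- The part of the hypotheses on the sweeping process that controls the nodes of the catching-up
algorithm: the Lipschitz moving set `C`, and the selection `f` of the perturbation, whose growth is
controlled by the Lipschitz function `h` and the number `γ`. -/
structure IsDrivenSweeping (T : ℝ) (C : ℝ → Set H) (LC : ℝ≥0) (x₀ : H) (h : H → ℝ) (Lh : ℝ≥0)
    (γ : ℝ) (f : ℝ → H → H) : Prop where
  pos : 0 < T
  isClosed : ∀ t ∈ Icc 0 T, IsClosed (C t)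
  lip : ∀ t ∈ Icc 0 T, ∀ s ∈ Icc 0 T,
    Metric.hausdorffEDist (C t) (C s) ≤ ENNReal.ofReal (LC * |t - s|)
  mem : x₀ ∈ C 0
  h_nonneg : ∀ x, 0 ≤ h x
  h_lip : LipschitzWith Lh h
  f_meas : ∀ x, AEStronglyMeasurable (fun t => f t x) (volume.restrict (Icc 0 T))
  f_bound : ∀ x, ∀ᵐ t ∂volume.restrict (Icc 0 T), ‖f t x‖ ≤ h x + √γ

/-- The part of an inexact catching-up sequence that concerns a single number `n` of steps, with
the tolerances `ε` and `η`, the nodes `p` and the interpolant `X`. -/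
structure IsCatchingUpRun (T : ℝ) (C : ℝ → Set H) (f : ℝ → H → H) (x₀ : H) (n : ℕ) (ε η : ℝ)
    (p : ℕ → H) (X : ℝ → H) : Prop where
  one_le : 1 ≤ n
  eps_pos : 0 < ε
  eta_pos : 0 < η
  node_zero : p 0 = x₀
  node_succ : ∀ k : ℕ, k < n →
    p (k + 1) ∈ inexactProj ε η (C ((k + 1) * (T / n)))
      (p k + ∫ s in (k * (T / n))..((k + 1) * (T / n)), f s (p k))
  interp_zero : X 0 = x₀
  interp : ∀ k : ℕ, k < n → ∀ t ∈ Ioc (k * (T / n)) ((k + 1) * (T / n)),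
    X t = p k + ((t - k * (T / n)) / (T / n)) • (p (k + 1) - p k
          - ∫ s in (k * (T / n))..((k + 1) * (T / n)), f s (p k))
      + ∫ s in (k * (T / n))..t, f s (p k)

theorem IsInexactCatchingUp.run {T : ℝ} {C : ℝ → Set H} {f : ℝ → H → H} {x₀ : H} {ε η : ℕ → ℝ}
    {p : ℕ → ℕ → H} {X : ℕ → ℝ → H} (hX : IsInexactCatchingUp T C f x₀ ε η p X) {n : ℕ}
    (hn : 1 ≤ n) : IsCatchingUpRun T C f x₀ n (ε n) (η n) (p n) (X n) :=
  ⟨hn, hX.eps_pos n hn, hX.eta_pos n hn, hX.node_zero n hn, hX.node_succ n hn,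
    hX.interp_zero n hn, hX.interp n hn⟩

variable {T : ℝ} {C : ℝ → Set H} {LC : ℝ≥0} {x₀ : H} {h : H → ℝ} {Lh : ℝ≥0} {γ : ℝ}
  {f : ℝ → H → H}

omit [InnerProductSpace ℝ H] in
theorem infDist_le_of_hausdorffEDist_le {A B : Set H} {r : ℝ} (hr : 0 ≤ r)
    (hAB : Metric.hausdorffEDist A B ≤ ENNReal.ofReal r) (x : H) :
    Metric.infDist x B ≤ Metric.infDist x A + r := by
  have h1 : Metric.hausdorffEDist A B ≠ ⊤ := ne_top_of_le_ne_top ENNReal.ofReal_ne_top hAB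
  refine (Metric.infDist_le_infDist_add_hausdorffDist h1).trans ?_
  gcongr
  rw [Metric.hausdorffDist]
  exact ENNReal.toReal_le_of_le_ofReal hr hAB

namespace IsDrivenSweeping

variable (D : IsDrivenSweeping T C LC x₀ h Lh γ f)
include D

omit [InnerProductSpace ℝ H] in
theorem infDist_le {t s : ℝ} (ht : t ∈ Icc 0 T) (hs : s ∈ Icc 0 T) (x : H) :
    Metric.infDist x (C s) ≤ Metric.infDist x (C t) + LC * |t - s| :=
  infDist_le_of_hausdorffEDist_le (by positivity) (D.lip t ht s hs) x

omit [InnerProductSpace ℝ H] in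
theorem intervalIntegrable (x : H) {a b : ℝ} (ha : a ∈ Icc 0 T) (hb : b ∈ Icc 0 T) :
    IntervalIntegrable (fun t => f t x) volume a b := by
  have h1 : IntegrableOn (fun t => f t x) (Icc 0 T) :=
    Integrable.of_bound (D.f_meas x) _ (D.f_bound x)
  refine (intervalIntegrable_iff_integrableOn_Icc_of_le D.pos.le).2 h1 |>.mono_set ?_
  rw [uIcc_of_le D.pos.le]
  exact uIcc_subset_Icc ha hb

theorem norm_integral_le (x : H) {a b : ℝ} (ha : 0 ≤ a) (hab : a ≤ b) (hb : b ≤ T) :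
    ‖∫ s in a..b, f s x‖ ≤ (h x + √γ) * (b - a) := by
  rw [← abs_of_nonneg (sub_nonneg.2 hab)]
  refine intervalIntegral.norm_integral_le_of_norm_le_const_ae ?_
  filter_upwards [(ae_restrict_iff' measurableSet_Icc).1 (D.f_bound x)] with t ht htm
  rw [uIoc_of_le hab] at htm
  exact ht ⟨ha.trans htm.1.le, htm.2.trans hb⟩

end IsDrivenSweeping

namespace IsCatchingUpRun

variable {n : ℕ} {ε η : ℝ} {p : ℕ → H} {X : ℝ → H}

section

variable (R : IsCatchingUpRun T C f x₀ n ε η p X)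
include R

theorem n_pos : (0 : ℝ) < n := by exact_mod_cast R.one_le

theorem step_pos (hT : 0 < T) : 0 < T / n := div_pos hT R.n_pos

theorem mul_step_le (hT : 0 < T) {k : ℕ} (hk : k ≤ n) : k * (T / n) ≤ T := by
  have h1 := R.n_pos
  calc (k : ℝ) * (T / n) ≤ n * (T / n) := by gcongr
    _ = T := by field_simp

theorem step_le (hT : 0 < T) : T / n ≤ T := by simpa using R.mul_step_le hT R.one_le

theorem mul_step_mem (hT : 0 < T) {k : ℕ} (hk : k ≤ n) : k * (T / n) ∈ Icc 0 T :=
  ⟨mul_nonneg k.cast_nonneg (R.step_pos hT).le, R.mul_step_le hT hk⟩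

theorem succ_mul_step_mem (hT : 0 < T) {k : ℕ} (hk : k < n) : (k + 1) * (T / n) ∈ Icc 0 T := by
  have := R.mul_step_mem hT (k := k + 1) hk
  rwa [Nat.cast_succ] at this

end

/-- The predictor of step `k`: the point that is projected, inexactly, on the moving set. -/
noncomputable def predictor (T : ℝ) (f : ℝ → H → H) (n : ℕ) (p : ℕ → H) (k : ℕ) : H :=
  p k + ∫ s in (k * (T / n))..((k + 1) * (T / n)), f s (p k)

variable (R : IsCatchingUpRun T C f x₀ n ε η p X) (D : IsDrivenSweeping T C LC x₀ h Lh γ f)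
include R D

omit D in
theorem exists_mem_near {k : ℕ} (hk : k < n) :
    ∃ z ∈ C ((k + 1) * (T / n)), ‖p (k + 1) - z‖ ≤ η := by
  obtain ⟨S', -, -, hS', hz, -⟩ := R.node_succ k hk
  obtain ⟨z, hzC, b, hb, hzb⟩ := hS' hz
  refine ⟨z, hzC, ?_⟩
  simp only at hzb
  rw [← hzb, add_sub_cancel_left]
  simpa using hb

theorem infDist_node_le {k : ℕ} (hk : k ≤ n) : Metric.infDist (p k) (C (k * (T / n))) ≤ η := by
  cases k with
  | zero =>
    rw [R.node_zero]
    simpa [Metric.infDist_zero_of_mem D.mem] using R.eta_pos.le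
  | succ k =>
    obtain ⟨z, hz, hzp⟩ := R.exists_mem_near (k := k) hk
    rw [Nat.cast_succ]
    refine (Metric.infDist_le_dist_of_mem hz).trans ?_
    rwa [dist_eq_norm]

theorem norm_integral_step_le {k : ℕ} (hk : k < n) :
    ‖∫ s in (k * (T / n))..((k + 1) * (T / n)), f s (p k)‖ ≤ (h (p k) + √γ) * (T / n) := by
  have h1 := D.norm_integral_le (p k) (R.mul_step_mem D.pos hk.le).1
    (by linarith [R.step_pos D.pos] : k * (T / n) ≤ (k + 1) * (T / n))
    (R.succ_mul_step_mem D.pos hk).2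
  have e : (k + 1) * (T / n) - k * (T / n) = T / n := by ring
  rwa [e] at h1

theorem infDist_predictor_le {k : ℕ} (hk : k < n) :
    Metric.infDist (predictor T f n p k) (C ((k + 1) * (T / n)))
      ≤ η + (LC + h (p k) + √γ) * (T / n) := by
  have h1 := D.infDist_le (R.mul_step_mem D.pos hk.le) (R.succ_mul_step_mem D.pos hk) (p k)
  have h2 := R.infDist_node_le D hk.le
  have h3 := R.norm_integral_step_le D hk
  have h4 := Metric.infDist_le_infDist_add_dist (s := C ((k + 1) * (T / n)))
    (x := predictor T f n p k) (y := p k)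
  rw [dist_eq_norm, predictor, add_sub_cancel_left] at h4
  have e : |k * (T / n) - (k + 1) * (T / n)| = T / n := by
    rw [show k * (T / n) - (k + 1) * (T / n) = -(T / n) by ring, abs_neg,
      abs_of_pos (R.step_pos D.pos)]
  rw [e] at h1
  rw [predictor]
  linarith

omit D in
theorem norm_predictor_sub_le {k : ℕ} (hk : k < n) :
    ‖predictor T f n p k - p (k + 1)‖
      ≤ Metric.infDist (predictor T f n p k) (C ((k + 1) * (T / n))) + √ε := by
  obtain ⟨S', -, -, -, -, hz⟩ := R.node_succ k hk
  have h0 := Metric.infDist_nonneg (x := predictor T f n p k) (s := C ((k + 1) * (T / n)))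
  refine (sq_le_sq₀ (norm_nonneg _) (by positivity)).1 (hz.le.trans ?_)
  rw [add_sq, Real.sq_sqrt R.eps_pos.le]
  have : 0 ≤ 2 * Metric.infDist (predictor T f n p k) (C ((k + 1) * (T / n))) * √ε := by
    positivity
  have e : predictor T f n p k
    = p k + ∫ s in (k * (T / n))..((k + 1) * (T / n)), f s (p k) := rfl
  rw [← e]
  linarith

theorem norm_node_succ_sub_le {k : ℕ} (hk : k < n) :
    ‖p (k + 1) - p k‖ ≤ √ε + η + (LC + 2 * h (p k) + 2 * √γ) * (T / n) := by
  have h1 := R.norm_predictor_sub_le hk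
  have h2 := R.infDist_predictor_le D hk
  have h3 := R.norm_integral_step_le D hk
  have e : p (k + 1) - p k = (∫ s in (k * (T / n))..((k + 1) * (T / n)), f s (p k))
      - (predictor T f n p k - p (k + 1)) := by rw [predictor]; abel
  rw [e]
  refine (norm_sub_le _ _).trans ?_
  linarith

/-- The constants of the scheme, for an upper bound `c` of `(√ε + η) / μ`. -/
noncomputable abbrev params (T : ℝ) (LC : ℝ≥0) (x₀ : H) (h : H → ℝ) (Lh : ℝ≥0) (γ c : ℝ) : Params :=
  ⟨T, LC, Lh, h x₀, γ, ‖x₀‖, c⟩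

variable {c : ℝ} (hc : (√ε + η) / (T / n) ≤ c)
include hc

theorem sqrt_add_le : √ε + η ≤ c * (T / n) := (div_le_iff₀ (R.step_pos D.pos)).1 hc

theorem c_pos : 0 < c :=
  lt_of_lt_of_le (div_pos (add_pos_of_nonneg_of_pos (Real.sqrt_nonneg _) R.eta_pos)
    (R.step_pos D.pos)) hc

theorem norm_node_sub_le {k : ℕ} (hk : k ≤ n) :
    ‖p k - x₀‖ ≤ (params T LC x₀ h Lh γ c).K₁ := by
  set B : ℝ := LC + 2 * h x₀ + 2 * √γ + c with hB
  set μ := T / n with hμ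
  have hμ0 : 0 < μ := R.step_pos D.pos
  have hc0 := R.c_pos D hc
  have hh0 := D.h_nonneg x₀
  have hB0 : 0 ≤ B := by positivity
  -- discrete Gronwall inequality
  have hrec : ∀ k ≤ n, ‖p k - x₀‖ ≤ k * μ * B * Real.exp (2 * Lh * (k * μ)) := by
    intro k
    induction k with
    | zero => intro _; simp [R.node_zero]
    | succ k ih =>
      intro hk
      have h1 := ih (Nat.le_of_succ_le hk)
      have h2 := R.norm_node_succ_sub_le D (k := k) hk
      have h3 : h (p k) ≤ h x₀ + Lh * ‖p k - x₀‖ := by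
        have := D.h_lip.dist_le_mul (p k) x₀
        rw [Real.dist_eq, dist_eq_norm] at this
        linarith [le_abs_self (h (p k) - h x₀)]
      have h4 := R.sqrt_add_le D hc
      have h5 : ‖p (k + 1) - x₀‖ ≤ (1 + 2 * Lh * μ) * ‖p k - x₀‖ + B * μ := by
        have e : p (k + 1) - x₀ = (p (k + 1) - p k) + (p k - x₀) := by abel
        rw [e]
        refine (norm_add_le _ _).trans ?_
        have := mul_le_mul_of_nonneg_right h3 hμ0.le
        simp only [← hμ] at h2 h4
        rw [hB]
        linarith
      have h6 : 1 + 2 * Lh * μ ≤ Real.exp (2 * Lh * μ) := by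
        linarith [Real.add_one_le_exp (2 * Lh * μ)]
      have h7 : Real.exp (2 * Lh * ((k + 1 : ℕ) * μ))
          = Real.exp (2 * Lh * μ) * Real.exp (2 * Lh * (k * μ)) := by
        rw [← Real.exp_add]; push_cast; ring_nf
      have h8 : 1 ≤ Real.exp (2 * Lh * ((k + 1 : ℕ) * μ)) := Real.one_le_exp (by positivity)
      calc ‖p (k + 1) - x₀‖
          ≤ Real.exp (2 * Lh * μ) * (k * μ * B * Real.exp (2 * Lh * (k * μ)))
            + B * μ * Real.exp (2 * Lh * ((k + 1 : ℕ) * μ)) := by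
            refine h5.trans (add_le_add ?_ ?_)
            · exact mul_le_mul h6 h1 (norm_nonneg _) (Real.exp_nonneg _)
            · exact le_mul_of_one_le_right (by positivity) h8
        _ = ((k + 1 : ℕ) : ℝ) * μ * B * Real.exp (2 * Lh * ((k + 1 : ℕ) * μ)) := by
            rw [h7]; push_cast; ring
  have h1 := R.mul_step_le D.pos hk
  refine (hrec k hk).trans ?_
  have h2 : 0 ≤ T * B := mul_nonneg D.pos.le hB0
  simp only [Params.K₁, ← hB]
  gcongr

theorem h_node_le {k : ℕ} (hk : k ≤ n) :
    h (p k) + √γ ≤ (params T LC x₀ h Lh γ c).α := by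
  have h1 := R.norm_node_sub_le D hc hk
  have h2 := D.h_lip.dist_le_mul (p k) x₀
  rw [Real.dist_eq, dist_eq_norm] at h2
  have h3 := le_abs_self (h (p k) - h x₀)
  have h4 := mul_le_mul_of_nonneg_left h1 Lh.2
  simp only [Params.α]
  simp only [NNReal.val_eq_coe] at h4
  linarith

theorem α_nonneg : 0 ≤ (params T LC x₀ h Lh γ c).α :=
  (add_nonneg (D.h_nonneg _) (Real.sqrt_nonneg _)).trans (R.h_node_le D hc (Nat.zero_le n))

theorem K₁_nonneg : 0 ≤ (params T LC x₀ h Lh γ c).K₁ :=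
  (norm_nonneg _).trans (R.norm_node_sub_le D hc (Nat.zero_le n))

theorem norm_node_le {k : ℕ} (hk : k ≤ n) :
    ‖p k‖ ≤ (params T LC x₀ h Lh γ c).K₁ + ‖x₀‖ := by
  have h1 := R.norm_node_sub_le D hc hk
  have h2 := norm_add_le (p k - x₀) x₀
  rw [sub_add_cancel] at h2
  linarith

theorem K₁_add_le_K₂ : (params T LC x₀ h Lh γ c).K₁ + ‖x₀‖ ≤ (params T LC x₀ h Lh γ c).K₂ := by
  have h1 := R.α_nonneg D hc
  have h2 := R.c_pos D hc
  have h3 := D.pos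
  have h4 : 0 ≤ T * (LC + 2 * (params T LC x₀ h Lh γ c).α + c) := by positivity
  simp only [Params.K₂]
  linarith

theorem K₂_pos : 0 < (params T LC x₀ h Lh γ c).K₂ := by
  have h1 := R.α_nonneg D hc
  have h2 := R.c_pos D hc
  have h3 := D.pos
  have h5 := R.K₁_nonneg D hc
  have h6 := norm_nonneg x₀
  have h4 : 0 < T * (LC + 2 * (params T LC x₀ h Lh γ c).α + c) := by positivity
  simp only [Params.K₂] at *
  linarith

theorem h_node_le_K₃ {k : ℕ} (hk : k ≤ n) :
    LC + h (p k) + √γ ≤ (params T LC x₀ h Lh γ c).K₃ := by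
  have h1 := (R.norm_node_le D hc hk).trans (R.K₁_add_le_K₂ D hc)
  have h2 := D.h_lip.dist_le_mul (p k) x₀
  rw [Real.dist_eq, dist_eq_norm] at h2
  have h3 := le_abs_self (h (p k) - h x₀)
  have h4 := mul_le_mul_of_nonneg_left ((norm_sub_le (p k) x₀).trans (add_le_add_left h1 ‖x₀‖))
    Lh.2
  simp only [Params.K₃]
  simp only [NNReal.val_eq_coe] at h4
  linarith

theorem K₃_nonneg : 0 ≤ (params T LC x₀ h Lh γ c).K₃ :=
  (add_nonneg (add_nonneg LC.2 (D.h_nonneg _)) (Real.sqrt_nonneg _)).trans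
    (R.h_node_le_K₃ D hc (Nat.zero_le n))

theorem σ_pos : 0 < (params T LC x₀ h Lh γ c).σ ε η (T / n) := by
  have h1 := R.K₃_nonneg D hc
  have h2 := R.eps_pos
  have h3 := R.eta_pos
  have h4 := R.step_pos D.pos
  simp only [Params.σ]
  positivity

theorem norm_predictor_sub_le' {k : ℕ} (hk : k < n) :
    ‖predictor T f n p k - p (k + 1)‖
      ≤ (LC + (params T LC x₀ h Lh γ c).α) * (T / n) + √ε + η := by
  have h1 := R.norm_predictor_sub_le hk
  have h2 := R.infDist_predictor_le D hk
  have h3 := mul_le_mul_of_nonneg_right (R.h_node_le D hc hk.le) (R.step_pos D.pos).le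
  linarith

/-- Each step is close to the exact solution of a projection problem: near the new node there is a
point of the moving set with a proximal normal close to the displacement. -/
theorem exists_normal [CompleteSpace H] {k : ℕ} (hk : k < n) :
    ∃ v ∈ C ((k + 1) * (T / n)), ∃ ζ ∈ proximalNormalCone (C ((k + 1) * (T / n))) v,
      ‖v - p (k + 1)‖ ≤ 2 * √((params T LC x₀ h Lh γ c).σ ε η (T / n)) + η ∧
      ‖ζ - (predictor T f n p k - p (k + 1))‖
        ≤ 3 * √((params T LC x₀ h Lh γ c).σ ε η (T / n)) + η ∧
      ‖ζ‖ ≤ 4 * √((params T LC x₀ h Lh γ c).σ ε η (T / n))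
        + (LC + h (p k) + √γ) * (T / n) + η := by
  obtain ⟨z, hzC, hz⟩ := R.exists_mem_near hk
  set q := predictor T f n p k with hq
  set σ := (params T LC x₀ h Lh γ c).σ ε η (T / n) with hσ
  set d := Metric.infDist q (C ((k + 1) * (T / n))) with hd
  have hd0 : 0 ≤ d := Metric.infDist_nonneg
  have hεs : √ε ^ 2 = ε := Real.sq_sqrt R.eps_pos.le
  have hη := R.eta_pos
  have hμ := R.step_pos D.pos
  have h1 : ‖q - p (k + 1)‖ ^ 2 ≤ d ^ 2 + ε := by
    obtain ⟨S', -, -, -, -, hz'⟩ := R.node_succ k hk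
    exact hz'.le
  have h2 := R.norm_predictor_sub_le hk
  have h3 := R.infDist_predictor_le D hk
  have h4 := mul_le_mul_of_nonneg_right (R.h_node_le_K₃ D hc hk.le) hμ.le
  rw [← hq, ← hd] at h2 h3
  have h5 : ‖q - z‖ ≤ ‖q - p (k + 1)‖ + η := by
    have e : q - z = (q - p (k + 1)) + (p (k + 1) - z) := by abel
    rw [e]
    exact (norm_add_le _ _).trans (by linarith)
  -- a point `z` of the moving set within `η` of the new node is a `σ`-approximate projection of `q`
  have h6 : ‖q - z‖ ^ 2 ≤ d ^ 2 + σ := by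
    have h7 := pow_le_pow_left₀ (norm_nonneg _) h5 2
    have h8 : ‖q - p (k + 1)‖ * η
        ≤ ((params T LC x₀ h Lh γ c).K₃ * (T / n) + η + √ε) * η :=
      mul_le_mul_of_nonneg_right (by linarith) hη.le
    have h9 : 2 * η * √ε ≤ η ^ 2 + ε := by nlinarith [sq_nonneg (η - √ε)]
    rw [hσ, Params.σ]
    nlinarith
  obtain ⟨v, hv, ζ, hζ, hvz, hζz, hζn⟩ := exists_proximalNormal_near
    (D.isClosed _ (R.succ_mul_step_mem D.pos hk)) (R.σ_pos D hc) hzC h6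
  refine ⟨v, hv, ζ, hζ, ?_, ?_, by linarith⟩
  · have e : v - p (k + 1) = (v - z) - (p (k + 1) - z) := by abel
    rw [e]
    exact (norm_sub_le _ _).trans (by linarith)
  · have e : ζ - (q - p (k + 1)) = (ζ - (q - z)) + (p (k + 1) - z) := by abel
    rw [e]
    exact (norm_add_le _ _).trans (by linarith)

end IsCatchingUpRun

end Scheme

/-! ### The interpolants as approximate solutions -/

section Interpolants

variable {H : Type*} [NormedAddCommGroup H] [InnerProductSpace ℝ H]

/-- `X` solves approximately the perturbed sweeping process: its derivative is `g - U`, where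
`g t = f t (y t)` for a point `y t` at distance at most `a` of `X t`, and where `U t` is within `e`
of a proximal normal `ν t` to `C (θ t)` at a point `V t` at distance at most `a + w` of `X t`, with
`θ t` within `μ` of `t`. The other numbers bound the norms of the objects (`α` for `g`, `B` for `U`,
`M` for `X` and `y`, `Γ` for `ν`) and, through `d`, the distance from `X t` to the moving set. -/
structure IsApproxSolution (T : ℝ) (C : ℝ → Set H) (LC : ℝ≥0) (f : ℝ → H → H) (x₀ : H)
    (α B M Γ μ a w e d : ℝ) (X g U y ν V : ℝ → H) (θ : ℝ → ℝ) : Prop where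
  int_g : IntervalIntegrable g volume 0 T
  int_U : IntervalIntegrable U volume 0 T
  eq_integral : ∀ t ∈ Icc 0 T, X t = x₀ + ∫ s in (0 : ℝ)..t, (g s - U s)
  g_eq : ∀ t ∈ Ioc 0 T, g t = f t (y t)
  norm_g : ∀ᵐ t ∂volume.restrict (Icc 0 T), ‖g t‖ ≤ α
  norm_U : ∀ t ∈ Ioc 0 T, ‖U t‖ ≤ B
  norm_X : ∀ t ∈ Ioc 0 T, ‖X t‖ ≤ M
  norm_y : ∀ t ∈ Ioc 0 T, ‖y t‖ ≤ M
  norm_X_sub_y : ∀ t ∈ Ioc 0 T, ‖X t - y t‖ ≤ a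
  θ_mem : ∀ t ∈ Ioc 0 T, θ t ∈ Icc 0 T
  θ_sub : ∀ t ∈ Ioc 0 T, |θ t - t| ≤ μ
  V_mem : ∀ t ∈ Ioc 0 T, V t ∈ C (θ t)
  ν_mem : ∀ t ∈ Ioc 0 T, ν t ∈ proximalNormalCone (C (θ t)) (V t)
  norm_V_sub_X : ∀ t ∈ Ioc 0 T, ‖V t - X t‖ ≤ a + w
  norm_V : ∀ t ∈ Ioc 0 T, ‖V t‖ ≤ M + w
  norm_ν_sub_U : ∀ t ∈ Ioc 0 T, ‖ν t - U t‖ ≤ e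
  norm_ν : ∀ t ∈ Ioc 0 T, ‖ν t‖ ≤ Γ
  infDist_X : ∀ t ∈ Ioc 0 T, ∀ s ∈ Icc 0 T, Metric.infDist (X t) (C s) ≤ d + LC * |t - s|

/-- The index of the step of length `μ` to which the time `t` belongs. -/
noncomputable def stepIndex (μ t : ℝ) : ℕ := ⌈t / μ⌉₊ - 1

theorem stepIndex_eq {μ t : ℝ} (hμ : 0 < μ) {k : ℕ} (ht : t ∈ Ioc (k * μ) ((k + 1) * μ)) :
    stepIndex μ t = k := by
  have h1 : ⌈t / μ⌉₊ = k + 1 := by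
    rw [Nat.ceil_eq_iff (Nat.succ_ne_zero k)]
    refine ⟨?_, ?_⟩
    · rw [lt_div_iff₀ hμ]; simpa using ht.1
    · rw [div_le_iff₀ hμ]; push_cast; exact ht.2
  rw [stepIndex, h1, Nat.add_sub_cancel]

theorem stepIndex_spec {T t : ℝ} {n : ℕ} (hT : 0 < T) (hn : 1 ≤ n) (ht : t ∈ Ioc 0 T) :
    stepIndex (T / n) t < n ∧
      t ∈ Ioc (stepIndex (T / n) t * (T / n)) ((stepIndex (T / n) t + 1) * (T / n)) := by
  have hn0 : (0 : ℝ) < n := by exact_mod_cast hn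
  have hμ : 0 < T / n := div_pos hT hn0
  have h1 : 0 < ⌈t / (T / n)⌉₊ := Nat.ceil_pos.2 (div_pos ht.1 hμ)
  have h2 : ⌈t / (T / n)⌉₊ ≤ n := by
    rw [Nat.ceil_le, div_le_iff₀ hμ]
    have e : n * (T / n) = T := by field_simp
    rw [e]; exact ht.2
  have h3 : stepIndex (T / n) t + 1 = ⌈t / (T / n)⌉₊ := by rw [stepIndex]; omega
  have h4 : ((stepIndex (T / n) t : ℝ) + 1) = (⌈t / (T / n)⌉₊ : ℝ) := by exact_mod_cast h3
  refine ⟨by omega, ?_, ?_⟩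
  · rw [← lt_div_iff₀ hμ]
    have := Nat.ceil_lt_add_one (div_pos ht.1 hμ).le
    linarith
  · rw [h4, ← div_le_iff₀ hμ]
    exact Nat.le_ceil _

namespace IsCatchingUpRun

variable {T : ℝ} {C : ℝ → Set H} {LC : ℝ≥0} {x₀ : H} {h : H → ℝ} {Lh : ℝ≥0} {γ : ℝ}
  {f : ℝ → H → H} {n : ℕ} {ε η : ℝ} {p : ℕ → H} {X : ℝ → H}
  (R : IsCatchingUpRun T C f x₀ n ε η p X) (D : IsDrivenSweeping T C LC x₀ h Lh γ f)

/-- The correction of step `k`, per unit of time. -/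
noncomputable def correction (T : ℝ) (f : ℝ → H → H) (n : ℕ) (p : ℕ → H) (k : ℕ) : H :=
  (T / n)⁻¹ • (predictor T f n p k - p (k + 1))

include R

theorem interp_eq {k : ℕ} (hk : k < n) {t : ℝ}
    (ht : t ∈ Ioc (k * (T / n)) ((k + 1) * (T / n))) :
    X t = p k + ((∫ s in (k * (T / n))..t, f s (p k))
      - (t - k * (T / n)) • correction T f n p k) := by
  rw [R.interp k hk t ht, correction, predictor, smul_smul, div_eq_mul_inv]
  module

theorem interp_node (hT : 0 < T) {k : ℕ} (hk : k ≤ n) : X (k * (T / n)) = p k := by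
  cases k with
  | zero => simp [R.interp_zero, R.node_zero]
  | succ k =>
    have hμ := R.step_pos hT
    rw [Nat.cast_succ, R.interp k hk _ ⟨by linarith, le_rfl⟩]
    have e : ((k + 1) * (T / n) - k * (T / n)) / (T / n) = 1 := by
      rw [← sub_mul, add_sub_cancel_left, one_mul, div_self hμ.ne']
    rw [e, one_smul]
    abel

include D

/-- The derivative of the interpolant is the perturbation frozen at the last node minus the
correction. -/
theorem intervalIntegrable_and_eq_integral [CompleteSpace H] :
    IntervalIntegrable (fun t => f t (p (stepIndex (T / n) t))) volume 0 T ∧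
    IntervalIntegrable (fun t => correction T f n p (stepIndex (T / n) t)) volume 0 T ∧
    ∀ t ∈ Icc 0 T, X t = x₀ + ∫ s in (0 : ℝ)..t,
      (f s (p (stepIndex (T / n) s)) - correction T f n p (stepIndex (T / n) s)) := by
  set μ := T / n with hμd
  have hμ : 0 < μ := R.step_pos D.pos
  have hend : (n : ℝ) * μ = T := by have := R.n_pos; rw [hμd]; field_simp
  have hle : ∀ k : ℕ, k * μ ≤ (k + 1) * μ := fun k => by linarith
  have hidx : ∀ k : ℕ, ∀ s ∈ uIoc (k * μ) ((k + 1) * μ), stepIndex μ s = k := fun k s hs => by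
    rw [uIoc_of_le (hle k)] at hs
    exact stepIndex_eq hμ hs
  have hg : ∀ k < n, IntervalIntegrable (fun t => f t (p (stepIndex μ t))) volume
      (k * μ) ((k + 1) * μ) := fun k hk => by
    refine (intervalIntegrable_congr fun s hs => ?_).1 (D.intervalIntegrable (p k)
      (R.mul_step_mem D.pos hk.le) (R.succ_mul_step_mem D.pos hk))
    simp only [hidx k s hs]
  have hU : ∀ k < n, IntervalIntegrable (fun t => correction T f n p (stepIndex μ t)) volume
      (k * μ) ((k + 1) * μ) := fun k hk => by
    refine (intervalIntegrable_congr fun s hs => ?_).1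
      (intervalIntegrable_const (c := correction T f n p k))
    simp only [hidx k s hs]
  have hglue : ∀ G : ℝ → H, (∀ k < n, IntervalIntegrable G volume (k * μ) ((k + 1) * μ)) →
      IntervalIntegrable G volume 0 T := fun G hG => by
    have := IntervalIntegrable.trans_iterate (f := G) (μ := volume) (a := fun k : ℕ => k * μ)
      (n := n) fun k hk => by simpa using hG k hk
    simpa [hend] using this
  have hgT := hglue _ hg
  have hUT := hglue _ hU
  refine ⟨hgT, hUT, ?_⟩
  set G : ℝ → H := fun s => f s (p (stepIndex μ s)) - correction T f n p (stepIndex μ s) with hG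
  have hGT : IntervalIntegrable G volume 0 T := hgT.sub hUT
  have hGab : ∀ {a b : ℝ}, a ∈ Icc 0 T → b ∈ Icc 0 T → IntervalIntegrable G volume a b :=
    fun ha hb => hGT.mono_set (by rw [uIcc_of_le D.pos.le]; exact uIcc_subset_Icc ha hb)
  have hstep : ∀ k < n, ∀ t ∈ Ioc (k * μ) ((k + 1) * μ), X t = p k + ∫ s in (k * μ)..t, G s := by
    intro k hk t ht
    have htT : t ∈ Icc 0 T :=
      ⟨(R.mul_step_mem D.pos hk.le).1.trans ht.1.le, ht.2.trans (R.succ_mul_step_mem D.pos hk).2⟩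
    have e1 : ∫ s in (k * μ)..t, G s = ∫ s in (k * μ)..t, (f s (p k) - correction T f n p k) := by
      refine intervalIntegral.integral_congr_ae (Eventually.of_forall fun s hs => ?_)
      rw [uIoc_of_le ht.1.le] at hs
      simp only [hG, stepIndex_eq hμ ⟨hs.1, hs.2.trans ht.2⟩]
    rw [R.interp_eq hk ht, e1, intervalIntegral.integral_sub
      (D.intervalIntegrable (p k) (R.mul_step_mem D.pos hk.le) htT) intervalIntegrable_const,
      intervalIntegral.integral_const]
  have hnode : ∀ k ≤ n, p k = x₀ + ∫ s in (0 : ℝ)..(k * μ), G s := by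
    intro k
    induction k with
    | zero => intro _; simp [R.node_zero]
    | succ k ih =>
      intro hk
      have h1 := hstep k hk ((k + 1) * μ) ⟨by linarith, le_rfl⟩
      have h2 := R.interp_node D.pos hk
      rw [Nat.cast_succ] at h2
      rw [Nat.cast_succ, ← h2, h1, ih (Nat.le_of_succ_le hk), add_assoc,
        intervalIntegral.integral_add_adjacent_intervals
          (hGab ⟨le_rfl, D.pos.le⟩ (R.mul_step_mem D.pos (Nat.le_of_succ_le hk)))
          (hGab (R.mul_step_mem D.pos (Nat.le_of_succ_le hk)) (R.succ_mul_step_mem D.pos hk))]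
  intro t ht
  rcases ht.1.eq_or_lt with h0 | h0
  · rw [← h0, R.interp_zero]; simp
  · obtain ⟨hk, hkt⟩ := stepIndex_spec D.pos R.one_le ⟨h0, ht.2⟩
    rw [hstep _ hk t hkt, hnode _ hk.le, add_assoc,
      intervalIntegral.integral_add_adjacent_intervals
        (hGab ⟨le_rfl, D.pos.le⟩ (R.mul_step_mem D.pos hk.le))
        (hGab (R.mul_step_mem D.pos hk.le) ht)]

variable {c : ℝ} (hc : (√ε + η) / (T / n) ≤ c)
include hc

theorem norm_interp_sub_le {k : ℕ} (hk : k < n) {t : ℝ}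
    (ht : t ∈ Ioc (k * (T / n)) ((k + 1) * (T / n))) :
    ‖X t - p k‖ ≤ (params T LC x₀ h Lh γ c).K₄ * (T / n) + √ε + η ∧
    ‖X t - p (k + 1)‖ ≤ (params T LC x₀ h Lh γ c).K₄ * (T / n) + √ε + η := by
  set μ := T / n with hμd
  have hμ : 0 < μ := R.step_pos D.pos
  set α := (params T LC x₀ h Lh γ c).α with hα
  have hα0 : 0 ≤ α := R.α_nonneg D hc
  have hK4 : (params T LC x₀ h Lh γ c).K₄ = LC + 2 * α := rfl
  set q := predictor T f n p k with hq
  have h1 : ‖q - p (k + 1)‖ ≤ (LC + α) * μ + √ε + η := R.norm_predictor_sub_le' D hc hk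
  have hk0 := (R.mul_step_mem D.pos hk.le)
  have hk1 := (R.succ_mul_step_mem D.pos hk)
  have htT : t ∈ Icc 0 T := ⟨hk0.1.trans ht.1.le, ht.2.trans hk1.2⟩
  have hh := R.h_node_le D hc hk.le
  set r := (t - k * μ) / μ with hr
  have hr0 : 0 ≤ r := div_nonneg (by linarith [ht.1]) hμ.le
  have hr1 : r ≤ 1 := by rw [hr, div_le_one hμ]; linarith [ht.2]
  have hXt : X t = p k + ((∫ s in (k * μ)..t, f s (p k)) - r • (q - p (k + 1))) := by
    rw [R.interp_eq hk ht, correction, smul_smul, ← div_eq_mul_inv]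
  have hsplit : (∫ s in (k * μ)..t, f s (p k)) + ∫ s in t..((k + 1) * μ), f s (p k)
      = ∫ s in (k * μ)..((k + 1) * μ), f s (p k) :=
    intervalIntegral.integral_add_adjacent_intervals
      (D.intervalIntegrable _ hk0 htT) (D.intervalIntegrable _ htT hk1)
  have hq' : q = p k + ∫ s in (k * μ)..((k + 1) * μ), f s (p k) := rfl
  constructor
  · rw [hXt, add_sub_cancel_left]
    have h2 : ‖∫ s in (k * μ)..t, f s (p k)‖ ≤ α * μ :=
      (D.norm_integral_le (p k) hk0.1 ht.1.le htT.2).trans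
        (mul_le_mul hh (by linarith [ht.2]) (by linarith [ht.1]) hα0)
    have h3 : ‖r • (q - p (k + 1))‖ ≤ ‖q - p (k + 1)‖ := by
      rw [norm_smul, Real.norm_eq_abs, abs_of_nonneg hr0]
      exact mul_le_of_le_one_left (norm_nonneg _) hr1
    refine (norm_sub_le _ _).trans ?_
    rw [hK4]
    linarith
  · have e : X t - p (k + 1) = (1 - r) • (q - p (k + 1)) - ∫ s in t..((k + 1) * μ), f s (p k) := by
      rw [sub_smul, one_smul]
      nth_rewrite 1 [hq']
      rw [← hsplit, hXt]
      abel
    rw [e]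
    have h2 : ‖∫ s in t..((k + 1) * μ), f s (p k)‖ ≤ α * μ :=
      (D.norm_integral_le (p k) htT.1 ht.2 hk1.2).trans
        (mul_le_mul hh (by linarith [ht.1]) (by linarith [ht.2]) hα0)
    have h3 : ‖(1 - r) • (q - p (k + 1))‖ ≤ ‖q - p (k + 1)‖ := by
      rw [norm_smul, Real.norm_eq_abs, abs_of_nonneg (by linarith)]
      exact mul_le_of_le_one_left (norm_nonneg _) (by linarith)
    refine (norm_sub_le _ _).trans ?_
    rw [hK4]
    linarith

/-- The interpolant of a run of the algorithm is an approximate solution: on each step the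
perturbation is frozen at the last node, `U` is the correction per unit of time, and `ν` is the
proximal normal obtained from the projection step, at the time `θ` of the next node. -/
theorem exists_isApproxSolution [CompleteSpace H] {Γ : ℝ}
    (hΓ : ∀ j < n, (4 * √((params T LC x₀ h Lh γ c).σ ε η (T / n))
      + (LC + h (p j) + √γ) * (T / n) + η) / (T / n) ≤ Γ) :
    ∃ (g U y ν V : ℝ → H) (θ : ℝ → ℝ), IsApproxSolution T C LC f x₀
      (params T LC x₀ h Lh γ c).α (params T LC x₀ h Lh γ c).K₇ (params T LC x₀ h Lh γ c).K₂ Γ (T / n)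
      ((params T LC x₀ h Lh γ c).K₄ * (T / n) + √ε + η)
      (2 * √((params T LC x₀ h Lh γ c).σ ε η (T / n)) + η)
      ((3 * √((params T LC x₀ h Lh γ c).σ ε η (T / n)) + η) / (T / n))
      ((params T LC x₀ h Lh γ c).K₄ * (T / n) + √ε + 2 * η + LC * (T / n)) X g U y ν V θ := by
  have hμ : 0 < T / n := R.step_pos D.pos
  obtain ⟨hgint, hUint, hrepr⟩ := R.intervalIntegrable_and_eq_integral D
  have hex : ∀ k : ℕ, ∃ v ζ : H, k < n → v ∈ C ((k + 1) * (T / n)) ∧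
      ζ ∈ proximalNormalCone (C ((k + 1) * (T / n))) v ∧
      ‖v - p (k + 1)‖ ≤ 2 * √((params T LC x₀ h Lh γ c).σ ε η (T / n)) + η ∧
      ‖ζ - (predictor T f n p k - p (k + 1))‖
        ≤ 3 * √((params T LC x₀ h Lh γ c).σ ε η (T / n)) + η ∧
      ‖ζ‖ ≤ 4 * √((params T LC x₀ h Lh γ c).σ ε η (T / n))
        + (LC + h (p k) + √γ) * (T / n) + η := fun k => by
    by_cases hk : k < n
    · obtain ⟨v, hv, ζ, h1⟩ := R.exists_normal D hc hk
      exact ⟨v, ζ, fun _ => ⟨hv, h1⟩⟩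
    · exact ⟨0, 0, fun h => absurd h hk⟩
  choose v ζ hv hζ hvp hζq hζn using hex
  have hα := R.α_nonneg D hc
  have hcμ := R.sqrt_add_le D hc
  have hc0 := R.c_pos D hc
  have hμT := R.step_le D.pos
  have hη := R.eta_pos
  have hK4 : (params T LC x₀ h Lh γ c).K₄ = LC + 2 * (params T LC x₀ h Lh γ c).α := rfl
  have hK7 : (params T LC x₀ h Lh γ c).K₇ = c + LC + 2 * (params T LC x₀ h Lh γ c).α := rfl
  have hK2 : (params T LC x₀ h Lh γ c).K₂ = (params T LC x₀ h Lh γ c).K₁ + ‖x₀‖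
    + T * (LC + 2 * (params T LC x₀ h Lh γ c).α + c) := rfl
  have hM := R.K₁_add_le_K₂ D hc
  refine ⟨_, _, fun t => p (stepIndex (T / n) t),
    fun t => (T / n)⁻¹ • ζ (stepIndex (T / n) t), fun t => v (stepIndex (T / n) t),
    fun t => (stepIndex (T / n) t + 1) * (T / n), hgint, hUint, hrepr, fun t _ => rfl,
    ?_, ?_, ?_, ?_, ?_, ?_, ?_, ?_, ?_, ?_, ?_, ?_, ?_, ?_⟩
  · have h1 : ∀ k : ℕ, ∀ᵐ t ∂volume.restrict (Icc 0 T), ‖f t (p k)‖ ≤ h (p k) + √γ :=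
      fun k => D.f_bound (p k)
    have h2 : ∀ᵐ t ∂volume.restrict (Icc 0 T), t ≠ 0 :=
      ae_restrict_of_ae (Measure.ae_ne volume 0)
    filter_upwards [ae_all_iff.2 h1, h2, ae_restrict_mem measurableSet_Icc] with t ht h0 htm
    exact (ht _).trans (R.h_node_le D hc
      (stepIndex_spec D.pos R.one_le ⟨lt_of_le_of_ne htm.1 h0.symm, htm.2⟩).1.le)
  all_goals
    intro t ht
    obtain ⟨hk, hkt⟩ := stepIndex_spec D.pos R.one_le ht
    set k := stepIndex (T / n) t
    obtain ⟨hXk, hXk1⟩ := R.norm_interp_sub_le D hc hk hkt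
  · have h1 := R.norm_predictor_sub_le' D hc hk
    rw [correction, norm_smul, norm_inv, Real.norm_eq_abs, abs_of_pos hμ, inv_mul_le_iff₀ hμ, hK7]
    have := mul_nonneg hα hμ.le
    linarith
  · have h1 := R.norm_node_le D hc hk.le
    have h2 := norm_add_le (X t - p k) (p k)
    rw [sub_add_cancel] at h2
    rw [hK4] at hXk
    have h3 : (LC + 2 * (params T LC x₀ h Lh γ c).α + c) * (T / n)
        ≤ (LC + 2 * (params T LC x₀ h Lh γ c).α + c) * T := by gcongr
    rw [hK2]
    linarith
  · exact (R.norm_node_le D hc hk.le).trans hM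
  · exact hXk
  · exact R.succ_mul_step_mem D.pos hk
  · rw [abs_of_nonneg (by linarith [hkt.2])]
    linarith [hkt.1]
  · exact hv k hk
  · exact smul_mem_proximalNormalCone (by positivity) (hζ k hk)
  · have e : v k - X t = (v k - p (k + 1)) - (X t - p (k + 1)) := by abel
    rw [e]
    exact (norm_sub_le _ _).trans (by linarith [hvp k hk])
  · have h1 := norm_add_le (v k - p (k + 1)) (p (k + 1))
    rw [sub_add_cancel] at h1
    have h2 := R.norm_node_le D hc (k := k + 1) hk
    linarith [hvp k hk]
  · rw [correction, ← smul_sub, norm_smul, norm_inv, Real.norm_eq_abs, abs_of_pos hμ,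
      inv_mul_eq_div]
    exact div_le_div_of_nonneg_right (hζq k hk) hμ.le
  · rw [norm_smul, norm_inv, Real.norm_eq_abs, abs_of_pos hμ, inv_mul_eq_div]
    exact (div_le_div_of_nonneg_right (hζn k hk) hμ.le).trans (hΓ k hk)
  · intro s hs
    have h1 := D.infDist_le (R.mul_step_mem D.pos hk.le) hs (X t)
    have h2 := Metric.infDist_le_infDist_add_dist (s := C (k * (T / n))) (x := X t) (y := p k)
    rw [dist_eq_norm] at h2
    have h3 := R.infDist_node_le D hk.le
    have h4 : |k * (T / n) - s| ≤ T / n + |t - s| := by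
      refine (abs_sub_le _ t _).trans ?_
      gcongr
      rw [abs_sub_comm, abs_of_nonneg (by linarith [hkt.1])]
      linarith [hkt.2]
    have h5 : (LC : ℝ) * |k * (T / n) - s| ≤ LC * (T / n + |t - s|) := by gcongr
    linarith

end IsCatchingUpRun

end Interpolants

/-! ### Comparison of two approximate solutions -/

section Comparison

variable {H : Type*} [NormedAddCommGroup H] [InnerProductSpace ℝ H]

/-- If `U` is within `e` of a proximal normal `ν` at a point `V` of a prox-regular set close to `X`,
and `Y` is close to the set, then `-U` does not point from `Y` to `X`, up to errors. -/
theorem IsUniformlyProxRegular.inner_neg_le {ρ : ℝ≥0∞} {S : Set H}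
    (hS : IsUniformlyProxRegular ρ S) {U ν X Y V : H} {B b e M w δ N Γ : ℝ} (hV : V ∈ S)
    (hν : ν ∈ proximalNormalCone S V) (hU : ‖U‖ ≤ B) (hVX : ‖V - X‖ ≤ b) (he : ‖ν - U‖ ≤ e)
    (hVn : ‖V‖ ≤ M + w) (hY : ‖Y‖ ≤ M) (hN : ‖ν‖ ≤ N) (hΓ : ‖ν‖ ≤ Γ)
    (hδ : Metric.infDist Y S ≤ δ) :
    inner ℝ (-U) (X - Y) ≤ B * b + e * (2 * M + w) + N * δ
      + Γ / 2 * ρ⁻¹.toReal * (‖X - Y‖ + b + δ) ^ 2 := by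
  set c := ρ⁻¹.toReal
  have hc0 : 0 ≤ c := ENNReal.toReal_nonneg
  have hB0 := (norm_nonneg _).trans hU
  have he0 := (norm_nonneg _).trans he
  have hN0 := (norm_nonneg _).trans hN
  have hΓ0 := (norm_nonneg _).trans hΓ
  have h1 : ∀ δ' : ℝ, δ < δ' → inner ℝ (-U) (X - Y) ≤ B * b + e * (2 * M + w) + N * δ'
      + Γ / 2 * c * (‖X - Y‖ + b + δ') ^ 2 := by
    intro δ' hδ'
    obtain ⟨z, hz, hYz⟩ := (Metric.infDist_lt_iff ⟨V, hV⟩).1 (hδ.trans_lt hδ')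
    rw [dist_eq_norm] at hYz
    have e1 : inner ℝ (-U) (X - Y) = inner ℝ U (V - X) + inner ℝ (U - ν) (Y - V)
        + inner ℝ ν (Y - z) + inner ℝ ν (z - V) := by
      simp only [inner_neg_left, inner_sub_left, inner_sub_right]; ring
    have h2 : inner ℝ U (V - X) ≤ B * b :=
      (real_inner_le_norm _ _).trans (mul_le_mul hU hVX (norm_nonneg _) hB0)
    have h3 : inner ℝ (U - ν) (Y - V) ≤ e * (2 * M + w) := by
      refine (real_inner_le_norm _ _).trans ?_
      rw [norm_sub_rev] at he
      exact mul_le_mul he ((norm_sub_le _ _).trans (by linarith)) (norm_nonneg _) he0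
    have h4 : inner ℝ ν (Y - z) ≤ N * δ' :=
      (real_inner_le_norm _ _).trans (mul_le_mul hN hYz.le (norm_nonneg _) hN0)
    have h5 : inner ℝ ν (z - V) ≤ Γ / 2 * c * (‖X - Y‖ + b + δ') ^ 2 := by
      refine (hS.2 V hV ν hν z hz).trans ?_
      have h6 : ‖z - V‖ ≤ ‖X - Y‖ + b + δ' := by
        have e3 : z - V = -((V - X) + (X - Y) + (Y - z)) := by abel
        rw [e3, norm_neg]
        exact (norm_add₃_le).trans (by linarith)
      gcongr
    linarith
  have hcont : Continuous fun δ' : ℝ => B * b + e * (2 * M + w) + N * δ'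
      + Γ / 2 * c * (‖X - Y‖ + b + δ') ^ 2 := by fun_prop
  refine ge_of_tendsto ((hcont.tendsto δ).mono_left nhdsWithin_le_nhds :
    Tendsto _ (𝓝[>] δ) _) ?_
  filter_upwards [self_mem_nhdsWithin] with δ' hδ' using h1 δ' hδ'

namespace IsApproxSolution

variable {T : ℝ} {C : ℝ → Set H} {LC : ℝ≥0} {f : ℝ → H → H} {x₀ : H}
  {α B M Γ μ a w e d : ℝ} {X g U y ν V : ℝ → H} {θ : ℝ → ℝ}

section

variable (S : IsApproxSolution T C LC f x₀ α B M Γ μ a w e d X g U y ν V θ)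
include S

theorem norm_sub_le (hT : 0 < T) {s t : ℝ} (hs : s ∈ Icc 0 T) (ht : t ∈ Icc 0 T) :
    ‖X t - X s‖ ≤ (α + B) * |t - s| := by
  have hint : ∀ r ∈ Icc 0 T, IntervalIntegrable (fun s => g s - U s) volume 0 r := fun r hr =>
    (S.int_g.sub S.int_U).mono_set
      (by rw [uIcc_of_le hr.1, uIcc_of_le hT.le]; exact Icc_subset_Icc_right hr.2)
  rw [S.eq_integral t ht, S.eq_integral s hs, add_sub_add_left_eq_sub,
    intervalIntegral.integral_interval_sub_left (hint t ht) (hint s hs)]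
  refine intervalIntegral.norm_integral_le_of_norm_le_const_ae ?_
  filter_upwards [(ae_restrict_iff' measurableSet_Icc).1 S.norm_g] with r hr hrm
  have hr' : r ∈ Ioc 0 T :=
    ⟨(le_min hs.1 ht.1).trans_lt hrm.1, hrm.2.trans (max_le hs.2 ht.2)⟩
  exact (_root_.norm_sub_le _ _).trans
    (add_le_add (hr (Ioc_subset_Icc_self hr')) (S.norm_U r hr'))

theorem absolutelyContinuous (hT : 0 < T) : AbsolutelyContinuousOnInterval X 0 T := by
  have h1 : LipschitzOnWith (Real.toNNReal (α + B)) X (uIcc 0 T) := by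
    refine LipschitzOnWith.of_dist_le_mul fun s hs t ht => ?_
    rw [uIcc_of_le hT.le] at hs ht
    rw [dist_eq_norm, Real.dist_eq]
    refine (S.norm_sub_le hT ht hs).trans ?_
    gcongr
    exact Real.le_coe_toNNReal _
  exact h1.absolutelyContinuousOnInterval

theorem ae_hasDerivAt [CompleteSpace H] (hT : 0 < T) :
    ∀ᵐ t ∂volume.restrict (Icc 0 T), t ∈ Ioo 0 T ∧ HasDerivAt X (g t - U t) t := by
  have h1 := (S.int_g.sub S.int_U).ae_hasDerivAt_integral
  rw [ae_restrict_iff' measurableSet_Icc]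
  filter_upwards [h1, Measure.ae_ne volume 0, Measure.ae_ne volume T] with t ht h0 hT' htm
  have hto : t ∈ Ioo 0 T := ⟨lt_of_le_of_ne htm.1 h0.symm, lt_of_le_of_ne htm.2 hT'⟩
  rw [uIcc_of_le hT.le] at ht
  have h2 := (ht htm 0 (left_mem_Icc.2 hT.le)).const_add x₀
  refine ⟨hto, h2.congr_of_eventuallyEq ?_⟩
  filter_upwards [Ioo_mem_nhds hto.1 hto.2] with s hs
  exact S.eq_integral s (Ioo_subset_Icc_self hs)

theorem nonneg (hT : 0 < T) : 0 ≤ a ∧ 0 ≤ a + w ∧ 0 ≤ e ∧ 0 ≤ μ ∧ 0 ≤ d ∧ 0 ≤ Γ ∧ 0 ≤ B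
    ∧ 0 ≤ M ∧ 0 ≤ M + w := by
  have h0 : T ∈ Ioc 0 T := ⟨hT, le_rfl⟩
  refine ⟨(norm_nonneg _).trans (S.norm_X_sub_y T h0), (norm_nonneg _).trans (S.norm_V_sub_X T h0),
    (norm_nonneg _).trans (S.norm_ν_sub_U T h0), (abs_nonneg _).trans (S.θ_sub T h0), ?_,
    (norm_nonneg _).trans (S.norm_ν T h0), (norm_nonneg _).trans (S.norm_U T h0),
    (norm_nonneg _).trans (S.norm_X T h0), (norm_nonneg _).trans (S.norm_V T h0)⟩
  simpa using Metric.infDist_nonneg.trans (S.infDist_X T h0 T ⟨hT.le, le_rfl⟩)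

end

variable {Γ' μ' a' w' e' d' : ℝ} {X' g' U' y' ν' V' : ℝ → H} {θ' : ℝ → ℝ}

theorem infDist_le_of_pair
    (S : IsApproxSolution T C LC f x₀ α B M Γ μ a w e d X g U y ν V θ)
    (S' : IsApproxSolution T C LC f x₀ α B M Γ' μ' a' w' e' d' X' g' U' y' ν' V' θ')
    {t : ℝ} (ht : t ∈ Ioc 0 T) : Metric.infDist (X' t) (C (θ t)) ≤ LC * μ + d' := by
  refine (S'.infDist_X t ht _ (S.θ_mem t ht)).trans ?_
  have := S.θ_sub t ht
  rw [abs_sub_comm] at this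
  have := mul_le_mul_of_nonneg_left this LC.2
  simp only [NNReal.val_eq_coe] at this
  linarith

/-- The error terms in the differential inequality for the distance between two approximate
solutions, apart from those which are multiplied by the monotonicity modulus. -/
def pairError (LC α B M Γ c μ a w e d μ' a' w' e' d' : ℝ) : ℝ :=
  2 * B * (a + w) + 2 * e * (2 * M + w) + 2 * Γ * (LC * μ + d')
    + 4 * Γ * c * ((a + w + LC * μ) ^ 2 + d' ^ 2)
    + 2 * B * (a' + w') + 2 * e' * (2 * M + w') + 2 * (B + e') * (LC * μ' + d)
    + 4 * Γ * c * ((a' + w' + LC * μ') ^ 2 + d ^ 2) + 4 * α * (a + a')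

variable {ρ : ℝ≥0∞} {F : ℝ → H → Set H} {k : ℝ → ℝ}

/-- The differential inequality behind the comparison of two approximate solutions. The normal
vector of the first one is bounded by `Γ` and that of the second one by `B + e'`. -/
theorem inner_sub_le
    (S : IsApproxSolution T C LC f x₀ α B M Γ μ a w e d X g U y ν V θ)
    (S' : IsApproxSolution T C LC f x₀ α B M Γ μ' a' w' e' d' X' g' U' y' ν' V' θ')
    (hprox : ∀ t ∈ Icc 0 T, IsUniformlyProxRegular ρ (C t))
    (hf : ∀ t ∈ Icc 0 T, ∀ x, f t x ∈ F t x) {t : ℝ} (ht : t ∈ Ioc 0 T) (hk0 : 0 ≤ k t)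
    (hmono : ∀ x₁ ∈ Metric.closedBall (0 : H) M, ∀ x₂ ∈ Metric.closedBall (0 : H) M,
      ∀ v₁ ∈ F t x₁, ∀ v₂ ∈ F t x₂, inner ℝ (v₁ - v₂) (x₁ - x₂) ≤ k t * ‖x₁ - x₂‖ ^ 2)
    (hg : ‖g t‖ ≤ α) (hg' : ‖g' t‖ ≤ α) :
    2 * inner ℝ (X t - X' t) ((g t - U t) - (g' t - U' t))
      ≤ (4 * Γ * ρ⁻¹.toReal + 4 * k t) * ‖X t - X' t‖ ^ 2
        + (pairError LC α B M Γ ρ⁻¹.toReal μ a w e d μ' a' w' e' d'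
          + 8 * (a ^ 2 + a' ^ 2) * k t) := by
  have htI := Ioc_subset_Icc_self ht
  have hT : 0 < T := ht.1.trans_le ht.2
  obtain ⟨ha, haw, he, hμ, hd, hΓ, hB, hM, hMw⟩ := S.nonneg hT
  obtain ⟨ha', haw', he', hμ', hd', -, -, -, hMw'⟩ := S'.nonneg hT
  set c := ρ⁻¹.toReal with hc
  have hc0 : 0 ≤ c := ENNReal.toReal_nonneg
  set N := ‖X t - X' t‖ with hN
  have hN0 : 0 ≤ N := norm_nonneg _
  have h1 := (hprox _ (S.θ_mem t ht)).inner_neg_le (S.V_mem t ht) (S.ν_mem t ht) (S.norm_U t ht)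
    (S.norm_V_sub_X t ht) (S.norm_ν_sub_U t ht) (S.norm_V t ht) (S'.norm_X t ht) (S.norm_ν t ht)
    (S.norm_ν t ht) (S.infDist_le_of_pair S' ht)
  have hν' : ‖ν' t‖ ≤ B + e' := by
    have := norm_add_le (U' t) (ν' t - U' t)
    rw [add_sub_cancel] at this
    linarith [S'.norm_U t ht, S'.norm_ν_sub_U t ht]
  have h2 := (hprox _ (S'.θ_mem t ht)).inner_neg_le (S'.V_mem t ht) (S'.ν_mem t ht)
    (S'.norm_U t ht) (S'.norm_V_sub_X t ht) (S'.norm_ν_sub_U t ht) (S'.norm_V t ht)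
    (S.norm_X t ht) hν' (S'.norm_ν t ht) (S'.infDist_le_of_pair S ht)
  rw [norm_sub_rev (X' t), ← hN] at h2
  rw [← hN] at h1
  have hsq : ∀ p q r : ℝ, (N + p + (q + r)) ^ 2 ≤ 2 * N ^ 2 + 4 * ((p + q) ^ 2 + r ^ 2) :=
    fun p q r => by nlinarith [sq_nonneg (N - (p + q + r)), sq_nonneg (p + q - r)]
  have h3 : Γ / 2 * c * (N + (a + w) + (LC * μ + d')) ^ 2
      ≤ Γ / 2 * c * (2 * N ^ 2 + 4 * ((a + w + LC * μ) ^ 2 + d' ^ 2)) :=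
    mul_le_mul_of_nonneg_left (hsq _ _ _) (by positivity)
  have h4 : Γ / 2 * c * (N + (a' + w') + (LC * μ' + d)) ^ 2
      ≤ Γ / 2 * c * (2 * N ^ 2 + 4 * ((a' + w' + LC * μ') ^ 2 + d ^ 2)) :=
    mul_le_mul_of_nonneg_left (hsq _ _ _) (by positivity)
  -- the one-sided Lipschitz condition holds at the points `y t`, `y' t` where `f` is evaluated
  have h5 : inner ℝ (g t - g' t) (y t - y' t) ≤ k t * ‖y t - y' t‖ ^ 2 := by
    rw [S.g_eq t ht, S'.g_eq t ht]
    exact hmono _ (by simpa using S.norm_y t ht) _ (by simpa using S'.norm_y t ht) _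
      (hf t htI _) _ (hf t htI _)
  have hX := S.norm_X_sub_y t ht
  have hX' := S'.norm_X_sub_y t ht
  have h6 : ‖y t - y' t‖ ^ 2 ≤ 2 * N ^ 2 + 4 * (a ^ 2 + a' ^ 2) := by
    have e1 : y t - y' t = (X t - X' t) + -(X t - y t) + (X' t - y' t) := by abel
    have h7 : ‖y t - y' t‖ ≤ N + 0 + (a + a') := by
      rw [e1]
      refine (norm_add₃_le).trans ?_
      rw [norm_neg]
      linarith
    refine ((pow_le_pow_left₀ (norm_nonneg _) h7 2).trans (hsq 0 a a')).trans_eq ?_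
    ring
  have h7 : inner ℝ (g t - g' t) ((X t - y t) - (X' t - y' t)) ≤ 2 * α * (a + a') := by
    refine (real_inner_le_norm _ _).trans ?_
    have h8 := (_root_.norm_sub_le (g t) (g' t)).trans (add_le_add hg hg')
    have h9 := (_root_.norm_sub_le (X t - y t) (X' t - y' t)).trans (add_le_add hX hX')
    have h10 := mul_le_mul h8 h9 (norm_nonneg _) ((norm_nonneg _).trans h8)
    linarith
  have h8 := mul_le_mul_of_nonneg_left h6 hk0
  have e1 : inner ℝ (X t - X' t) ((g t - U t) - (g' t - U' t))
      = inner ℝ (-U t) (X t - X' t) + inner ℝ (-U' t) (X' t - X t)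
        + inner ℝ (g t - g' t) (y t - y' t)
        + inner ℝ (g t - g' t) ((X t - y t) - (X' t - y' t)) := by
    rw [real_inner_comm]
    simp only [inner_neg_left, inner_sub_left, inner_sub_right]
    ring
  rw [e1, pairError]
  linarith

/-- Two approximate solutions with the same initial value are close to each other. -/
theorem norm_sub_sq_le [CompleteSpace H]
    (S : IsApproxSolution T C LC f x₀ α B M Γ μ a w e d X g U y ν V θ)
    (S' : IsApproxSolution T C LC f x₀ α B M Γ μ' a' w' e' d' X' g' U' y' ν' V' θ')
    (hα : 0 ≤ α)
    (hprox : ∀ t ∈ Icc 0 T, IsUniformlyProxRegular ρ (C t))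
    (hf : ∀ t ∈ Icc 0 T, ∀ x, f t x ∈ F t x) (hk0 : ∀ t ∈ Icc 0 T, 0 ≤ k t)
    (hk : IntegrableOn k (Icc 0 T))
    (hmono : ∀ t ∈ Icc 0 T, ∀ x₁ ∈ Metric.closedBall (0 : H) M,
      ∀ x₂ ∈ Metric.closedBall (0 : H) M, ∀ v₁ ∈ F t x₁, ∀ v₂ ∈ F t x₂,
      inner ℝ (v₁ - v₂) (x₁ - x₂) ≤ k t * ‖x₁ - x₂‖ ^ 2)
    {t : ℝ} (ht : t ∈ Icc 0 T) (hT : 0 < T) :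
    ‖X t - X' t‖ ^ 2 ≤ (T * pairError LC α B M Γ ρ⁻¹.toReal μ a w e d μ' a' w' e' d'
        + 8 * (a ^ 2 + a' ^ 2) * ∫ s in (0 : ℝ)..T, k s)
      * Real.exp (4 * Γ * ρ⁻¹.toReal * T + 4 * ∫ s in (0 : ℝ)..T, k s) := by
  obtain ⟨ha, haw, he, hμ, hd, hΓ, hB, hM, hMw⟩ := S.nonneg hT
  obtain ⟨ha', haw', he', hμ', hd', -, -, -, hMw'⟩ := S'.nonneg hT
  set c := ρ⁻¹.toReal with hc
  have hc0 : 0 ≤ c := ENNReal.toReal_nonneg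
  set Q := pairError LC α B M Γ c μ a w e d μ' a' w' e' d' with hQ
  have hQ0 : 0 ≤ Q := by
    have h1 : 0 ≤ 2 * M + w := by linarith
    have h2 : 0 ≤ 2 * M + w' := by linarith
    rw [hQ, pairError]
    positivity
  have hki : IntervalIntegrable k volume 0 T :=
    (intervalIntegrable_iff_integrableOn_Icc_of_le hT.le).2 hk
  have hX0 : X 0 - X' 0 = 0 := by
    rw [S.eq_integral 0 ⟨le_rfl, hT.le⟩, S'.eq_integral 0 ⟨le_rfl, hT.le⟩]; simp
  have key := le_integral_mul_exp_of_deriv_le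
    (φ := fun t => ‖X t - X' t‖ ^ 2) (a := fun t => 4 * Γ * c + 4 * k t)
    (b := fun t => Q + 8 * (a ^ 2 + a' ^ 2) * k t) (T := T)
    (absolutelyContinuousOnInterval_norm_sq
      ((S.absolutelyContinuous hT).fun_sub (S'.absolutelyContinuous hT)))
    (by simp [hX0]) (intervalIntegrable_const.add (hki.const_mul 4))
    (intervalIntegrable_const.add (hki.const_mul _))
    (by filter_upwards [ae_restrict_mem measurableSet_Icc] with t ht
        have := hk0 t ht; positivity)
    (by filter_upwards [ae_restrict_mem measurableSet_Icc] with t ht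
        have := hk0 t ht; positivity)
    (by
      filter_upwards [S.ae_hasDerivAt hT, S'.ae_hasDerivAt hT, S.norm_g, S'.norm_g] with
        t h1 h2 h3 h4
      have ht : t ∈ Ioc 0 T := Ioo_subset_Ioc_self h1.1
      rw [(h1.2.fun_sub h2.2).norm_sq.deriv]
      exact S.inner_sub_le S' hprox hf ht (hk0 t (Ioc_subset_Icc_self ht))
        (hmono t (Ioc_subset_Icc_self ht)) h3 h4) ht
  rw [intervalIntegral.integral_add intervalIntegrable_const (hki.const_mul _),
    intervalIntegral.integral_add intervalIntegrable_const (hki.const_mul _)] at key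
  simp only [intervalIntegral.integral_const, intervalIntegral.integral_const_mul, sub_zero,
    smul_eq_mul] at key
  rw [show 4 * Γ * (T * c) = 4 * Γ * c * T by ring] at key
  exact key

end IsApproxSolution

end Comparison

/-! ### Limits of approximate solutions -/

section Limits

variable {H : Type*} [NormedAddCommGroup H] [InnerProductSpace ℝ H]

theorem coeFn_linearCombination {Ω : Type*} [MeasurableSpace Ω] {m : Measure Ω}
    {G : ℕ → Lp H 2 m} {u : ℕ → Ω → H} (hu : ∀ i, G i =ᵐ[m] u i) (w : ℕ →₀ ℝ) :
    (Finsupp.linearCombination ℝ G w : Lp H 2 m)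
      =ᵐ[m] fun t => Finsupp.linearCombination ℝ (fun i => u i t) w := by
  induction w using Finsupp.induction_linear with
  | zero => simp only [map_zero]; exact Lp.coeFn_zero H 2 m
  | add w w' h h' =>
    rw [map_add]
    filter_upwards [Lp.coeFn_add (Finsupp.linearCombination ℝ G w)
      (Finsupp.linearCombination ℝ G w'), h, h'] with t h1 h2 h3
    rw [h1, Pi.add_apply, h2, h3, map_add]
  | single i a =>
    rw [Finsupp.linearCombination_single]
    filter_upwards [Lp.coeFn_smul a (G i), hu i] with t h1 h2
    rw [h1, Pi.smul_apply, h2, Finsupp.linearCombination_single]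

/-- Two bounded sequences of functions have convex combinations of their tails, with the same
weights, that converge almost everywhere. -/
theorem exists_ae_tendsto_linearCombination [CompleteSpace H] {Ω : Type*} [MeasurableSpace Ω]
    {m : Measure Ω} [IsFiniteMeasure m] {u v : ℕ → Ω → H} {A B : ℝ} (hA : 0 ≤ A) (hB : 0 ≤ B)
    (hu : ∀ i, AEStronglyMeasurable (u i) m) (hv : ∀ i, AEStronglyMeasurable (v i) m)
    (huA : ∀ i, ∀ᵐ t ∂m, ‖u i t‖ ≤ A) (hvB : ∀ i, ∀ᵐ t ∂m, ‖v i t‖ ≤ B) :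
    ∃ (w : ℕ → ℕ →₀ ℝ) (u' v' : Ω → H), (∀ n, w n ∈ tailWeights n) ∧
      ∀ᵐ t ∂m,
        Tendsto (fun n => Finsupp.linearCombination ℝ (fun i => u i t) (w n)) atTop (𝓝 (u' t)) ∧
        Tendsto (fun n => Finsupp.linearCombination ℝ (fun i => v i t) (w n)) atTop
          (𝓝 (v' t)) := by
  have hu2 : ∀ i, MemLp (u i) 2 m := fun i => MemLp.of_bound (hu i) A (huA i)
  have hv2 : ∀ i, MemLp (v i) 2 m := fun i => MemLp.of_bound (hv i) B (hvB i)
  let G : ℕ → Lp H 2 m := fun i => (hu2 i).toLp (u i)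
  let K : ℕ → Lp H 2 m := fun i => (hv2 i).toLp (v i)
  have hG : ∀ i, G i =ᵐ[m] u i := fun i => (hu2 i).coeFn_toLp
  have hK : ∀ i, K i =ᵐ[m] v i := fun i => (hv2 i).coeFn_toLp
  obtain ⟨RG, hRG⟩ : ∃ R, ∀ i, ‖G i‖ ≤ R := ⟨_, fun i => Lp.norm_le_of_ae_bound hA (by
    filter_upwards [hG i, huA i] with t h1 h2; rwa [h1])⟩
  obtain ⟨RK, hRK⟩ : ∃ R, ∀ i, ‖K i‖ ≤ R := ⟨_, fun i => Lp.norm_le_of_ae_bound hB (by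
    filter_upwards [hK i, hvB i] with t h1 h2; rwa [h1])⟩
  -- working in the Hilbert product of two copies of `L²` gives the same weights for both sequences
  let P : ℕ → WithLp 2 (Lp H 2 m × Lp H 2 m) := fun i => WithLp.toLp 2 (G i, K i)
  have hP : ∀ i, ‖P i‖ ≤ √(RG ^ 2 + RK ^ 2) := fun i => by
    rw [WithLp.prod_norm_eq_of_L2]
    exact Real.sqrt_le_sqrt (add_le_add (pow_le_pow_left₀ (norm_nonneg _) (hRG i) 2)
      (pow_le_pow_left₀ (norm_nonneg _) (hRK i) 2))
  obtain ⟨w, z, hw, hz⟩ := exists_tendsto_linearCombination_tailWeights hP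
  have h1 : Tendsto (fun n => Finsupp.linearCombination ℝ G (w n)) atTop (𝓝 z.fst) := by
    have := ((WithLp.fstL 2 ℝ (Lp H 2 m) (Lp H 2 m)).continuous.tendsto z).comp hz
    refine this.congr fun n => ?_
    exact Finsupp.apply_linearCombination ℝ
      (WithLp.fstL 2 ℝ (Lp H 2 m) (Lp H 2 m)).toLinearMap P (w n)
  have h2 : Tendsto (fun n => Finsupp.linearCombination ℝ K (w n)) atTop (𝓝 z.snd) := by
    have := ((WithLp.sndL 2 ℝ (Lp H 2 m) (Lp H 2 m)).continuous.tendsto z).comp hz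
    refine this.congr fun n => ?_
    exact Finsupp.apply_linearCombination ℝ
      (WithLp.sndL 2 ℝ (Lp H 2 m) (Lp H 2 m)).toLinearMap P (w n)
  obtain ⟨ns, hns, hae⟩ := (tendstoInMeasure_of_tendsto_Lp h1).exists_seq_tendsto_ae
  obtain ⟨ms, hms, hae'⟩ := (tendstoInMeasure_of_tendsto_Lp
    (h2.comp hns.tendsto_atTop)).exists_seq_tendsto_ae
  refine ⟨fun n => w (ns (ms n)), z.fst, z.snd, fun n => tailWeights_antitone
    ((hms.le_apply).trans (hns.le_apply)) (hw _), ?_⟩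
  filter_upwards [hae, hae', ae_all_iff.2 fun n => coeFn_linearCombination hG (w n),
    ae_all_iff.2 fun n => coeFn_linearCombination hK (w n)] with t h3 h4 h5 h6
  constructor
  · refine (h3.comp hms.tendsto_atTop).congr fun n => ?_
    exact h5 (ns (ms n))
  · refine h4.congr fun n => ?_
    exact h6 (ns (ms n))

theorem intervalIntegrable_linearCombination {u : ℕ → ℝ → H} {a b : ℝ}
    (hu : ∀ i, IntervalIntegrable (u i) volume a b) (w : ℕ →₀ ℝ) :
    IntervalIntegrable (fun s => Finsupp.linearCombination ℝ (fun i => u i s) w) volume a b := by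
  induction w using Finsupp.induction_linear with
  | zero => simp
  | add w w' h h' => simpa only [map_add] using h.add h'
  | single i c => simp only [Finsupp.linearCombination_single]; exact (hu i).smul c

theorem integral_linearCombination {u : ℕ → ℝ → H} {a b : ℝ}
    (hu : ∀ i, IntervalIntegrable (u i) volume a b) (w : ℕ →₀ ℝ) :
    ∫ s in a..b, Finsupp.linearCombination ℝ (fun i => u i s) w
      = Finsupp.linearCombination ℝ (fun i => ∫ s in a..b, u i s) w := by
  induction w using Finsupp.induction_linear with
  | zero => simp
  | add w w' h h' =>
    simp only [map_add]
    rw [intervalIntegral.integral_add (intervalIntegrable_linearCombination hu w)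
      (intervalIntegrable_linearCombination hu w'), h, h']
  | single i c =>
    simp only [Finsupp.linearCombination_single]
    exact intervalIntegral.integral_smul c _

/-- Limits of convex combinations of tails of selections of a weakly upper semicontinuous map
with closed convex values remain in the values of the map. Only the closed half-spaces, which are
weakly closed, matter. -/
theorem IsWeaklyUpperSemicontinuous.mem_of_tendsto [CompleteSpace H] {G : H → Set H}
    (hG : IsWeaklyUpperSemicontinuous G) {x : H} (hconv : Convex ℝ (G x)) (hcl : IsClosed (G x))
    {y v : ℕ → H} (hy : Tendsto y atTop (𝓝 x)) (hv : ∀ i, v i ∈ G (y i)) {w : ℕ → ℕ →₀ ℝ}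
    (hw : ∀ n, w n ∈ tailWeights n) {z : H}
    (hz : Tendsto (fun n => Finsupp.linearCombination ℝ v (w n)) atTop (𝓝 z)) : z ∈ G x := by
  by_contra hzG
  obtain ⟨φ, a, hφ, ha⟩ := geometric_hahn_banach_closed_point hconv hcl hzG
  have hD : IsClosed (toWeakSpace ℝ H '' {q | a ≤ φ q}) := by
    have h1 : Convex ℝ {q : H | a ≤ φ q} := convex_halfSpace_ge φ.toLinearMap.isLinear a
    have h2 : IsClosed {q : H | a ≤ φ q} := isClosed_le continuous_const φ.continuous
    have h3 := h1.toWeakSpace_closure ℝ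
    rw [h2.closure_eq] at h3
    rw [h3]
    exact isClosed_closure
  have hx : x ∈ {q | (G q ∩ {q | a ≤ φ q}).Nonempty}ᶜ := by
    rintro ⟨q, hq, hq'⟩
    exact absurd (hφ q hq) (not_lt.2 hq')
  have hev : ∀ᶠ i in atTop, inner ℝ ((InnerProductSpace.toDual ℝ H).symm φ) (v i) ≤ a := by
    filter_upwards [hy.eventually ((hG _ hD).isOpen_compl.mem_nhds hx)] with i hi
    rw [InnerProductSpace.toDual_symm_apply]
    by_contra hlt
    exact hi ⟨v i, hv i, (not_le.1 hlt).le⟩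
  have h1 := inner_le_of_tendsto_linearCombination hw hz tendsto_const_nhds hev
  rw [InnerProductSpace.toDual_symm_apply] at h1
  linarith

/-- Limits of convex combinations of tails of approximate proximal normals to nearby prox-regular
sets are proximal normals. -/
theorem mem_proximalNormalCone_of_tendsto {ρ : ℝ≥0∞} {S : Set H} {Si : ℕ → Set H} {Γ : ℝ}
    {x z : H} {V ν U : ℕ → H} {e r : ℕ → ℝ} {w : ℕ → ℕ →₀ ℝ}
    (hSi : ∀ i, IsUniformlyProxRegular ρ (Si i)) (hx : x ∈ S) (hV : ∀ i, V i ∈ Si i)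
    (hν : ∀ i, ν i ∈ proximalNormalCone (Si i) (V i)) (hΓ : ∀ i, ‖ν i‖ ≤ Γ)
    (hVx : Tendsto V atTop (𝓝 x)) (he : Tendsto e atTop (𝓝 0)) (hνU : ∀ i, ‖ν i - U i‖ ≤ e i)
    (hr : Tendsto r atTop (𝓝 0)) (hSr : ∀ i, ∀ s ∈ S, Metric.infDist s (Si i) ≤ r i)
    (hw : ∀ n, w n ∈ tailWeights n)
    (hz : Tendsto (fun n => Finsupp.linearCombination ℝ U (w n)) atTop (𝓝 z)) :
    z ∈ proximalNormalCone S x := by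
  have hΓ0 : 0 ≤ Γ := (norm_nonneg _).trans (hΓ 0)
  set c := ρ⁻¹.toReal with hc
  have hc0 : 0 ≤ c := ENNReal.toReal_nonneg
  refine ⟨hx, Γ / 2 * c, by positivity, 1, one_pos, fun s hs _ => ?_⟩
  choose q hqS hq using fun i : ℕ => (Metric.infDist_lt_iff ⟨V i, hV i⟩).1
    ((hSr i s hs).trans_lt (lt_add_of_pos_right (r i) (Nat.one_div_pos_of_nat (α := ℝ) (n := i))))
  have hqs : Tendsto q atTop (𝓝 s) := by
    rw [tendsto_iff_dist_tendsto_zero]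
    refine squeeze_zero (fun _ => dist_nonneg) (fun i => ?_)
      (by simpa using hr.add tendsto_one_div_add_atTop_nhds_zero_nat :
        Tendsto (fun i : ℕ => r i + 1 / ((i : ℝ) + 1)) atTop (𝓝 0))
    rw [dist_comm]
    exact (hq i).le
  rw [real_inner_comm]
  refine inner_le_of_tendsto_linearCombination hw hz (b := fun i => Γ / 2 * c * ‖q i - V i‖ ^ 2
    + (Γ * ‖s - q i‖ + Γ * ‖V i - x‖ + e i * ‖s - x‖)) ?_ (Eventually.of_forall fun i => ?_)
  · have h1 : Tendsto (fun i => Γ / 2 * c * ‖q i - V i‖ ^ 2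
        + (Γ * ‖s - q i‖ + Γ * ‖V i - x‖ + e i * ‖s - x‖)) atTop
        (𝓝 (Γ / 2 * c * ‖s - x‖ ^ 2 + (Γ * ‖s - s‖ + Γ * ‖x - x‖ + 0 * ‖s - x‖))) :=
      (((hqs.sub hVx).norm.pow 2).const_mul _).add
        ((((hqs.const_sub s).norm.const_mul Γ).add ((hVx.sub_const x).norm.const_mul Γ)).add
          (he.mul_const _))
    simpa using h1
  · have e1 : inner ℝ (s - x) (U i) = inner ℝ (ν i) (q i - V i) + inner ℝ (ν i) (s - q i)
        + inner ℝ (ν i) (V i - x) + inner ℝ (U i - ν i) (s - x) := by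
      rw [real_inner_comm]
      simp only [inner_sub_left, inner_sub_right]
      ring
    have h1 : inner ℝ (ν i) (q i - V i) ≤ Γ / 2 * c * ‖q i - V i‖ ^ 2 := by
      refine ((hSi i).2 _ (hV i) _ (hν i) _ (hqS i)).trans ?_
      have := hΓ i
      gcongr
    have h2 : inner ℝ (ν i) (s - q i) ≤ Γ * ‖s - q i‖ :=
      (real_inner_le_norm _ _).trans (mul_le_mul_of_nonneg_right (hΓ i) (norm_nonneg _))
    have h3 : inner ℝ (ν i) (V i - x) ≤ Γ * ‖V i - x‖ :=
      (real_inner_le_norm _ _).trans (mul_le_mul_of_nonneg_right (hΓ i) (norm_nonneg _))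
    have h4 : inner ℝ (U i - ν i) (s - x) ≤ e i * ‖s - x‖ := by
      refine (real_inner_le_norm _ _).trans (mul_le_mul_of_nonneg_right ?_ (norm_nonneg _))
      rw [norm_sub_rev]; exact hνU i
    rw [e1]
    linarith

variable {T : ℝ} {C : ℝ → Set H} {LC : ℝ≥0} {f : ℝ → H → H} {x₀ : H} {F : ℝ → H → Set H}
  {ρ : ℝ≥0∞}

/-- The limit of a convergent sequence of approximate solutions, with errors tending to zero, is a
Lipschitz solution. -/
theorem exists_isSolution_of_tendsto [CompleteSpace H] (hT : 0 < T)
    (hC_lip : ∀ t ∈ Icc 0 T, ∀ s ∈ Icc 0 T,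
      Metric.hausdorffEDist (C t) (C s) ≤ ENNReal.ofReal (LC * |t - s|))
    (hC_prox : ∀ t ∈ Icc 0 T, IsUniformlyProxRegular ρ (C t))
    (hF_closed : ∀ t ∈ Icc 0 T, ∀ x, IsClosed (F t x))
    (hF_convex : ∀ t ∈ Icc 0 T, ∀ x, Convex ℝ (F t x))
    (hF₁ : ∀ t ∈ Icc 0 T, IsWeaklyUpperSemicontinuous (F t))
    (hf : ∀ t ∈ Icc 0 T, ∀ x, f t x ∈ F t x)
    {α B M Γ : ℝ} {μ a w e d : ℕ → ℝ} {X g U y ν V : ℕ → ℝ → H} {θ : ℕ → ℝ → ℝ}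
    (S : ∀ i, IsApproxSolution T C LC f x₀ α B M Γ (μ i) (a i) (w i) (e i) (d i)
      (X i) (g i) (U i) (y i) (ν i) (V i) (θ i))
    (hμ : Tendsto μ atTop (𝓝 0)) (ha : Tendsto a atTop (𝓝 0)) (hw : Tendsto w atTop (𝓝 0))
    (he : Tendsto e atTop (𝓝 0)) {x : ℝ → H}
    (hx : ∀ t ∈ Icc 0 T, Tendsto (fun i => X i t) atTop (𝓝 (x t))) :
    ∃ z : ℝ → H, EqOn z x (Icc 0 T) ∧ (∃ L : ℝ≥0, LipschitzOnWith L z (Icc 0 T)) ∧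
      IsSolution T C F x₀ z := by
  have hB : 0 ≤ B := ((S 0).nonneg hT).2.2.2.2.2.2.1
  set m := volume.restrict (Ioc 0 T) with hm
  have hα' : ∀ i, ∀ᵐ t ∂m, ‖g i t‖ ≤ max α 0 := fun i => by
    filter_upwards [ae_mono (Measure.restrict_mono Ioc_subset_Icc_self le_rfl) (S i).norm_g] with
      t ht using ht.trans (le_max_left _ _)
  have hB' : ∀ i, ∀ᵐ t ∂m, ‖U i t‖ ≤ B := fun i => by
    filter_upwards [ae_restrict_mem measurableSet_Ioc] with t ht using (S i).norm_U t ht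
  have hgi : ∀ i, Integrable (g i) m := fun i =>
    (intervalIntegrable_iff_integrableOn_Ioc_of_le hT.le).1 (S i).int_g
  have hUi : ∀ i, Integrable (U i) m := fun i =>
    (intervalIntegrable_iff_integrableOn_Ioc_of_le hT.le).1 (S i).int_U
  obtain ⟨W, G, K, hW, hGK⟩ := exists_ae_tendsto_linearCombination (m := m) (le_max_right α 0) hB
    (fun i => (hgi i).aestronglyMeasurable) (fun i => (hUi i).aestronglyMeasurable) hα' hB'
  -- convex combinations of the velocities `v i` converge almost everywhere to `G - K`, boundedly
  set v : ℕ → ℝ → H := fun i s => g i s - U i s with hv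
  have hvi : ∀ i, IntervalIntegrable (v i) volume 0 T := fun i => (S i).int_g.sub (S i).int_U
  have hcomb : ∀ (w' : ℕ →₀ ℝ) (t : ℝ), Finsupp.linearCombination ℝ (fun i => v i t) w'
      = Finsupp.linearCombination ℝ (fun i => g i t) w'
        - Finsupp.linearCombination ℝ (fun i => U i t) w' := fun w' t => by
    simp only [hv, Finsupp.linearCombination_apply, Finsupp.sum, smul_sub, Finset.sum_sub_distrib]
  have hvlim : ∀ᵐ t ∂m, Tendsto (fun n => Finsupp.linearCombination ℝ (fun i => v i t) (W n))
      atTop (𝓝 (G t - K t)) := by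
    filter_upwards [hGK] with t ht
    simpa only [hcomb] using ht.1.sub ht.2
  have hvb : ∀ n, ∀ᵐ t ∂m, ‖Finsupp.linearCombination ℝ (fun i => v i t) (W n)‖
      ≤ max α 0 + B := fun n => by
    filter_upwards [ae_all_iff.2 hα', ae_all_iff.2 hB'] with t h1 h2
    have := linearCombination_mem_of_mem_tailWeights
      (convex_closedBall (0 : H) (max α 0 + B)) (a := fun i => v i t) (hW n) fun i _ => by
        rw [mem_closedBall_zero_iff]
        exact (norm_sub_le _ _).trans (add_le_add (h1 i) (h2 i))
    rwa [mem_closedBall_zero_iff] at this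
  have hcombi : ∀ n, IntervalIntegrable
      (fun s => Finsupp.linearCombination ℝ (fun i => v i s) (W n)) volume 0 T :=
    fun n => intervalIntegrable_linearCombination hvi _
  have hlimi : IntervalIntegrable (fun s => G s - K s) volume 0 T := by
    refine (intervalIntegrable_iff_integrableOn_Ioc_of_le hT.le).2 ?_
    have hmeas : AEStronglyMeasurable (fun s => G s - K s) m :=
      aestronglyMeasurable_of_tendsto_ae atTop (fun n =>
        ((intervalIntegrable_iff_integrableOn_Ioc_of_le hT.le).1 (hcombi n)).aestronglyMeasurable)
        hvlim
    refine Integrable.of_bound hmeas (max α 0 + B) ?_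
    filter_upwards [hvlim, ae_all_iff.2 hvb] with t h1 h2
    exact le_of_tendsto h1.norm (Eventually.of_forall h2)
  have hsub : ∀ {t}, t ∈ Icc 0 T → uIcc 0 t ⊆ uIcc 0 T := fun ht => by
    rw [uIcc_of_le ht.1, uIcc_of_le hT.le]; exact Icc_subset_Icc_right ht.2
  -- the limit `x` is prescribed on `[0, T]` only; the primitive `z` is the solution that agrees with
  -- it there
  set z : ℝ → H := fun t => x₀ + ∫ s in (0 : ℝ)..t, (G s - K s) with hz
  have hzx : EqOn z x (Icc 0 T) := by
    intro t ht
    have h1 : Tendsto (fun n => ∫ s in (0 : ℝ)..t, Finsupp.linearCombination ℝ (fun i => v i s)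
        (W n)) atTop (𝓝 (∫ s in (0 : ℝ)..t, (G s - K s))) := by
      refine intervalIntegral.tendsto_integral_filter_of_dominated_convergence
        (fun _ => max α 0 + B) (Eventually.of_forall fun n => ?_) (Eventually.of_forall fun n => ?_)
        intervalIntegrable_const ?_
      · exact (intervalIntegrable_iff.1 ((hcombi n).mono_set (hsub ht))).aestronglyMeasurable
      · filter_upwards [(ae_restrict_iff' measurableSet_Ioc).1 (hvb n)] with s hs hst
        rw [uIoc_of_le ht.1] at hst
        exact hs ⟨hst.1, hst.2.trans ht.2⟩
      · filter_upwards [(ae_restrict_iff' measurableSet_Ioc).1 hvlim] with s hs hst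
        rw [uIoc_of_le ht.1] at hst
        exact hs ⟨hst.1, hst.2.trans ht.2⟩
    have h2 : ∀ n, ∫ s in (0 : ℝ)..t, Finsupp.linearCombination ℝ (fun i => v i s) (W n)
        = Finsupp.linearCombination ℝ (fun i => X i t - x₀) (W n) := fun n => by
      rw [integral_linearCombination (fun i => (hvi i).mono_set (hsub ht))]
      congr 2
      funext i
      rw [(S i).eq_integral t ht, add_sub_cancel_left]
    simp only [h2] at h1
    have h3 := tendsto_linearCombination_tailWeights ((hx t ht).sub_const x₀) hW
    simp only [hz, tendsto_nhds_unique h1 h3, add_sub_cancel]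
  have hlip : LipschitzOnWith (Real.toNNReal (α + B)) z (Icc 0 T) := by
    refine LipschitzOnWith.of_dist_le_mul fun s hs t ht => ?_
    rw [hzx hs, hzx ht, dist_eq_norm, Real.dist_eq]
    refine le_of_tendsto ((hx s hs).sub (hx t ht)).norm (Eventually.of_forall fun i => ?_)
    refine ((S i).norm_sub_le hT ht hs).trans ?_
    gcongr
    exact Real.le_coe_toNNReal _
  refine ⟨z, hzx, ⟨_, hlip⟩, ?_, by simp [hz], ?_⟩
  · rw [← uIcc_of_le hT.le] at hlip
    exact hlip.absolutelyContinuousOnInterval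
  have hae : ∀ᵐ t, t ∈ Icc 0 T → HasDerivAt z (G t - K t) t := by
    filter_upwards [hlimi.ae_hasDerivAt_integral] with t ht htm
    rw [uIcc_of_le hT.le] at ht
    exact (ht htm 0 (left_mem_Icc.2 hT.le)).const_add x₀
  rw [ae_restrict_iff' measurableSet_Icc]
  filter_upwards [hae, (ae_restrict_iff' measurableSet_Ioc).1 hGK, Measure.ae_ne volume 0] with
    t hd hGKt h0 htI
  have ht : t ∈ Ioc 0 T := ⟨lt_of_le_of_ne htI.1 h0.symm, htI.2⟩
  obtain ⟨hGt, hKt⟩ := hGKt ht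
  have hxt : z t = x t := hzx htI
  have hyx : Tendsto (fun i => y i t) atTop (𝓝 (x t)) := by
    have h1 : Tendsto (fun i => X i t - y i t) atTop (𝓝 0) :=
      squeeze_zero_norm (fun i => (S i).norm_X_sub_y t ht) ha
    simpa using (hx t htI).sub h1
  have hVx : Tendsto (fun i => V i t) atTop (𝓝 (x t)) := by
    have h1 : Tendsto (fun i => V i t - X i t) atTop (𝓝 0) :=
      squeeze_zero_norm (fun i => (S i).norm_V_sub_X t ht) (by simpa using ha.add hw)
    simpa using h1.add (hx t htI)
  have hr : Tendsto (fun i => (LC : ℝ) * μ i) atTop (𝓝 0) := by simpa using hμ.const_mul (LC : ℝ)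
  have hxC : x t ∈ C t := by
    have h1 : Tendsto (fun i => Metric.infDist (V i t) (C t)) atTop (𝓝 0) := by
      refine squeeze_zero (fun _ => Metric.infDist_nonneg) (fun i => ?_) hr
      have h2 := infDist_le_of_hausdorffEDist_le (by positivity)
        (hC_lip _ ((S i).θ_mem t ht) t htI) (V i t)
      rw [Metric.infDist_zero_of_mem ((S i).V_mem t ht), zero_add] at h2
      exact h2.trans (mul_le_mul_of_nonneg_left ((S i).θ_sub t ht) LC.2)
    have h2 : Tendsto (fun i => Metric.infDist (V i t) (C t)) atTop
        (𝓝 (Metric.infDist (x t) (C t))) :=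
      ((Metric.continuous_infDist_pt _).tendsto _).comp hVx
    have hne : (C t).Nonempty := by
      by_contra hempty
      have h3 := hC_lip _ ((S 0).θ_mem t ht) t htI
      rw [not_nonempty_iff_eq_empty.1 hempty,
        Metric.hausdorffEDist_empty ⟨_, (S 0).V_mem t ht⟩] at h3
      exact absurd (top_le_iff.1 h3) ENNReal.ofReal_ne_top
    rw [(hC_prox t htI).1.mem_iff_infDist_zero hne]
    exact tendsto_nhds_unique h2 h1
  refine ⟨(hd htI).differentiableAt, ?_⟩
  rw [(hd htI).deriv, hxt]
  have hGF : G t ∈ F t (x t) := by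
    refine (hF₁ t htI).mem_of_tendsto (hF_convex t htI _) (hF_closed t htI _) hyx (fun i => ?_)
      hW hGt
    rw [(S i).g_eq t ht]
    exact hf t htI _
  have hKN : K t ∈ proximalNormalCone (C t) (x t) := by
    refine mem_proximalNormalCone_of_tendsto (fun i => hC_prox _ ((S i).θ_mem t ht)) hxC
      (fun i => (S i).V_mem t ht) (fun i => (S i).ν_mem t ht) (fun i => (S i).norm_ν t ht) hVx he
      (fun i => (S i).norm_ν_sub_U t ht) hr (fun i s hs => ?_) hW hKt
    have h2 := infDist_le_of_hausdorffEDist_le (by positivity)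
      (hC_lip t htI _ ((S i).θ_mem t ht)) s
    rw [Metric.infDist_zero_of_mem hs, zero_add, abs_sub_comm] at h2
    exact h2.trans (mul_le_mul_of_nonneg_left ((S i).θ_sub t ht) LC.2)
  rw [sub_eq_neg_add]
  exact add_mem_add (neg_mem_neg.2 (proximalNormalCone_subset_clarkeNormalCone _ _ hKN)) hGF

end Limits

/-! ### Uniqueness -/

section Uniqueness

variable {H : Type*} [NormedAddCommGroup H] [InnerProductSpace ℝ H]

/-- If a curve stays close, in the past, to a set that has the proximal normal `ζ` at the present
position, then its velocity cannot point far into the opposite direction of `ζ`. -/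
theorem inner_neg_deriv_le {S : Set H} (hS : S.Nonempty) {x : ℝ → H} {x' ζ : H} {t σ L : ℝ}
    (hσ : 0 ≤ σ) (hx : HasDerivAt x x' t)
    (hζ : ∀ y ∈ S, inner ℝ ζ (y - x t) ≤ σ * ‖y - x t‖ ^ 2)
    (hd : ∀ᶠ u in 𝓝[<] (0 : ℝ), Metric.infDist (x (t + u)) S ≤ L * -u) :
    inner ℝ ζ (-x') ≤ L * ‖ζ‖ := by
  have h1 : Tendsto (fun u : ℝ => u⁻¹ • (x (t + u) - x t)) (𝓝[<] 0) (𝓝 x') :=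
    hx.tendsto_slope_zero_left
  have h0 : Tendsto (fun u : ℝ => -u) (𝓝[<] 0) (𝓝 0) := by
    simpa using (continuous_neg.tendsto (0 : ℝ)).mono_left (nhdsWithin_le_nhds (s := Iio 0))
  have h2 : Tendsto (fun u : ℝ => σ * (‖u⁻¹ • (x (t + u) - x t)‖ + (L + -u)) ^ 2 * -u
      + ‖ζ‖ * (L + -u)) (𝓝[<] 0) (𝓝 (σ * (‖x'‖ + (L + 0)) ^ 2 * 0 + ‖ζ‖ * (L + 0))) :=
    ((((h1.norm.add (h0.const_add L)).pow 2).const_mul σ).mul h0).add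
      ((h0.const_add L).const_mul _)
  have h3 : Tendsto (fun u : ℝ => inner ℝ ζ (-(u⁻¹ • (x (t + u) - x t)))) (𝓝[<] 0)
      (𝓝 (inner ℝ ζ (-x'))) := tendsto_const_nhds.inner h1.neg
  have h4 := le_of_tendsto_of_tendsto h3 h2 (by
    filter_upwards [hd, self_mem_nhdsWithin] with u hu hu0
    have hu' : 0 < -u := neg_pos.2 hu0
    obtain ⟨z, hz, hxz⟩ := (Metric.infDist_lt_iff hS).1
      (lt_of_le_of_lt hu (lt_add_of_pos_right _ (mul_pos hu' hu')))
    rw [dist_eq_norm] at hxz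
    set q := u⁻¹ • (x (t + u) - x t) with hq
    have e1 : x (t + u) - x t = u • q := by rw [hq, smul_smul, mul_inv_cancel₀ hu0.ne, one_smul]
    have e2 : z - x t = u • q - (x (t + u) - z) := by rw [← e1]; abel
    have h5 : ‖z - x t‖ ≤ -u * (‖q‖ + (L + -u)) := by
      rw [e2]
      refine (norm_sub_le _ _).trans ?_
      rw [norm_smul, Real.norm_eq_abs, abs_of_neg hu0]
      linarith
    have h6 : inner ℝ ζ (x (t + u) - z) ≤ ‖ζ‖ * (-u * (L + -u)) :=
      (real_inner_le_norm _ _).trans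
        (mul_le_mul_of_nonneg_left (by linarith) (norm_nonneg _))
    have h7 : inner ℝ ζ (z - x t) ≤ σ * (-u * (‖q‖ + (L + -u))) ^ 2 :=
      (hζ z hz).trans (by gcongr)
    rw [e2, inner_sub_right, inner_smul_right] at h7
    rw [inner_neg_right]
    refine le_of_mul_le_mul_left ?_ hu'
    linarith)
  simpa [mul_comm] using h4

variable {T : ℝ} {C : ℝ → Set H} {LC : ℝ≥0} {x₀ : H} {F : ℝ → H → Set H} {ρ : ℝ≥0∞}

namespace IsSolution

variable {x : ℝ → H}

/-- A solution stays in the moving set: it does so almost everywhere, and its distance to the moving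
set is continuous. -/
theorem mem (hx : IsSolution T C F x₀ x) (hT : 0 < T)
    (hC_nonempty : ∀ t ∈ Icc 0 T, (C t).Nonempty) (hC_closed : ∀ t ∈ Icc 0 T, IsClosed (C t))
    (hC_lip : ∀ t ∈ Icc 0 T, ∀ s ∈ Icc 0 T,
      Metric.hausdorffEDist (C t) (C s) ≤ ENNReal.ofReal (LC * |t - s|))
    {t : ℝ} (ht : t ∈ Icc 0 T) : x t ∈ C t := by
  have hxc : ContinuousOn x (Icc 0 T) := by
    rw [← uIcc_of_le hT.le]; exact hx.absolutelyContinuous.continuousOn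
  have hle : ∀ s ∈ Icc 0 T, ∀ r ∈ Icc 0 T, Metric.infDist (x s) (C s)
      ≤ Metric.infDist (x r) (C r) + (dist (x s) (x r) + LC * |r - s|) := fun s hs r hr => by
    have h1 := infDist_le_of_hausdorffEDist_le (by positivity) (hC_lip r hr s hs) (x r)
    have h2 := Metric.infDist_le_infDist_add_dist (s := C s) (x := x s) (y := x r)
    linarith
  have hcont : ContinuousOn (fun s => Metric.infDist (x s) (C s)) (Icc 0 T) := by
    intro s hs
    rw [ContinuousWithinAt, tendsto_iff_dist_tendsto_zero]
    refine squeeze_zero' (g := fun r => dist (x r) (x s) + LC * |r - s|)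
      (Eventually.of_forall fun _ => dist_nonneg) ?_ ?_
    · filter_upwards [self_mem_nhdsWithin] with r hr
      rw [Real.dist_eq, abs_sub_le_iff]
      have h1 := hle s hs r hr
      have h2 := hle r hr s hs
      rw [dist_comm] at h1
      rw [abs_sub_comm] at h2
      constructor <;> linarith
    · have h1 : Tendsto (fun r => dist (x r) (x s)) (𝓝[Icc 0 T] s) (𝓝 0) :=
        tendsto_iff_dist_tendsto_zero.1 (hxc s hs)
      have h2 : Tendsto (fun r => (LC : ℝ) * |r - s|) (𝓝[Icc 0 T] s) (𝓝 (LC * |s - s|)) :=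
        (Continuous.tendsto (by fun_prop) s).mono_left nhdsWithin_le_nhds
      simpa using h1.add h2
  have hae : (fun s => Metric.infDist (x s) (C s)) =ᵐ[volume.restrict (Icc 0 T)] fun _ => 0 := by
    filter_upwards [hx.inclusion] with s hs
    obtain ⟨a, ha, b, -, -⟩ := hs.2
    exact Metric.infDist_zero_of_mem (Set.mem_neg.1 ha).1
  have h0 := Measure.eqOn_Icc_of_ae_eq volume hT.ne hae hcont continuousOn_const ht
  exact ((hC_closed t ht).mem_iff_infDist_zero (hC_nonempty t ht)).2 h0

/-- Almost everywhere, the velocity of a solution is `v - ζ`, where `v` belongs to the perturbation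
and the normal vector `ζ` is bounded in terms of `v`. -/
theorem ae_exists_normal [CompleteSpace H] (hx : IsSolution T C F x₀ x) (hT : 0 < T)
    (hC_nonempty : ∀ t ∈ Icc 0 T, (C t).Nonempty)
    (hC_lip : ∀ t ∈ Icc 0 T, ∀ s ∈ Icc 0 T,
      Metric.hausdorffEDist (C t) (C s) ≤ ENNReal.ofReal (LC * |t - s|))
    (hC_prox : ∀ t ∈ Icc 0 T, IsUniformlyProxRegular ρ (C t)) :
    ∀ᵐ t ∂volume.restrict (Icc 0 T), ∃ ζ ∈ proximalNormalCone (C t) (x t), ∃ v ∈ F t (x t),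
      HasDerivAt x (v - ζ) t ∧ ‖ζ‖ ≤ LC + ‖v‖ := by
  filter_upwards [hx.inclusion, ae_restrict_of_ae (Measure.ae_ne volume 0),
    ae_restrict_mem measurableSet_Icc] with t ht h0 htI
  obtain ⟨hd, ζ', hζ', v, hv, hsum⟩ := ht
  rw [Set.mem_neg, (hC_prox t htI).clarkeNormalCone_eq] at hζ'
  set ζ := -ζ' with hζ
  have hder : HasDerivAt x (v - ζ) t := by
    have e : v - ζ = deriv x t := by rw [← hsum, hζ]; simp only; abel
    rw [e]; exact hd.hasDerivAt
  refine ⟨ζ, hζ', v, hv, hder, ?_⟩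
  have ht0 : 0 < t := lt_of_le_of_ne htI.1 h0.symm
  have h1 : inner ℝ ζ (-(v - ζ)) ≤ LC * ‖ζ‖ := by
    refine inner_neg_deriv_le (hC_nonempty t htI) ?_ hder ((hC_prox t htI).2 _ hζ'.1 _ hζ') ?_
    · positivity
    · filter_upwards [Ioo_mem_nhdsLT (neg_lt_zero.2 ht0)] with u hu
      have htu : t + u ∈ Icc 0 T := ⟨by linarith [hu.1], by linarith [hu.2, htI.2]⟩
      have h2 := infDist_le_of_hausdorffEDist_le (by positivity) (hC_lip _ htu t htI) (x (t + u))
      rw [Metric.infDist_zero_of_mem (hx.mem hT hC_nonempty (fun s hs => (hC_prox s hs).1) hC_lip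
        htu), zero_add, add_sub_cancel_left, abs_of_neg hu.2] at h2
      exact h2
  rw [neg_sub, inner_sub_right, real_inner_self_eq_norm_sq] at h1
  have h2 := real_inner_le_norm ζ v
  rcases (norm_nonneg ζ).eq_or_lt with h3 | h3
  · rw [← h3]; positivity
  · refine le_of_mul_le_mul_left ?_ h3
    linarith

/-- Under linear growth of the perturbation, solutions are unique: the normal vectors are
integrable, so that the hypomonotonicity of the normal cones gives a Gronwall inequality. -/
theorem eqOn [CompleteSpace H] (hT : 0 < T) (hC_nonempty : ∀ t ∈ Icc 0 T, (C t).Nonempty)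
    (hC_lip : ∀ t ∈ Icc 0 T, ∀ s ∈ Icc 0 T,
      Metric.hausdorffEDist (C t) (C s) ≤ ENNReal.ofReal (LC * |t - s|))
    (hC_prox : ∀ t ∈ Icc 0 T, IsUniformlyProxRegular ρ (C t))
    {k : ℝ → ℝ → ℝ} (hk_nonneg : ∀ r, 0 < r → ∀ t ∈ Icc 0 T, 0 ≤ k r t)
    (hk_int : ∀ r, 0 < r → IntegrableOn (k r) (Icc 0 T))
    (hF_mono : ∀ r, 0 < r → ∀ t ∈ Icc 0 T,
      ∀ x₁ ∈ Metric.closedBall (0 : H) r, ∀ x₂ ∈ Metric.closedBall (0 : H) r,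
      ∀ v₁ ∈ F t x₁, ∀ v₂ ∈ F t x₂,
        inner ℝ (v₁ - v₂) (x₁ - x₂) ≤ k r t * ‖x₁ - x₂‖ ^ 2)
    {c : ℝ → ℝ} (hc0 : ∀ t ∈ Icc 0 T, 0 ≤ c t) (hc : IntegrableOn c (Icc 0 T))
    (hFc : ∀ᵐ t ∂(volume.restrict (Icc 0 T)), ∀ x, ∀ y ∈ F t x, ‖y‖ ≤ c t * (‖x‖ + 1))
    {y : ℝ → H} (hx : IsSolution T C F x₀ x) (hy : IsSolution T C F x₀ y) :
    EqOn x y (Icc 0 T) := by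
  obtain ⟨Mx, hMx⟩ := hx.absolutelyContinuous.exists_bound
  obtain ⟨My, hMy⟩ := hy.absolutelyContinuous.exists_bound
  rw [uIcc_of_le hT.le] at hMx hMy
  set r := max (max Mx My) 1 with hr
  have hr0 : 0 < r := lt_of_lt_of_le one_pos (le_max_right _ _)
  have hxr : ∀ t ∈ Icc 0 T, ‖x t‖ ≤ r := fun t ht =>
    (hMx t ht).trans ((le_max_left _ _).trans (le_max_left _ _))
  have hyr : ∀ t ∈ Icc 0 T, ‖y t‖ ≤ r := fun t ht =>
    (hMy t ht).trans ((le_max_right _ _).trans (le_max_left _ _))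
  set q := ρ⁻¹.toReal with hq
  have hq0 : 0 ≤ q := ENNReal.toReal_nonneg
  have hki : IntervalIntegrable (k r) volume 0 T :=
    (intervalIntegrable_iff_integrableOn_Icc_of_le hT.le).2 (hk_int r hr0)
  have hci : IntervalIntegrable c volume 0 T :=
    (intervalIntegrable_iff_integrableOn_Icc_of_le hT.le).2 hc
  intro t ht
  have key := le_integral_mul_exp_of_deriv_le (φ := fun t => ‖x t - y t‖ ^ 2)
    (a := fun t => 2 * k r t + 2 * q * (LC + (r + 1) * c t)) (b := fun _ => 0) (T := T)
    (absolutelyContinuousOnInterval_norm_sq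
      (hx.absolutelyContinuous.fun_sub hy.absolutelyContinuous))
    (by simp [hx.initial, hy.initial])
    ((hki.const_mul 2).add ((intervalIntegrable_const.add (hci.const_mul (r + 1))).const_mul _))
    intervalIntegrable_const
    (by filter_upwards [ae_restrict_mem measurableSet_Icc] with t ht
        have := hk_nonneg r hr0 t ht
        have := hc0 t ht
        positivity)
    (Eventually.of_forall fun _ => le_rfl)
    (by
      filter_upwards [hx.ae_exists_normal hT hC_nonempty hC_lip hC_prox,
        hy.ae_exists_normal hT hC_nonempty hC_lip hC_prox, hFc,
        ae_restrict_mem measurableSet_Icc] with t h1 h2 h3 ht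
      obtain ⟨ζ, hζ, v, hv, hdx, hζn⟩ := h1
      obtain ⟨ξ, hξ, u, hu, hdy, hξn⟩ := h2
      rw [(hdx.fun_sub hdy).norm_sq.deriv]
      have hct := hc0 t ht
      have h4 : ‖ζ‖ ≤ LC + (r + 1) * c t := by
        have := (h3 _ _ hv).trans (mul_le_mul_of_nonneg_left
          (add_le_add_left (hxr t ht) 1) hct)
        linarith
      have h5 : ‖ξ‖ ≤ LC + (r + 1) * c t := by
        have := (h3 _ _ hu).trans (mul_le_mul_of_nonneg_left
          (add_le_add_left (hyr t ht) 1) hct)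
        linarith
      have h6 := (hC_prox t ht).2 _ hζ.1 _ hζ _ hξ.1
      have h7 := (hC_prox t ht).2 _ hξ.1 _ hξ _ hζ.1
      have h8 := hF_mono r hr0 t ht _ (by simpa using hxr t ht) _ (by simpa using hyr t ht)
        v hv u hu
      rw [norm_sub_rev, ← hq] at h6
      rw [← hq] at h7
      set N := ‖x t - y t‖ ^ 2 with hN
      have hN0 : 0 ≤ N := by positivity
      have h9 : ‖ζ‖ / 2 * q * N ≤ (LC + (r + 1) * c t) / 2 * q * N := by gcongr
      have h10 : ‖ξ‖ / 2 * q * N ≤ (LC + (r + 1) * c t) / 2 * q * N := by gcongr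
      have e : inner ℝ (x t - y t) (v - ζ - (u - ξ)) = inner ℝ (v - u) (x t - y t)
          + inner ℝ ζ (y t - x t) + inner ℝ ξ (x t - y t) := by
        rw [real_inner_comm]
        simp only [inner_sub_left, inner_sub_right]
        ring
      rw [e]
      linarith) ht
  simp only [intervalIntegral.integral_zero, zero_mul] at key
  have h1 : ‖x t - y t‖ = 0 := by
    have := sq_nonneg ‖x t - y t‖
    exact pow_eq_zero_iff two_ne_zero |>.1 (le_antisymm key this)
  exact sub_eq_zero.1 (norm_eq_zero.1 h1)

end IsSolution

end Uniqueness

/-! ### The error quantity -/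

namespace Params

/-- The signs of the constants of a scheme, which hold as soon as the scheme has a run. -/
structure IsNonneg (P : Params) : Prop where
  T_pos : 0 < P.T
  LC_nonneg : 0 ≤ P.LC
  α_nonneg : 0 ≤ P.α
  K₂_pos : 0 < P.K₂
  K₃_nonneg : 0 ≤ P.K₃
  c_nonneg : 0 ≤ P.c

/-- The quantity that controls the rate of convergence. -/
noncomputable def gauge (ε η μ : ℝ) : ℝ := √ε + η + μ + √ε / μ + η / μ + √(η / μ)

/-- An upper bound of the gauge. -/
noncomputable def gaugeBound (P : Params) : ℝ := 2 * (P.c * P.T) + P.T + 2 * P.c + √P.c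

variable {P : Params} {ε η μ : ℝ}

theorem sqrt_le_gauge (hη : 0 < η) (hμ : 0 < μ) :
    √ε ≤ gauge ε η μ ∧ η ≤ gauge ε η μ ∧ μ ≤ gauge ε η μ ∧ η / μ ≤ gauge ε η μ := by
  have h1 : 0 ≤ √ε := Real.sqrt_nonneg _
  have h2 : 0 ≤ √ε / μ := by positivity
  have h3 : 0 ≤ η / μ := by positivity
  have h4 : 0 ≤ √(η / μ) := Real.sqrt_nonneg _
  unfold gauge
  refine ⟨?_, ?_, ?_, ?_⟩ <;> linarith

/-- `√σ / μ` is of the order of the gauge: this is where the term `√(η / μ)` comes from. -/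
theorem sqrt_σ_le (hP : P.IsNonneg) (hε : 0 < ε) (hη : 0 < η) (hμ : 0 < μ) :
    √(P.σ ε η μ) ≤ μ * ((2 + √(2 * P.K₃)) * gauge ε η μ) := by
  have hK := hP.K₃_nonneg
  have h1 : √ε ^ 2 = ε := Real.sq_sqrt hε.le
  have h2 : √(2 * P.K₃) ^ 2 = 2 * P.K₃ := Real.sq_sqrt (by positivity)
  have h3 : √(η / μ) ^ 2 = η / μ := Real.sq_sqrt (by positivity)
  set b := √(2 * P.K₃) with hb
  set q := √(η / μ) with hq
  have hb0 : 0 ≤ b := Real.sqrt_nonneg _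
  have hq0 : 0 ≤ q := Real.sqrt_nonneg _
  have hr0 : 0 ≤ √ε := Real.sqrt_nonneg _
  have h4 : √(P.σ ε η μ) ≤ 2 * √ε + b * q * μ + 2 * η := by
    refine Real.sqrt_le_iff.2 ⟨by positivity, ?_⟩
    have h5 : (b * q * μ) ^ 2 = 2 * P.K₃ * η * μ := by
      rw [mul_pow, mul_pow, h2, h3]; field_simp
    have h6 : 0 ≤ 2 * (2 * √ε) * (b * q * μ) + 2 * (2 * √ε) * (2 * η) + 2 * (b * q * μ) * (2 * η)
      := by positivity
    rw [Params.σ]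
    linarith
  refine h4.trans ?_
  have h7 : 2 * √ε + b * q * μ + 2 * η = μ * (2 * (√ε / μ) + b * q + 2 * (η / μ)) := by
    field_simp
  rw [h7]
  refine mul_le_mul_of_nonneg_left ?_ hμ.le
  have h8 : 0 ≤ √ε / μ := by positivity
  have h9 : 0 ≤ η / μ := by positivity
  have h10 : q ≤ gauge ε η μ := by unfold gauge; linarith
  have h11 : √ε / μ + η / μ ≤ gauge ε η μ := by unfold gauge; linarith
  have h12 := mul_le_mul_of_nonneg_left h10 hb0
  linarith

theorem gauge_le (hP : P.IsNonneg) (hη : 0 < η) (hμ : 0 < μ) (hμT : μ ≤ P.T)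
    (hc : √ε + η ≤ P.c * μ) : gauge ε η μ ≤ P.gaugeBound := by
  have h1 : 0 ≤ √ε := Real.sqrt_nonneg _
  have h2 : P.c * μ ≤ P.c * P.T := mul_le_mul_of_nonneg_left hμT hP.c_nonneg
  have h3 : √ε / μ ≤ P.c := by rw [div_le_iff₀ hμ]; linarith
  have h4 : η / μ ≤ P.c := by rw [div_le_iff₀ hμ]; linarith
  have h5 : √(η / μ) ≤ √P.c := Real.sqrt_le_sqrt h4
  unfold gauge gaugeBound
  linarith

/-- The error quantity is of the order of the gauge. -/
theorem exists_errA_le (hP : P.IsNonneg) {q Γ κ : ℝ} (hq : 0 ≤ q) (hΓ : 0 ≤ Γ) (hκ : 0 ≤ κ) :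
    ∃ D : ℝ, 0 < D ∧ ∀ ε η μ : ℝ, 0 < ε → 0 < η → 0 < μ → μ ≤ P.T → √ε + η ≤ P.c * μ →
      P.errA q Γ κ ε η μ ≤ D * gauge ε η μ := by
  have hT := hP.T_pos
  have hLC := hP.LC_nonneg
  have hα := hP.α_nonneg
  have hK2 := hP.K₂_pos
  have hc0 := hP.c_nonneg
  have hK4 : 0 ≤ P.K₄ := by unfold K₄; positivity
  have hK5 : 0 ≤ P.K₅ := by unfold K₅; positivity
  have hK7 : 0 ≤ P.K₇ := by unfold K₇; positivity
  set β := 2 + √(2 * P.K₃) with hβ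
  have hβ0 : 0 ≤ β := by positivity
  set Ŝ := P.gaugeBound with hŜ
  have hŜ0 : 0 ≤ Ŝ := by rw [hŜ]; unfold gaugeBound; positivity
  refine ⟨4 * P.α * P.T * (2 * (P.T * β) + 1 + 2 + P.K₄)
    + 4 * P.T * P.K₇ * (P.K₅ + 2 * (1 + P.T * β) + 3) + 4 * P.T * Γ * P.LC
    + 2 * P.T * (3 * β + 1) * (2 * (P.T * (β * Ŝ)) + P.c * P.T + 2 * P.K₂)
    + 16 * P.T * Γ * q * (2 * (1 + P.T * β) + 3 + P.K₅) ^ 2 * Ŝ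
    + 4 * κ * (3 + 3 + (P.K₄ + P.K₅)) ^ 2 * Ŝ + 1, by positivity, ?_⟩
  intro ε η μ hε hη hμ hμT hc
  obtain ⟨hr, hηS, hμS, hημ⟩ := sqrt_le_gauge (ε := ε) hη hμ
  have hSb := gauge_le hP hη hμ hμT hc
  have hsμ := sqrt_σ_le hP hε hη hμ
  rw [← hβ] at hsμ
  rw [← hŜ] at hSb
  set S := gauge ε η μ with hS
  set s := √(P.σ ε η μ) with hs
  have hs0 : 0 ≤ s := Real.sqrt_nonneg _
  have hr0 : 0 ≤ √ε := Real.sqrt_nonneg _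
  have hS0 : 0 ≤ S := hμ.le.trans hμS
  have hsT : s ≤ P.T * β * S := hsμ.trans (by rw [← mul_assoc]; gcongr)
  have hsb : s ≤ P.T * (β * Ŝ) := hsμ.trans (by gcongr)
  have hηb : η ≤ P.c * P.T := by
    have := mul_le_mul_of_nonneg_left hμT hc0
    linarith
  have hSS : S ^ 2 ≤ Ŝ * S := by rw [sq]; gcongr
  have h1 : 4 * P.α * P.T * (2 * s + √ε + 2 * η + P.K₄ * μ)
      ≤ 4 * P.α * P.T * (2 * (P.T * β * S) + S + 2 * S + P.K₄ * S) := by gcongr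
  have h2 : 4 * P.T * P.K₇ * (P.K₅ * μ + 2 * (√ε + s) + 3 * η)
      ≤ 4 * P.T * P.K₇ * (P.K₅ * S + 2 * (S + P.T * β * S) + 3 * S) := by gcongr
  have h3 : 4 * P.T * Γ * P.LC * μ ≤ 4 * P.T * Γ * P.LC * S := by gcongr
  have h4 : 2 * P.T * ((3 * s + η) / μ) * (2 * s + η + 2 * P.K₂)
      ≤ 2 * P.T * ((3 * β + 1) * S) * (2 * (P.T * (β * Ŝ)) + P.c * P.T + 2 * P.K₂) := by
    have h5 : (3 * s + η) / μ ≤ (3 * β + 1) * S := by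
      have h6 : s / μ ≤ β * S := by rw [div_le_iff₀ hμ]; linarith
      rw [add_div, mul_div_assoc]
      linarith
    gcongr
  have h5 : (2 * (√ε + s) + 3 * η + P.K₅ * μ) ^ 2
      ≤ (2 * (1 + P.T * β) + 3 + P.K₅) ^ 2 * (Ŝ * S) := by
    calc (2 * (√ε + s) + 3 * η + P.K₅ * μ) ^ 2
        ≤ (2 * (S + P.T * β * S) + 3 * S + P.K₅ * S) ^ 2 := by gcongr
      _ = (2 * (1 + P.T * β) + 3 + P.K₅) ^ 2 * S ^ 2 := by ring
      _ ≤ _ := by gcongr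
  have h6 : (3 * √ε + 3 * η + (P.K₄ + P.K₅) * μ) ^ 2
      ≤ (3 + 3 + (P.K₄ + P.K₅)) ^ 2 * (Ŝ * S) := by
    calc (3 * √ε + 3 * η + (P.K₄ + P.K₅) * μ) ^ 2
        ≤ (3 * S + 3 * S + (P.K₄ + P.K₅) * S) ^ 2 := by gcongr
      _ = (3 + 3 + (P.K₄ + P.K₅)) ^ 2 * S ^ 2 := by ring
      _ ≤ _ := by gcongr
  have h7 := mul_le_mul_of_nonneg_left h5 (by positivity : 0 ≤ 16 * P.T * Γ * q)
  have h8 := mul_le_mul_of_nonneg_left h6 (by positivity : 0 ≤ 4 * κ)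
  unfold errA
  rw [← hs]
  linarith

/-- The contribution of the second approximate solution to the comparison of two of them. -/
noncomputable def remainder (P : Params) (q Γ κ D μ a w e d : ℝ) : ℝ :=
  P.T * (2 * P.K₇ * (a + w) + 2 * e * (2 * P.K₂ + w) + 2 * Γ * d
    + 4 * Γ * q * ((a + w + P.LC * μ) ^ 2 + d ^ 2) + 2 * (P.K₇ + e) * (P.LC * μ) + 2 * e * D
    + 4 * P.α * a) + 8 * a ^ 2 * κ

open IsApproxSolution in
/-- The error in the comparison of two approximate solutions is at most the error quantity of the
first one plus a remainder that involves the second one only. -/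
theorem pairError_le (hP : P.IsNonneg) {q Γ κ D μ' a' w' e' d' : ℝ} (hq : 0 ≤ q) (hΓ : 0 ≤ Γ)
    (hκ : 0 ≤ κ) (hη : 0 < η) (hμ : 0 < μ) (he' : 0 ≤ e')
    (hD : P.K₄ * μ + √ε + 2 * η + P.LC * μ ≤ D) :
    P.T * pairError P.LC P.α P.K₇ P.K₂ Γ q μ (P.K₄ * μ + √ε + η) (2 * √(P.σ ε η μ) + η)
        ((3 * √(P.σ ε η μ) + η) / μ) (P.K₄ * μ + √ε + 2 * η + P.LC * μ) μ' a' w' e' d'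
      + 8 * ((P.K₄ * μ + √ε + η) ^ 2 + a' ^ 2) * κ
      ≤ P.errA q Γ κ ε η μ + P.remainder q Γ κ D μ' a' w' e' d' := by
  have hT := hP.T_pos
  have hLC := hP.LC_nonneg
  have hα := hP.α_nonneg
  have hK2 := hP.K₂_pos
  have hc0 := hP.c_nonneg
  have hK4 : 0 ≤ P.K₄ := by unfold K₄; positivity
  have hK5 : P.K₅ = 2 * P.K₄ := by unfold K₅ K₄; ring
  have hLC4 : P.LC ≤ P.K₄ := by unfold K₄; linarith
  have hK7 : 0 ≤ P.K₇ := by unfold K₇; positivity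
  set s := √(P.σ ε η μ) with hs
  set r := √ε with hr
  set K := P.K₄ with hK
  have hs0 : 0 ≤ s := Real.sqrt_nonneg _
  have hr0 : 0 ≤ r := Real.sqrt_nonneg _
  have hKμ : 0 ≤ K * μ := by positivity
  have hLμ : P.LC * μ ≤ K * μ := by gcongr
  have hLμ0 : 0 ≤ P.LC * μ := by positivity
  set d := K * μ + r + 2 * η + P.LC * μ with hd
  have h1 : 2 * P.K₇ * ((K * μ + r + η) + (2 * s + η) + d)
      ≤ 4 * P.K₇ * (2 * K * μ + 2 * (r + s) + 3 * η) := by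
    have : (K * μ + r + η) + (2 * s + η) + d ≤ 2 * (2 * K * μ + 2 * (r + s) + 3 * η) := by
      rw [hd]; linarith
    have := mul_le_mul_of_nonneg_left this (by positivity : 0 ≤ 2 * P.K₇)
    linarith
  have h2 : 2 * Γ * (P.LC * μ) ≤ 4 * Γ * P.LC * μ := by
    have : 0 ≤ Γ * (P.LC * μ) := by positivity
    linarith
  have h3 : 4 * P.α * (K * μ + r + η) ≤ 4 * P.α * (2 * s + r + 2 * η + K * μ) :=
    mul_le_mul_of_nonneg_left (by linarith) (by positivity)
  have h4 : (K * μ + r + η + (2 * s + η) + P.LC * μ) ^ 2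
      ≤ (2 * (r + s) + 3 * η + 2 * K * μ) ^ 2 :=
    pow_le_pow_left₀ (by positivity) (by linarith) 2
  have h5 : d ^ 2 ≤ (2 * (r + s) + 3 * η + 2 * K * μ) ^ 2 :=
    pow_le_pow_left₀ (by positivity) (by linarith) 2
  have h6 : 4 * Γ * q * ((K * μ + r + η + (2 * s + η) + P.LC * μ) ^ 2 + d ^ 2)
      ≤ 16 * Γ * q * (2 * (r + s) + 3 * η + 2 * K * μ) ^ 2 := by
    have h7 := mul_le_mul_of_nonneg_left (add_le_add h4 h5) (by positivity : 0 ≤ 4 * Γ * q)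
    have : 0 ≤ Γ * q * (2 * (r + s) + 3 * η + 2 * K * μ) ^ 2 := by positivity
    linarith
  have h7 : 8 * (K * μ + r + η) ^ 2 * κ ≤ 4 * κ * (3 * r + 3 * η + (K + 2 * K) * μ) ^ 2 := by
    have e : 4 * κ * (3 * r + 3 * η + (K + 2 * K) * μ) ^ 2 = 36 * ((K * μ + r + η) ^ 2 * κ) := by
      ring
    have : 0 ≤ (K * μ + r + η) ^ 2 * κ := by positivity
    linarith
  have h8 : 2 * e' * d ≤ 2 * e' * D := by gcongr
  have h9 : P.T * (2 * P.K₇ * ((K * μ + r + η) + (2 * s + η) + d) + 2 * Γ * (P.LC * μ)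
      + 4 * P.α * (K * μ + r + η)
      + 4 * Γ * q * ((K * μ + r + η + (2 * s + η) + P.LC * μ) ^ 2 + d ^ 2) + 2 * e' * d)
      ≤ P.T * (4 * P.K₇ * (2 * K * μ + 2 * (r + s) + 3 * η) + 4 * Γ * P.LC * μ
      + 4 * P.α * (2 * s + r + 2 * η + K * μ)
      + 16 * Γ * q * (2 * (r + s) + 3 * η + 2 * K * μ) ^ 2 + 2 * e' * D) :=
    mul_le_mul_of_nonneg_left (by linarith) hT.le
  generalize hX : (K * μ + r + η + (2 * s + η) + P.LC * μ) ^ 2 = X at *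
  generalize hY : (2 * (r + s) + 3 * η + 2 * K * μ) ^ 2 = Y at *
  generalize hZ : (3 * r + 3 * η + (K + 2 * K) * μ) ^ 2 = Z at *
  generalize hW : (K * μ + r + η) ^ 2 = W at *
  generalize hE : (3 * s + η) / μ = E at *
  generalize hd2 : d ^ 2 = d2 at *
  generalize hm : (a' + w' + P.LC * μ') ^ 2 = m at *
  unfold pairError errA remainder
  rw [hK5, ← hs, ← hr, ← hK, hX, hY, hZ, hd2, hm, hE]
  linarith

end Params

/-! ### Convergence of the algorithm -/

section Convergence

variable {H : Type*} [NormedAddCommGroup H] [InnerProductSpace ℝ H]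
  {T : ℝ} {C : ℝ → Set H} {LC : ℝ≥0} {x₀ : H} {h : H → ℝ} {Lh : ℝ≥0} {γ : ℝ} {f : ℝ → H → H}

theorem IsCatchingUpRun.params_isNonneg {n : ℕ} {ε η : ℝ} {p : ℕ → H} {X : ℝ → H}
    (R : IsCatchingUpRun T C f x₀ n ε η p X) (D : IsDrivenSweeping T C LC x₀ h Lh γ f) {c : ℝ}
    (hc : (√ε + η) / (T / n) ≤ c) : (params T LC x₀ h Lh γ c).IsNonneg :=
  ⟨D.pos, LC.2, R.α_nonneg D hc, R.K₂_pos D hc, R.K₃_nonneg D hc, (R.c_pos D hc).le⟩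

open IsCatchingUpRun (params)

namespace IsInexactCatchingUp

variable {ε η : ℕ → ℝ} {p : ℕ → ℕ → H} {X : ℕ → ℝ → H}
  (hX : IsInexactCatchingUp T C f x₀ ε η p X)
include hX

theorem exists_bound_tolerances (hT : 0 < T) :
    ∃ c : ℝ, ∀ n : ℕ, 1 ≤ n → (√(ε n) + η n) / (T / n) ≤ c := by
  have h1 := (hX.eps_lim.sqrt).add hX.eta_lim
  obtain ⟨c, hc⟩ := h1.bddAbove_range
  refine ⟨c, fun n hn => ?_⟩
  have hn0 : (0 : ℝ) < n := by exact_mod_cast hn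
  have h2 : √(ε n / (T / n) ^ 2) = √(ε n) / (T / n) := by
    rw [Real.sqrt_div' _ (by positivity), Real.sqrt_sq (by positivity)]
  have h3 := hc (mem_range_self n)
  simp only [h2] at h3
  rwa [add_div]

/-- The errors of the algorithm that enter the estimates tend to zero. -/
theorem tendsto_errors (hT : 0 < T) {P : Params} (hP : P.IsNonneg) :
    Tendsto (fun n : ℕ => T / n) atTop (𝓝 0) ∧ Tendsto (fun n => √(ε n)) atTop (𝓝 0) ∧
      Tendsto η atTop (𝓝 0) ∧ Tendsto (fun n : ℕ => √(P.σ (ε n) (η n) (T / n))) atTop (𝓝 0) ∧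
      Tendsto (fun n : ℕ => (3 * √(P.σ (ε n) (η n) (T / n)) + η n) / (T / n)) atTop (𝓝 0) := by
  have hμ : Tendsto (fun n : ℕ => T / n) atTop (𝓝 0) := tendsto_const_div_atTop_nhds_zero_nat T
  have hpos : ∀ᶠ n : ℕ in atTop, 1 ≤ n ∧ 0 < T / n := by
    filter_upwards [eventually_ge_atTop 1] with n hn
    exact ⟨hn, div_pos hT (by exact_mod_cast hn)⟩
  have hεμ : Tendsto (fun n : ℕ => √(ε n) / (T / n)) atTop (𝓝 0) := by
    refine (by simpa using hX.eps_lim.sqrt : Tendsto (fun n : ℕ => √(ε n / (T / n) ^ 2)) atTop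
      (𝓝 0)).congr' ?_
    filter_upwards [hpos] with n hn
    rw [Real.sqrt_div' _ (by positivity), Real.sqrt_sq hn.2.le]
  have hε : Tendsto (fun n => √(ε n)) atTop (𝓝 0) := by
    refine (by simpa using hεμ.mul hμ : Tendsto (fun n : ℕ => √(ε n) / (T / n) * (T / n)) atTop
      (𝓝 0)).congr' ?_
    filter_upwards [hpos] with n hn using div_mul_cancel₀ _ hn.2.ne'
  have hη : Tendsto η atTop (𝓝 0) := by
    refine (by simpa using hX.eta_lim.mul hμ : Tendsto (fun n : ℕ => η n / (T / n) * (T / n)) atTop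
      (𝓝 0)).congr' ?_
    filter_upwards [hpos] with n hn using div_mul_cancel₀ _ hn.2.ne'
  have hgauge : Tendsto (fun n : ℕ => (2 + √(2 * P.K₃)) * Params.gauge (ε n) (η n) (T / n)) atTop
      (𝓝 0) := by
    simpa [Params.gauge] using
      (((((hε.add hη).add hμ).add hεμ).add hX.eta_lim).add hX.eta_lim.sqrt).const_mul
        (2 + √(2 * P.K₃))
  have hσ : ∀ᶠ n : ℕ in atTop, √(P.σ (ε n) (η n) (T / n))
      ≤ T / n * ((2 + √(2 * P.K₃)) * Params.gauge (ε n) (η n) (T / n)) := by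
    filter_upwards [hpos] with n hn
    exact Params.sqrt_σ_le hP (hX.eps_pos n hn.1) (hX.eta_pos n hn.1) hn.2
  have hσμ : Tendsto (fun n : ℕ => √(P.σ (ε n) (η n) (T / n)) / (T / n)) atTop (𝓝 0) := by
    refine tendsto_of_tendsto_of_tendsto_of_le_of_le' tendsto_const_nhds hgauge ?_ ?_
    · filter_upwards [hpos] with n hn using div_nonneg (Real.sqrt_nonneg _) hn.2.le
    · filter_upwards [hpos, hσ] with n hn hσn using (div_le_iff₀' hn.2).2 hσn
  refine ⟨hμ, hε, hη, ?_, ?_⟩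
  · refine tendsto_of_tendsto_of_tendsto_of_le_of_le' tendsto_const_nhds
      (by simpa using hμ.mul hgauge) (Eventually.of_forall fun n => Real.sqrt_nonneg _) hσ
  · simpa [add_div, mul_div_assoc] using (hσμ.const_mul 3).add hX.eta_lim

theorem tendsto_errA (hT : 0 < T) {P : Params} (hP : P.IsNonneg) (q Γ κ : ℝ) :
    Tendsto (fun n : ℕ => P.errA q Γ κ (ε n) (η n) (T / n)) atTop (𝓝 0) := by
  obtain ⟨hμ, hε, hη, hσ, he⟩ := hX.tendsto_errors hT hP
  have hcont : Continuous fun z : ℝ × ℝ × ℝ × ℝ × ℝ =>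
      4 * P.α * P.T * (2 * z.2.2.2.1 + z.2.1 + 2 * z.2.2.1 + P.K₄ * z.1)
      + 4 * P.T * P.K₇ * (P.K₅ * z.1 + 2 * (z.2.1 + z.2.2.2.1) + 3 * z.2.2.1)
      + 4 * P.T * Γ * P.LC * z.1
      + 2 * P.T * z.2.2.2.2 * (2 * z.2.2.2.1 + z.2.2.1 + 2 * P.K₂)
      + 16 * P.T * Γ * q * (2 * (z.2.1 + z.2.2.2.1) + 3 * z.2.2.1 + P.K₅ * z.1) ^ 2
      + 4 * κ * (3 * z.2.1 + 3 * z.2.2.1 + (P.K₄ + P.K₅) * z.1) ^ 2 := by fun_prop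
  have hlim := (hcont.tendsto (0, 0, 0, 0, 0)).comp
    (hμ.prodMk_nhds (hε.prodMk_nhds (hη.prodMk_nhds (hσ.prodMk_nhds he))))
  simpa [Function.comp_def, Params.errA] using hlim

theorem tendsto_remainder (hT : 0 < T) {P : Params} (hP : P.IsNonneg) (q Γ κ D : ℝ) :
    Tendsto (fun n : ℕ => P.remainder q Γ κ D (T / n) (P.K₄ * (T / n) + √(ε n) + η n)
      (2 * √(P.σ (ε n) (η n) (T / n)) + η n)
      ((3 * √(P.σ (ε n) (η n) (T / n)) + η n) / (T / n))
      (P.K₄ * (T / n) + √(ε n) + 2 * η n + P.LC * (T / n))) atTop (𝓝 0) := by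
  obtain ⟨hμ, hε, hη, hσ, he⟩ := hX.tendsto_errors hT hP
  have hcont : Continuous fun z : ℝ × ℝ × ℝ × ℝ × ℝ =>
      P.remainder q Γ κ D z.1 (P.K₄ * z.1 + z.2.1 + z.2.2.1) (2 * z.2.2.2.1 + z.2.2.1) z.2.2.2.2
        (P.K₄ * z.1 + z.2.1 + 2 * z.2.2.1 + P.LC * z.1) := by
    unfold Params.remainder
    fun_prop
  have hlim := (hcont.tendsto (0, 0, 0, 0, 0)).comp
    (hμ.prodMk_nhds (hε.prodMk_nhds (hη.prodMk_nhds (hσ.prodMk_nhds he))))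
  have h0 : P.remainder q Γ κ D 0 (P.K₄ * 0 + 0 + 0) (2 * 0 + 0) 0
      (P.K₄ * 0 + 0 + 2 * 0 + P.LC * 0) = 0 := by simp [Params.remainder]
  rw [← h0]
  exact hlim

/-- The proximal normals of all the runs have a common bound, since the errors `√σ` are of the order
of the step. -/
theorem exists_bound_normal (D : IsDrivenSweeping T C LC x₀ h Lh γ f) {c : ℝ}
    (hc : ∀ n : ℕ, 1 ≤ n → (√(ε n) + η n) / (T / n) ≤ c) :
    ∃ Γ : ℝ, ∀ n : ℕ, 1 ≤ n → ∀ j < n, (4 * √((params T LC x₀ h Lh γ c).σ (ε n) (η n) (T / n))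
      + (LC + h (p n j) + √γ) * (T / n) + η n) / (T / n) ≤ Γ := by
  set P := params T LC x₀ h Lh γ c with hPdef
  refine ⟨4 * ((2 + √(2 * P.K₃)) * P.gaugeBound) + (LC + P.α) + c, fun n hn j hj => ?_⟩
  have R := hX.run hn
  have hP : P.IsNonneg := R.params_isNonneg D (hc n hn)
  have hμ := R.step_pos D.pos
  have h1 := R.h_node_le D (hc n hn) hj.le
  have h2 := R.sqrt_add_le D (hc n hn)
  have h3 := Params.gauge_le hP R.eta_pos hμ (R.step_le D.pos) h2
  have h4 := Params.sqrt_σ_le hP R.eps_pos R.eta_pos hμ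
  have h5 : T / n * ((2 + √(2 * P.K₃)) * Params.gauge (ε n) (η n) (T / n))
      ≤ T / n * ((2 + √(2 * P.K₃)) * P.gaugeBound) := by gcongr
  have h6 := mul_le_mul_of_nonneg_right h1 hμ.le
  have h7 := Real.sqrt_nonneg (ε n)
  rw [div_le_iff₀ hμ]
  linarith

end IsInexactCatchingUp

section Estimate

variable [CompleteSpace H] {ρ : ℝ≥0∞} {F : ℝ → H → Set H} {k : ℝ → ℝ → ℝ} {c Γ : ℝ}

/-- The comparison of two runs of the algorithm. The error of the second run enters only through the
remainder, where the constant `P.K₄ * T + 2 * (c * T) + LC * T` bounds the distance of the first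
interpolant to the moving set. -/
theorem IsCatchingUpRun.norm_sub_sq_le {n m : ℕ} {ε η ε' η' : ℝ} {p p' : ℕ → H} {X X' : ℝ → H}
    (R : IsCatchingUpRun T C f x₀ n ε η p X) (R' : IsCatchingUpRun T C f x₀ m ε' η' p' X')
    (D : IsDrivenSweeping T C LC x₀ h Lh γ f)
    (hC_prox : ∀ t ∈ Icc 0 T, IsUniformlyProxRegular ρ (C t))
    (hf : ∀ t ∈ Icc 0 T, ∀ x, f t x ∈ F t x)
    (hk_nonneg : ∀ r, 0 < r → ∀ t ∈ Icc 0 T, 0 ≤ k r t)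
    (hk_int : ∀ r, 0 < r → IntegrableOn (k r) (Icc 0 T))
    (hF_mono : ∀ r, 0 < r → ∀ t ∈ Icc 0 T,
      ∀ x₁ ∈ Metric.closedBall (0 : H) r, ∀ x₂ ∈ Metric.closedBall (0 : H) r,
      ∀ v₁ ∈ F t x₁, ∀ v₂ ∈ F t x₂,
        inner ℝ (v₁ - v₂) (x₁ - x₂) ≤ k r t * ‖x₁ - x₂‖ ^ 2)
    (hc : (√ε + η) / (T / n) ≤ c) (hc' : (√ε' + η') / (T / m) ≤ c) {P : Params}
    (hP : P = params T LC x₀ h Lh γ c)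
    (hΓ : ∀ j < n, (4 * √(P.σ ε η (T / n)) + (LC + h (p j) + √γ) * (T / n) + η) / (T / n) ≤ Γ)
    (hΓ' : ∀ j < m,
      (4 * √(P.σ ε' η' (T / m)) + (LC + h (p' j) + √γ) * (T / m) + η') / (T / m) ≤ Γ)
    {κ : ℝ} (hκ : κ = ∫ s in (0 : ℝ)..T, k P.K₂ s) {t : ℝ} (ht : t ∈ Icc 0 T) :
    ‖X t - X' t‖ ^ 2 ≤ (P.errA ρ⁻¹.toReal Γ κ ε η (T / n)
      + P.remainder ρ⁻¹.toReal Γ κ (P.K₄ * T + 2 * (c * T) + LC * T) (T / m)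
          (P.K₄ * (T / m) + √ε' + η') (2 * √(P.σ ε' η' (T / m)) + η')
          ((3 * √(P.σ ε' η' (T / m)) + η') / (T / m))
          (P.K₄ * (T / m) + √ε' + 2 * η' + P.LC * (T / m)))
      * Real.exp (4 * Γ * ρ⁻¹.toReal * T + 4 * κ) := by
  subst hP
  set P := params T LC x₀ h Lh γ c with hPdef
  have hT := D.pos
  have hP : P.IsNonneg := R.params_isNonneg D hc
  obtain ⟨g, U, y, ν, V, θ, S⟩ := R.exists_isApproxSolution D hc hΓ
  obtain ⟨g', U', y', ν', V', θ', S'⟩ := R'.exists_isApproxSolution D hc' hΓ'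
  have hκ0 : 0 ≤ κ := by
    rw [hκ]
    exact intervalIntegral.integral_nonneg hT.le fun s hs => hk_nonneg _ hP.K₂_pos s hs
  have hK4 : 0 ≤ P.K₄ := by
    have h1 := hP.LC_nonneg
    have h2 := hP.α_nonneg
    unfold Params.K₄
    linarith
  have hμT := R.step_le hT
  have h1 := S.norm_sub_sq_le S' hP.α_nonneg hC_prox hf (hk_nonneg _ hP.K₂_pos)
    (hk_int _ hP.K₂_pos) (hF_mono _ hP.K₂_pos) ht hT
  rw [← hκ] at h1
  refine h1.trans (mul_le_mul_of_nonneg_right ?_ (Real.exp_nonneg _))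
  refine Params.pairError_le hP ENNReal.toReal_nonneg (S.nonneg hT).2.2.2.2.2.1 hκ0 R.eta_pos
    (R.step_pos hT) (S'.nonneg hT).2.2.1 ?_
  have h2 := R.sqrt_add_le D hc
  have h3 : c * (T / n) ≤ c * T := mul_le_mul_of_nonneg_left hμT hP.c_nonneg
  have h4 := mul_le_mul_of_nonneg_left hμT hK4
  have h5 := mul_le_mul_of_nonneg_left hμT hP.LC_nonneg
  have h6 := Real.sqrt_nonneg ε
  change P.K₄ * (T / n) + √ε + 2 * η + P.LC * (T / n) ≤ P.K₄ * T + 2 * (c * T) + P.LC * T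
  linarith

namespace IsInexactCatchingUp

variable {ε η : ℕ → ℝ} {p : ℕ → ℕ → H} {X : ℕ → ℝ → H}

/-- The error of the algorithm with `n` steps with respect to the limit of the algorithm: the
comparison with a run of `m` steps, as `m` tends to infinity. -/
theorem norm_sub_sq_le_of_tendsto (hX : IsInexactCatchingUp T C f x₀ ε η p X)
    (D : IsDrivenSweeping T C LC x₀ h Lh γ f)
    (hC_prox : ∀ t ∈ Icc 0 T, IsUniformlyProxRegular ρ (C t))
    (hf : ∀ t ∈ Icc 0 T, ∀ x, f t x ∈ F t x)
    (hk_nonneg : ∀ r, 0 < r → ∀ t ∈ Icc 0 T, 0 ≤ k r t)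
    (hk_int : ∀ r, 0 < r → IntegrableOn (k r) (Icc 0 T))
    (hF_mono : ∀ r, 0 < r → ∀ t ∈ Icc 0 T,
      ∀ x₁ ∈ Metric.closedBall (0 : H) r, ∀ x₂ ∈ Metric.closedBall (0 : H) r,
      ∀ v₁ ∈ F t x₁, ∀ v₂ ∈ F t x₂,
        inner ℝ (v₁ - v₂) (x₁ - x₂) ≤ k r t * ‖x₁ - x₂‖ ^ 2)
    (hc : ∀ n : ℕ, 1 ≤ n → (√(ε n) + η n) / (T / n) ≤ c) {P : Params}
    (hP : P = params T LC x₀ h Lh γ c)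
    (hΓ : ∀ n : ℕ, 1 ≤ n → ∀ j < n,
      (4 * √(P.σ (ε n) (η n) (T / n)) + (LC + h (p n j) + √γ) * (T / n) + η n) / (T / n) ≤ Γ)
    {κ : ℝ} (hκ : κ = ∫ s in (0 : ℝ)..T, k P.K₂ s) {t : ℝ} (ht : t ∈ Icc 0 T) {z : H}
    (hz : Tendsto (fun m => X m t) atTop (𝓝 z)) {n : ℕ} (hn : 1 ≤ n) :
    ‖X n t - z‖ ^ 2 ≤ P.errA ρ⁻¹.toReal Γ κ (ε n) (η n) (T / n)
      * Real.exp (4 * Γ * ρ⁻¹.toReal * T + 4 * κ) := by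
  have hPn : P.IsNonneg := hP ▸ (hX.run hn).params_isNonneg D (hc n hn)
  have h1 := hX.tendsto_remainder D.pos hPn ρ⁻¹.toReal Γ κ (P.K₄ * T + 2 * (c * T) + LC * T)
  have h2 := (h1.const_add (P.errA ρ⁻¹.toReal Γ κ (ε n) (η n) (T / n))).mul_const
    (Real.exp (4 * Γ * ρ⁻¹.toReal * T + 4 * κ))
  rw [add_zero] at h2
  refine le_of_tendsto_of_tendsto ((tendsto_const_nhds.sub hz).norm.pow 2) h2 ?_
  filter_upwards [eventually_ge_atTop 1] with m hm
  exact (hX.run hn).norm_sub_sq_le (hX.run hm) D hC_prox hf hk_nonneg hk_int hF_mono (hc n hn)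
    (hc m hm) hP (hΓ n hn) (hΓ m hm) hκ ht

/-- The sequence generated by the algorithm converges uniformly to a Lipschitz solution. -/
theorem exists_isSolution (hX : IsInexactCatchingUp T C f x₀ ε η p X)
    (D : IsDrivenSweeping T C LC x₀ h Lh γ f)
    (hC_prox : ∀ t ∈ Icc 0 T, IsUniformlyProxRegular ρ (C t))
    (hF_closed : ∀ t ∈ Icc 0 T, ∀ x, IsClosed (F t x))
    (hF_convex : ∀ t ∈ Icc 0 T, ∀ x, Convex ℝ (F t x))
    (hF₁ : ∀ t ∈ Icc 0 T, IsWeaklyUpperSemicontinuous (F t))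
    (hf : ∀ t ∈ Icc 0 T, ∀ x, f t x ∈ F t x)
    (hk_nonneg : ∀ r, 0 < r → ∀ t ∈ Icc 0 T, 0 ≤ k r t)
    (hk_int : ∀ r, 0 < r → IntegrableOn (k r) (Icc 0 T))
    (hF_mono : ∀ r, 0 < r → ∀ t ∈ Icc 0 T,
      ∀ x₁ ∈ Metric.closedBall (0 : H) r, ∀ x₂ ∈ Metric.closedBall (0 : H) r,
      ∀ v₁ ∈ F t x₁, ∀ v₂ ∈ F t x₂,
        inner ℝ (v₁ - v₂) (x₁ - x₂) ≤ k r t * ‖x₁ - x₂‖ ^ 2) :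
    ∃ x : ℝ → H, (∃ L : ℝ≥0, LipschitzOnWith L x (Icc 0 T)) ∧ IsSolution T C F x₀ x ∧
      TendstoUniformlyOn X x atTop (Icc 0 T) := by
  have hT := D.pos
  obtain ⟨c, hc⟩ := hX.exists_bound_tolerances hT
  obtain ⟨Γ, hΓ⟩ := hX.exists_bound_normal D hc
  set P := params T LC x₀ h Lh γ c with hPdef
  have hP : P.IsNonneg := (hX.run le_rfl).params_isNonneg D (hc 1 le_rfl)
  set κ := ∫ s in (0 : ℝ)..T, k P.K₂ s with hκ
  set q := ρ⁻¹.toReal with hq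
  set E := Real.exp (4 * Γ * q * T + 4 * κ) with hE
  have hA := hX.tendsto_errA hT hP q Γ κ
  have hR := hX.tendsto_remainder hT hP q Γ κ (P.K₄ * T + 2 * (c * T) + LC * T)
  have hcauchy : ∀ t ∈ Icc 0 T, CauchySeq fun n => X n t := fun t ht => by
    rw [cauchySeq_iff_tendsto_dist_atTop_0]
    have h1 := hA.comp (tendsto_fst (g := atTop (α := ℕ)))
    have h2 := hR.comp (tendsto_snd (f := atTop (α := ℕ)))
    rw [prod_atTop_atTop_eq] at h1 h2
    have h3 := ((h1.add h2).mul_const E).sqrt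
    simp only [add_zero, zero_mul, Real.sqrt_zero] at h3
    refine tendsto_of_tendsto_of_tendsto_of_le_of_le' tendsto_const_nhds h3
      (Eventually.of_forall fun _ => dist_nonneg) ?_
    filter_upwards [eventually_ge_atTop (1, 1)] with ⟨n, m⟩ hnm
    rw [dist_eq_norm]
    exact Real.le_sqrt_of_sq_le ((hX.run hnm.1).norm_sub_sq_le (hX.run hnm.2) D hC_prox hf
      hk_nonneg hk_int hF_mono (hc n hnm.1) (hc m hnm.2) hPdef (hΓ n hnm.1) (hΓ m hnm.2) hκ ht)
  choose! y hy using fun t ht => cauchySeq_tendsto_of_complete (hcauchy t ht)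
  have happrox : ∀ i : ℕ, _ := fun i =>
    (hX.run (Nat.le_add_left 1 i)).exists_isApproxSolution D (hc _ (Nat.le_add_left 1 i))
      (hΓ _ (Nat.le_add_left 1 i))
  choose g U u ν V θ S using happrox
  obtain ⟨hμ, hε, hη, hσ, he⟩ := hX.tendsto_errors hT hP
  have hshift : Tendsto (fun i : ℕ => i + 1) atTop atTop := tendsto_add_atTop_nat 1
  have ha : Tendsto (fun n : ℕ => P.K₄ * (T / n) + √(ε n) + η n) atTop (𝓝 0) := by
    simpa using ((hμ.const_mul P.K₄).add hε).add hη
  have hw : Tendsto (fun n : ℕ => 2 * √(P.σ (ε n) (η n) (T / n)) + η n) atTop (𝓝 0) := by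
    simpa using (hσ.const_mul 2).add hη
  obtain ⟨z, hzy, hzL, hz⟩ := exists_isSolution_of_tendsto hT D.lip hC_prox hF_closed hF_convex hF₁
    hf S (hμ.comp hshift) (ha.comp hshift) (hw.comp hshift) (he.comp hshift)
    fun t ht => (hy t ht).comp hshift
  refine ⟨z, hzL, hz, ?_⟩
  have h3 := (hA.mul_const E).sqrt
  simp only [zero_mul, Real.sqrt_zero] at h3
  rw [Metric.tendstoUniformlyOn_iff]
  intro r hr
  filter_upwards [h3.eventually (gt_mem_nhds hr), eventually_ge_atTop 1] with n hnr hn t ht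
  rw [dist_comm, dist_eq_norm, hzy ht]
  exact (Real.le_sqrt_of_sq_le (hX.norm_sub_sq_le_of_tendsto D hC_prox hf hk_nonneg hk_int hF_mono
    hc hPdef hΓ hκ ht (hy t ht) hn)).trans_lt hnr

/-- The rate of convergence of the algorithm. -/
theorem norm_sub_sq_le_and_exists_errA_le (hX : IsInexactCatchingUp T C f x₀ ε η p X)
    (D : IsDrivenSweeping T C LC x₀ h Lh γ f)
    (hC_prox : ∀ t ∈ Icc 0 T, IsUniformlyProxRegular ρ (C t))
    (hf : ∀ t ∈ Icc 0 T, ∀ x, f t x ∈ F t x)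
    (hk_nonneg : ∀ r, 0 < r → ∀ t ∈ Icc 0 T, 0 ≤ k r t)
    (hk_int : ∀ r, 0 < r → IntegrableOn (k r) (Icc 0 T))
    (hF_mono : ∀ r, 0 < r → ∀ t ∈ Icc 0 T,
      ∀ x₁ ∈ Metric.closedBall (0 : H) r, ∀ x₂ ∈ Metric.closedBall (0 : H) r,
      ∀ v₁ ∈ F t x₁, ∀ v₂ ∈ F t x₂,
        inner ℝ (v₁ - v₂) (x₁ - x₂) ≤ k r t * ‖x₁ - x₂‖ ^ 2)
    {x : ℝ → H} (hx : ∀ t ∈ Icc 0 T, Tendsto (fun n => X n t) atTop (𝓝 (x t)))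
    (hc : ∀ n : ℕ, 1 ≤ n → (√(ε n) + η n) / (T / n) ≤ c) {P : Params}
    (hP : P = params T LC x₀ h Lh γ c)
    (hΓ : ∀ n : ℕ, 1 ≤ n → ∀ j < n,
      (4 * √(P.σ (ε n) (η n) (T / n)) + (LC + h (p n j) + √γ) * (T / n) + η n) / (T / n) ≤ Γ)
    {κ : ℝ} (hκ : κ = ∫ s in (0 : ℝ)..T, k P.K₂ s) :
    (∀ n : ℕ, 1 ≤ n → ∀ t ∈ Icc 0 T,
      ‖X n t - x t‖ ^ 2 ≤ P.errA ρ⁻¹.toReal Γ κ (ε n) (η n) (T / n)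
        * Real.exp (16 * Γ * ρ⁻¹.toReal * T + 4 * κ)) ∧
    ∃ D : ℝ, 0 < D ∧ ∀ n : ℕ, 1 ≤ n →
      P.errA ρ⁻¹.toReal Γ κ (ε n) (η n) (T / n) ≤ D * Params.gauge (ε n) (η n) (T / n) := by
  have hT := D.pos
  have hq : 0 ≤ ρ⁻¹.toReal := ENNReal.toReal_nonneg
  have hPn : P.IsNonneg := hP ▸ (hX.run le_rfl).params_isNonneg D (hc 1 le_rfl)
  have hΓ0 : 0 ≤ Γ := by
    obtain ⟨g, U, y, ν, V, θ, S⟩ := (hX.run le_rfl).exists_isApproxSolution D (hc 1 le_rfl)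
      (hP ▸ hΓ 1 le_rfl)
    exact (S.nonneg hT).2.2.2.2.2.1
  have hκ0 : 0 ≤ κ := by
    rw [hκ]
    exact intervalIntegral.integral_nonneg hT.le fun s hs => hk_nonneg _ hPn.K₂_pos s hs
  constructor
  · intro n hn t ht
    have h1 := hX.norm_sub_sq_le_of_tendsto D hC_prox hf hk_nonneg hk_int hF_mono hc hP hΓ hκ ht
      (hx t ht) hn
    have h2 : 0 ≤ P.errA ρ⁻¹.toReal Γ κ (ε n) (η n) (T / n) :=
      nonneg_of_mul_nonneg_left ((sq_nonneg _).trans h1) (Real.exp_pos _)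
    refine h1.trans (mul_le_mul_of_nonneg_left (Real.exp_le_exp.2 ?_) h2)
    have h3 : 0 ≤ Γ * ρ⁻¹.toReal * T := by positivity
    linarith
  · obtain ⟨K, hK, hbound⟩ := Params.exists_errA_le hPn hq hΓ0 hκ0
    refine ⟨K, hK, fun n hn => ?_⟩
    have R := hX.run hn
    have hPT : P.T = T := by rw [hP]
    have hPc : P.c = c := by rw [hP]
    exact hbound _ _ _ R.eps_pos R.eta_pos (R.step_pos hT) (hPT ▸ R.step_le hT)
      (hPc ▸ R.sqrt_add_le D (hc n hn))

end IsInexactCatchingUp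

end Estimate

end Convergence

end SweepingProcess

theorem mainTheorem1 {H : Type*} [NormedAddCommGroup H] [InnerProductSpace ℝ H] [CompleteSpace H]
    (T : ℝ) (hT : 0 < T)
    -- the moving set
    (C : ℝ → Set H)
    (hC_nonempty : ∀ t ∈ Icc 0 T, (C t).Nonempty)
    (hC_closed : ∀ t ∈ Icc 0 T, IsClosed (C t))
    (LC : ℝ≥0)
    (hC_lip : ∀ t ∈ Icc 0 T, ∀ s ∈ Icc 0 T,
      Metric.hausdorffEDist (C t) (C s) ≤ ENNReal.ofReal (LC * |t - s|))
    (ρ : ℝ≥0∞) (hρ : 0 < ρ)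
    (hC_prox : ∀ t ∈ Icc 0 T, SweepingProcess.IsUniformlyProxRegular ρ (C t))
    (x₀ : H) (hx₀ : x₀ ∈ C 0)
    -- the perturbation
    (F : ℝ → H → Set H)
    (hF_nonempty : ∀ t ∈ Icc 0 T, ∀ x, (F t x).Nonempty)
    (hF_closed : ∀ t ∈ Icc 0 T, ∀ x, IsClosed (F t x))
    (hF_convex : ∀ t ∈ Icc 0 T, ∀ x, Convex ℝ (F t x))
    (hF₁ : ∀ t ∈ Icc 0 T, SweepingProcess.IsWeaklyUpperSemicontinuous (F t))
    (h : H → ℝ) (hh_nonneg : ∀ x, 0 ≤ h x) (Lh : ℝ≥0) (hh_lip : LipschitzWith Lh h)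
    (hF₂ : ∀ x, ∀ᵐ t ∂(volume.restrict (Icc 0 T)), Metric.infDist 0 (F t x) ≤ h x)
    (γ : ℝ) (hγ : 0 < γ) (f : ℝ → H → H)
    (hf_meas : ∀ x, AEStronglyMeasurable (fun t => f t x) (volume.restrict (Icc 0 T)))
    (hF₃ : ∀ t ∈ Icc 0 T, ∀ x, f t x ∈ SweepingProcess.approxProj γ (F t x) 0)
    -- the one-sided Lipschitz condition
    (k : ℝ → ℝ → ℝ)
    (hk_nonneg : ∀ r, 0 < r → ∀ t ∈ Icc 0 T, 0 ≤ k r t)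
    (hk_int : ∀ r, 0 < r → IntegrableOn (k r) (Icc 0 T))
    (hF_mono : ∀ r, 0 < r → ∀ t ∈ Icc 0 T,
      ∀ x₁ ∈ Metric.closedBall (0 : H) r, ∀ x₂ ∈ Metric.closedBall (0 : H) r,
      ∀ v₁ ∈ F t x₁, ∀ v₂ ∈ F t x₂,
        inner ℝ (v₁ - v₂) (x₁ - x₂) ≤ k r t * ‖x₁ - x₂‖ ^ 2) :
    -- uniform convergence to a Lipschitz solution, with the rate
    (∀ (ε η : ℕ → ℝ) (p : ℕ → ℕ → H) (X : ℕ → ℝ → H),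
      SweepingProcess.IsInexactCatchingUp T C f x₀ ε η p X →
      ∃ x : ℝ → H,
        (∃ L : ℝ≥0, LipschitzOnWith L x (Icc 0 T)) ∧
        SweepingProcess.IsSolution T C F x₀ x ∧
        TendstoUniformlyOn X x atTop (Icc 0 T) ∧
        ∀ c : ℝ, (∀ n : ℕ, 1 ≤ n → (√(ε n) + η n) / (T / n) ≤ c) →
          ∀ P : SweepingProcess.Params, P = ⟨T, LC, Lh, h x₀, γ, ‖x₀‖, c⟩ →
          ∀ Γ : ℝ, (∀ n : ℕ, 1 ≤ n → ∀ j < n,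
              (4 * √(P.σ (ε n) (η n) (T / n)) + (LC + h (p n j) + √γ) * (T / n) + η n) / (T / n)
                ≤ Γ) →
          ∀ κ : ℝ, κ = ∫ s in (0 : ℝ)..T, k P.K₂ s →
            (∀ n : ℕ, 2 * LC * T * ρ⁻¹.toReal < n → ∀ t ∈ Icc 0 T,
              ‖X n t - x t‖ ^ 2 ≤ P.errA ρ⁻¹.toReal Γ κ (ε n) (η n) (T / n)
                * Real.exp (16 * Γ * ρ⁻¹.toReal * T + 4 * κ)) ∧
            ∃ D : ℝ, 0 < D ∧ ∀ n : ℕ, 1 ≤ n →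
              P.errA ρ⁻¹.toReal Γ κ (ε n) (η n) (T / n)
                ≤ D * (√(ε n) + η n + T / n + √(ε n) / (T / n) + η n / (T / n)
                    + √(η n / (T / n)))) ∧
    -- uniqueness under linear growth
    ((∃ c : ℝ → ℝ, (∀ t ∈ Icc 0 T, 0 ≤ c t) ∧ IntegrableOn c (Icc 0 T) ∧
        ∀ᵐ t ∂(volume.restrict (Icc 0 T)), ∀ x, ∀ y ∈ F t x, ‖y‖ ≤ c t * (‖x‖ + 1)) →
      ∀ x y : ℝ → H, SweepingProcess.IsSolution T C F x₀ x →
        SweepingProcess.IsSolution T C F x₀ y → EqOn x y (Icc 0 T)) := by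
  have hf : ∀ t ∈ Icc 0 T, ∀ x, f t x ∈ F t x := fun t ht x => (hF₃ t ht x).1
  have D : SweepingProcess.IsDrivenSweeping T C LC x₀ h Lh γ f := by
    refine ⟨hT, hC_closed, hC_lip, hx₀, hh_nonneg, hh_lip, hf_meas, fun x => ?_⟩
    filter_upwards [hF₂ x, ae_restrict_mem measurableSet_Icc] with t hht ht
    have h1 := (hF₃ t ht x).2
    rw [zero_sub, norm_neg] at h1
    have h2 : Metric.infDist 0 (F t x) ^ 2 ≤ h x ^ 2 :=
      pow_le_pow_left₀ Metric.infDist_nonneg hht 2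
    have h3 := Real.sq_sqrt hγ.le
    have h4 := mul_nonneg (hh_nonneg x) (Real.sqrt_nonneg γ)
    refine abs_le_of_sq_le_sq' (?_ : ‖f t x‖ ^ 2 ≤ (h x + √γ) ^ 2)
      (add_nonneg (hh_nonneg x) (Real.sqrt_nonneg γ)) |>.2
    linarith [add_sq (h x) (√γ)]
  refine ⟨fun ε η p X hX => ?_, ?_⟩
  · obtain ⟨x, hxL, hx, hlim⟩ := hX.exists_isSolution D hC_prox hF_closed hF_convex hF₁ hf hk_nonneg
      hk_int hF_mono
    refine ⟨x, hxL, hx, hlim, fun c hc P hP Γ hΓ κ hκ => ?_⟩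
    obtain ⟨hrate, K, hK, hbound⟩ := hX.norm_sub_sq_le_and_exists_errA_le D hC_prox hf hk_nonneg
      hk_int hF_mono (fun t ht => hlim.tendsto_at ht) hc hP hΓ hκ
    refine ⟨fun n hn => hrate n ?_, K, hK, hbound⟩
    -- the estimate holds for all `n ≥ 1`
    have h0 : 0 ≤ 2 * LC * T * ρ⁻¹.toReal := by positivity
    exact_mod_cast h0.trans_lt hn
  · rintro ⟨c, hc0, hc, hFc⟩ x y hx hy
    exact hx.eqOn hT hC_nonempty hC_lip hC_prox hk_nonneg hk_int hF_mono hc0 hc hFc hy
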